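/- **Setup.** Let $N\ge 1$, $k\in\mathbb Z$, let $\chi$ be a Dirichlet character modulo $N$, and let $M_k(N,\chi)$ be the space of holomorphic modular forms of weight $k$ and character $\chi$ on $\Gamma_0(N)$. For $z$ in the upper half-plane put $q=e^{2\pi i z}$, $\eta(z)=q^{1/24}\prod_{n\ge1}(1-q^n)$ and $\Theta=\frac1{2\pi i}\frac{d}{dz}$. For $f=\sum_{n\ge 0} c(n)q^n$ let $f\mid V_m=\sum c(n)q^{mn}$ and $f\mid U_m=\sum c(mn)q^n$; for $D\in\mathbb Z$ let $\left(\frac{D}{\cdot}\right)$ be the Kronecker symbol and $f\otimes\left(\frac{D}{\cdot}\right)=\sum\left(\frac{D}{n}\right)c(n)q^n$. For functions $f_1,f_2$ both of weight $k$ let $[f_1,f_2]_1=k\,(f_1\,\Theta f_2-f_2\,\Theta f_1)$ be the first Rankin–Cohen bracket. Let $\nu_\eta$ be the multiplier system of $\eta$, let $r$ be odd, $l$ an integer and $\psi$ a Dirichlet character. The first Shimura lift of a form $F$ of weight $l+\frac12$ and multiplier $\psi\nu_\eta^r$ is $\mathcal S_1(F)=\sum_{n\ge1}B(n)q^n$,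 where, if $3\nmid r$ and $F=\sum a(n)q^{n/24}$, $$B(n)=\sum_{d\mid n}\psi(d)\left(\tfrac{12}{n/d}\right)d^{\,l-1}a(n^2/d^2),$$ and, if $3\mid r$ and $F=\sum a(n)q^{n/8}$, $$B(n)=\sum_{d\mid n}\psi(d)\left(\tfrac{-4}{n/d}\right)d^{\,l-1}a(n^2/d^2).$$ **Theorem.** Let $g=\sum_{n\ge0}a(n)q^n\in M_k(N,\chi)$ be a normalized Hecke eigenform, that is, $a(1)=1$ and, for every prime $p$ (including $p\mid N$), $g$ is an eigenfunction of $T_p=U_p+\chi(p)p^{k-1}V_p$. Let $\tilde g=g\mid U_2\mid V_2$. Then in each case below the series defining $\mathcal S_1$ converges on the upper half-plane and has the stated value. (1) For the following products, of weight $k+\frac12$ (so $l=k$), with $(\psi,r)$ as indicated: (a) $\psi=\chi$, $r=1$: $\ \mathcal S_1(\eta(z)g(z))=g(z)g(6z)-g(2z)g(3z)$. (b) $\psi=\chi\left(\frac{-8}{\cdot}\right)$, $r=3$: $\ \mathcal S_1\!\left(\frac{\eta(z)\eta(4z)}{\eta(2z)}g(z)\right)=\bigl(2g(z)\tilde g(2z)-g(z)g(2z)\bigr)\otimes\left(\frac{-8}{\cdot}\right)$.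 (c) $\psi=\chi\left(\frac{-4}{\cdot}\right)$, $r=3$: $\ \mathcal S_1\!\left(\frac{\eta^2(2z)}{\eta(z)}g(z)\right)=\bigl(g(z)g(2z)\bigr)\otimes\left(\frac{-4}{\cdot}\right)$. (d) $\psi=\chi\left(\frac{12}{\cdot}\right)$, $r=1$: $\ \mathcal S_1\!\left(\frac{\eta(2z)\eta^2(3z)}{\eta(z)\eta(6z)}g(z)\right)=\bigl(g(z)g(6z)+g(2z)g(3z)\bigr)\otimes\left(\frac{12}{\cdot}\right)$. (e) $\psi=\chi\left(\frac{8}{\cdot}\right)$, $r=1$: $\ \mathcal S_1\!\left(\frac{\eta^3(2z)}{\eta(z)\eta(4z)}g(z)\right)=\bigl(2g(z)\tilde g(6z)-g(z)g(6z)\bigr)\otimes\left(\frac{8}{\cdot}\right)-\Bigl(g(2z)\cdot\bigl(g(3z)\otimes\left(\tfrac{-4}{\cdot}\right)\bigr)\Bigr)\otimes\left(\frac{-8}{\cdot}\right)$. (f) $\psi=\chi\left(\frac{24}{\cdot}\right)$, $r=1$: $\ \mathcal S_1\!\left(\frac{\eta(z)\eta(4z)\eta^5(6z)}{\eta^2(2z)\eta^2(3z)\eta^2(12z)}g(z)\right)=\bigl(2g(z)\tilde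 g(6z)-g(z)g(6z)\bigr)\otimes\left(\frac{24}{\cdot}\right)+\Bigl(g(2z)\cdot\bigl(g(3z)\otimes\left(\tfrac{-4}{\cdot}\right)\bigr)\Bigr)\otimes\left(\frac{-24}{\cdot}\right)$. (2) For the following products, of weight $k+\frac32$ (so $l=k+1$), with $(\psi,r)$ as indicated: (a) $\psi=\chi$, $r=3$: $\ \mathcal S_1(\eta^3(z)g(z))=\frac1k[g(2z),g(z)]_1$. (b) $\psi=\chi\left(\frac{8}{\cdot}\right)$, $r=3$: $\ \mathcal S_1\!\left(\frac{\eta^9(2z)}{\eta^3(z)\eta^3(4z)}g(z)\right)=\frac1k\bigl(2[\tilde g(2z),g(z)]_1-[g(2z),g(z)]_1\bigr)\otimes\left(\frac{8}{\cdot}\right)$. (c) $\psi=\chi\left(\frac{-4}{\cdot}\right)$, $r=1$: $\ \mathcal S_1\!\left(\frac{\eta^5(z)}{\eta^2(2z)}g(z)\right)=\frac1k\bigl([g(6z),g(z)]_1+[g(3z),g(2z)]_1\bigr)\otimes\left(\frac{-4}{\cdot}\right)$. (d) $\psi=\chi\left(\frac{-8}{\cdot}\right)$, $r=1$: $\ \mathcal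 S_1\!\left(\frac{\eta^{13}(2z)}{\eta^5(z)\eta^5(4z)}g(z)\right)=\frac1k\bigl(2[\tilde g(6z),g(z)]_1-[g(6z),g(z)]_1\bigr)\otimes\left(\frac{-8}{\cdot}\right)+\frac1k\Bigl[g(3z)\otimes\left(\tfrac{-4}{\cdot}\right),\,g(2z)\Bigr]_1\otimes\left(\frac{8}{\cdot}\right)$. (Here $k\ge1$ automatically, since $a(1)=1$ excludes $k\le 0$.) -/

import Mathlib

open UpperHalfPlane CongruenceSubgroup
open scoped MatrixGroups ModularForm

noncomputable section

namespace EtaShimura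

/-- The space `M_k(N, χ)`: the modular forms `f` of weight `k` on `Γ₁(N)` such that
`f ∣[k] γ = χ(d) f` for every `γ = (a b; c d)` in `Γ₀(N)`. -/
def formsWithCharacter (N : ℕ) (k : ℤ) (χ : DirichletCharacter ℂ N) :
    Submodule ℂ (ModularForm ((Gamma1 N).map (Matrix.SpecialLinearGroup.mapGL ℝ)) k) where
  carrier := {f | ∀ γ ∈ Gamma0 N, (f : ℍ → ℂ) ∣[k] γ = χ ((γ 1 1 : ℤ) : ZMod N) • (f : ℍ → ℂ)}
  add_mem' := by
    intro f g hf hg γ hγ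
    rw [FunLike.coe_add, SlashAction.add_slash, hf γ hγ, hg γ hγ, smul_add]
  zero_mem' := by
    intro γ _
    rw [FunLike.coe_zero, SlashAction.zero_slash, smul_zero]
  smul_mem' := by
    intro c f hf γ hγ
    rw [FunLike.coe_smul, ModularForm.SL_smul_slash, hf γ hγ, smul_comm]

/-- The operator `V_m`: `(f ∣ V_m)(z) = f(mz)`, for `m ≥ 1`. -/
def opV (m : ℕ) (f : ℍ → ℂ) : ℍ → ℂ :=
  fun z => f (ofComplex ((m : ℂ) * (z : ℂ)))

/-- The operator `U_m`: `(f ∣ U_m)(z) = (1/m) ∑_{0 ≤ j < m} f((z + j)/m)`, for `m ≥ 1`. -/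
def opU (m : ℕ) (f : ℍ → ℂ) : ℍ → ℂ :=
  fun z => (m : ℂ)⁻¹ * ∑ j ∈ Finset.range m, f (ofComplex (((z : ℂ) + (j : ℂ)) / (m : ℂ)))

/-- The Hecke operator `T_p = U_p + χ(p) p^(k-1) V_p` in weight `k` and character `χ`. -/
def heckeT {N : ℕ} (k : ℤ) (χ : DirichletCharacter ℂ N) (p : ℕ) (f : ℍ → ℂ) : ℍ → ℂ :=
  opU p f + (χ (p : ZMod N) * (p : ℂ) ^ (k - 1)) • opV p f

/-- `f` is a normalized Hecke eigenform in `M_k(N, χ)`, for the operators `T_p` at all primes `p`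
(those dividing the level included). -/
structure IsNormalizedEigenform {N : ℕ} {k : ℤ} (χ : DirichletCharacter ℂ N)
    (f : ModularForm ((Gamma1 N).map (Matrix.SpecialLinearGroup.mapGL ℝ)) k) : Prop where
  mem : f ∈ formsWithCharacter N k χ
  eigen : ∀ p : ℕ, p.Prime → ∃ c : ℂ, heckeT k χ p f = c • (f : ℍ → ℂ)
  normalized : (qExpansion 1 (f : ℍ → ℂ)).coeff 1 = 1

/-- The Kronecker symbol `(a / n)` for an integer `a` and a natural number `n`: it is
multiplicative in `n ≥ 1`, equal to the Jacobi symbol for odd `n`, and `(a / 2)` is `0`, `1`, `-1`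
according to whether `a` is even, `±1` or `±3` modulo `8`. -/
def kronecker (a : ℤ) (n : ℕ) : ℤ :=
  if n = 0 then (if a.natAbs = 1 then 1 else 0)
  else ZMod.χ₈ (a : ZMod 8) ^ n.factorization 2 * jacobiSym a (n / 2 ^ n.factorization 2)

/-- The twist `f ⊗ (a / ·) = ∑ (a / n) c(n) q^n` of `f = ∑ c(n) q^n`. -/
def twist (f : ℍ → ℂ) (a : ℤ) : ℍ → ℂ :=
  fun z => ∑' n : ℕ, (kronecker a n : ℂ) * (qExpansion 1 f).coeff n *
    Function.Periodic.qParam 1 (z : ℂ) ^ n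

/-- The Rankin–Cohen bracket `[f, g]_w` of functions of integral weights `k₁`, `k₂`, with respect
to the normalized derivative `(1/2πi) d/dz`. -/
def rankinCohen (k₁ k₂ : ℤ) (w : ℕ) (f g : ℍ → ℂ) : ℍ → ℂ :=
  fun z => ∑ r ∈ Finset.range (w + 1),
    (((-1) ^ r * Ring.choose ((w : ℤ) + k₁ - 1) (w - r) * Ring.choose ((w : ℤ) + k₂ - 1) r : ℤ) : ℂ)
      * (Derivative.normalizedDerivOfComplex^[r] f z)
      * (Derivative.normalizedDerivOfComplex^[w - r] g z)

/-- The function `z ↦ η(mz)` on the upper half-plane. -/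
def etaAt (m : ℕ) : ℍ → ℂ :=
  fun z => ModularForm.eta ((m : ℂ) * (z : ℂ))

/-- The character `(a / ·)` times `χ`, as a function on the natural numbers. -/
def charMul {N : ℕ} (χ : DirichletCharacter ℂ N) (a : ℤ) : ℕ → ℂ :=
  fun d => χ (d : ZMod N) * (kronecker a d : ℂ)

/-- A form with multiplier `ψ ν_η^r`, `r` odd, is a series in `q^(1/24)` if `3 ∤ r`, and a series
in `q^(1/8)` if `3 ∣ r`. -/
def etaDenominator (r : ℕ) : ℕ := if 3 ∣ r then 8 else 24

/-- The discriminant of the quadratic character in the lift: `-4` if `3 ∣ r`, otherwise `12`. -/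
def etaDiscriminant (r : ℕ) : ℤ := if 3 ∣ r then -4 else 12

/-- The `n`-th coefficient of the first Shimura lift of `F = ∑ a(n) q^(n/D)`, where `F` has weight
`l + 1/2` and multiplier `ψ ν_η^r`:
`B(n) = ∑_{d ∣ n} ψ(d) (12 / (n/d)) d^(l-1) a(n²/d²)`, `D = 24`, if `3 ∤ r`, and
`B(n) = ∑_{d ∣ n} ψ(d) (-4 / (n/d)) d^(l-1) a(n²/d²)`, `D = 8`, if `3 ∣ r`. -/
def etaLiftCoeff (r : ℕ) (l : ℤ) (ψ : ℕ → ℂ) (F : ℍ → ℂ) (n : ℕ) : ℂ :=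
  ∑ d ∈ n.divisors, ψ d * (kronecker (etaDiscriminant r) (n / d) : ℂ) * (d : ℂ) ^ (l - 1) *
    (qExpansion (etaDenominator r) F).coeff ((n / d) ^ 2)

/-- `𝒮₁(F) = G`: the series `∑_{n ≥ 1} B(n) q^n` that defines the first Shimura lift of `F`
(of weight `l + 1/2` and multiplier `ψ ν_η^r`) converges to `G` on the upper half-plane. -/
def IsFirstEtaLift (r : ℕ) (l : ℤ) (ψ : ℕ → ℂ) (F G : ℍ → ℂ) : Prop :=
  ∀ z : ℍ, HasSum
    (fun n : ℕ => etaLiftCoeff r l ψ F n * Function.Periodic.qParam 1 (z : ℂ) ^ n) (G z)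

end EtaShimura

end

/-! Each eta-quotient is a theta series `∑ e(m) q^(m²/D)` with `D = 8` or `24`, where `e` is an even
function: a quadratic character or a square of one, possibly times another character, and in weight
3/2 also times `m`. Hence the coefficient of `q^(n²/D)` in its product with `g` is `∑ e(m) a((n² -
m²)/D)`. For `n` prime to `D` the equation `n² - m² = D x y` splits into linear ones: `n = x + 2y`,
`m = ±(x - 2y)` if `D = 8`; `n = x + 6y`, `m = ±(x - 6y)` or `n = 2x + 3y`, `m = ±(2x - 3y)` if `D =
24` (`thetaCoeff_eight`, `thetaCoeff_twentyFour`). So the character value at `n` times this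
coefficient is a sum of `W(x, y) a(xy)` over representations of `n` by these forms, with an explicit
weight `W`.

On the other side, products and brackets of `g(αz)` and `g(βz)` have coefficients `∑ W(x, y) a(x)
a(y)` over `αx + βy = n`. The Hecke relations `a(x) a(y) = ∑ χ(d) d^(k-1) a(xy/d²)`, over `d`
dividing both `x` and `y`, together with the homogeneity `W(dx, dy) = (δ/d) d^ν W(x, y)`, turn this
into a divisor sum over `d ∣ n` of the previous sums at `n/d` (`sum_linearReps_hecke`). With `ψ = χ
(δ/·)` and `l = k + ν` that is the coefficient `B(n)` of the lift; this comparison is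
`isFirstEtaLift_of_weights`.

When `n` is not prime to `D` the quadratic character in the lift vanishes, so the sum of `W(x, y)
a(xy)` must vanish too. This follows from bijections between representations that preserve `xy` and
reverse the sign of the weight, or because the weight is zero there.

The theta series come from the Jacobi triple product (`hasSum_triple_product`), its derivative at `z
= 1` (`hasSum_int_mul_triPow`), the derivative of a product of two triple products
(`hasSum_odd_mul_pentPow`), and the substitution `q ↦ -q`, which multiplies `e` by `(8/·)`.
Coefficients are read off convergent series by `HasQExp.qExpansion_coeff`. -/

namespace EtaShimura

open Filter Topology

/-! ### The Jacobi triple product on the unit disc -/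

/-- The finite product `(1 - q) ⋯ (1 - q^n)`. -/
noncomputable def qPochhammer (q : ℂ) (n : ℕ) : ℂ := ∏ i ∈ Finset.range n, (1 - q ^ (i + 1))

/-- The inverse of `(1 - q) ⋯ (1 - q^m)`, extended by zero to negative integers `m`. -/
noncomputable def invPochhammer (q : ℂ) (m : ℤ) : ℂ :=
  if m < 0 then 0 else (qPochhammer q m.toNat)⁻¹

/-- The infinite product `(1 - x) (1 - x q) (1 - x q²) ⋯`. -/
noncomputable def qProd (x q : ℂ) : ℂ := ∏' n : ℕ, (1 - x * q ^ n)

/-- The power `q^(n (n - 1) / 2)`. -/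
noncomputable def triPow (q : ℂ) (n : ℤ) : ℂ := q ^ (n * (n - 1) / 2)

/-- The coefficients of the finite form of the triple product. -/
noncomputable def tripleCoeff (q : ℂ) (N : ℕ) (n : ℤ) : ℂ :=
  (-1) ^ n * triPow q n *
    (qPochhammer q (2 * N) * invPochhammer q (N + n) * invPochhammer q (N - n))

lemma one_sub_pow_succ_ne_zero {q : ℂ} (hq : ‖q‖ < 1) (n : ℕ) : 1 - q ^ (n + 1) ≠ 0 := by
  intro h
  have h1 : ‖q ^ (n + 1)‖ = 1 := by rw [← sub_eq_zero.mp h, norm_one]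
  rw [norm_pow] at h1
  exact (pow_lt_one₀ (norm_nonneg q) hq (Nat.succ_ne_zero n)).ne h1

lemma qPochhammer_ne_zero {q : ℂ} (hq : ‖q‖ < 1) (n : ℕ) : qPochhammer q n ≠ 0 :=
  Finset.prod_ne_zero_iff.mpr fun i _ => one_sub_pow_succ_ne_zero hq i

lemma qPochhammer_succ (q : ℂ) (n : ℕ) :
    qPochhammer q (n + 1) = qPochhammer q n * (1 - q ^ (n + 1)) :=
  Finset.prod_range_succ _ _

/-- The extension by zero is what makes this recursion valid for every integer: at `m = 0` the
factor `1 - q^0` vanishes. -/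
lemma invPochhammer_sub_one {q : ℂ} (hq : ‖q‖ < 1) (m : ℤ) :
    invPochhammer q (m - 1) = (1 - q ^ m) * invPochhammer q m := by
  unfold invPochhammer
  rcases lt_trichotomy m 0 with h | rfl | h
  · rw [if_pos (by omega), if_pos h, mul_zero]
  · simp
  · obtain ⟨n, rfl⟩ : ∃ n : ℕ, m = n + 1 := ⟨(m - 1).toNat, by omega⟩
    rw [if_neg (by omega), if_neg (by omega)]
    have h1 : ((n : ℤ) + 1 - 1).toNat = n := by omega
    have h2 : ((n : ℤ) + 1).toNat = n + 1 := by omega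
    rw [h1, h2, qPochhammer_succ]
    have h3 := one_sub_pow_succ_ne_zero hq n
    have h4 := qPochhammer_ne_zero hq n
    have h5 : q ^ ((n : ℤ) + 1) = q ^ (n + 1) := by exact_mod_cast zpow_natCast q (n + 1)
    rw [h5]
    field_simp

lemma triPow_add_one {q : ℂ} (h0 : q ≠ 0) (n : ℤ) : triPow q (n + 1) = q ^ n * triPow q n := by
  unfold triPow
  rw [← zpow_add₀ h0]
  congr 1
  have : (n + 1) * (n + 1 - 1) = n * (n - 1) + n * 2 := by ring
  rw [this, Int.add_mul_ediv_right _ _ two_ne_zero, add_comm]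

lemma triPow_sub_one {q : ℂ} (h0 : q ≠ 0) (n : ℤ) : triPow q (n - 1) = q / q ^ n * triPow q n := by
  have h := triPow_add_one h0 (n - 1)
  rw [sub_add_cancel, zpow_sub_one₀ h0] at h
  rw [h]
  have := zpow_ne_zero n h0
  field_simp

/-- Passing from `N` to `N + 1` multiplies the finite product by `(1 - z q^N)(1 - q^(N+1)/z) = 1 +
q^(2N+1) - q^N z - q^(N+1)/z`; this is the effect on the coefficient of `z^n`. -/
lemma tripleCoeff_succ {q : ℂ} (h0 : q ≠ 0) (hq : ‖q‖ < 1) (N : ℕ) (n : ℤ) :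
    tripleCoeff q (N + 1) n = (1 + q ^ (2 * N + 1)) * tripleCoeff q N n
      - q ^ N * tripleCoeff q N (n - 1) - q ^ (N + 1) * tripleCoeff q N (n + 1) := by
  unfold tripleCoeff
  rw [triPow_add_one h0, triPow_sub_one h0, zpow_add_one₀ (by norm_num), zpow_sub_one₀ (by norm_num)]
  have e1 : invPochhammer q (N + n) = (1 - q ^ ((N : ℤ) + n + 1)) * invPochhammer q (N + 1 + n) := by
    rw [show (N : ℤ) + 1 + n = N + n + 1 by ring, ← invPochhammer_sub_one hq]; simp
  have e2 : invPochhammer q (N + (n - 1)) = (1 - q ^ ((N : ℤ) + n)) *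
      ((1 - q ^ ((N : ℤ) + n + 1)) * invPochhammer q (N + 1 + n)) := by
    rw [← e1, ← invPochhammer_sub_one hq]; ring_nf
  have e3 : invPochhammer q (N - n) = (1 - q ^ ((N : ℤ) - n + 1)) * invPochhammer q (N + 1 - n) := by
    rw [show (N : ℤ) + 1 - n = N - n + 1 by ring, ← invPochhammer_sub_one hq]; simp
  have e4 : invPochhammer q (N - (n + 1)) = (1 - q ^ ((N : ℤ) - n)) *
      ((1 - q ^ ((N : ℤ) - n + 1)) * invPochhammer q (N + 1 - n)) := by
    rw [← e3, ← invPochhammer_sub_one hq]; ring_nf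
  have e5 : invPochhammer q (N + (n + 1)) = invPochhammer q (N + 1 + n) := by ring_nf
  have e6 : invPochhammer q (N - (n - 1)) = invPochhammer q (N + 1 - n) := by ring_nf
  rw [e2, e4, e5, e6, e1, e3]
  push_cast
  rw [show 2 * (N + 1) = 2 * N + 1 + 1 by ring, qPochhammer_succ, qPochhammer_succ]
  have hn := zpow_ne_zero n h0
  simp only [zpow_add₀ h0, zpow_sub₀ h0, zpow_natCast, zpow_one]
  field_simp
  ring

lemma hasSum_int_shift {f : ℤ → ℂ} {s : ℂ} (h : HasSum f s) (m : ℤ) :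
    HasSum (fun n => f (n + m)) s :=
  (Equiv.addRight m).hasSum_iff.mpr h

lemma tripleCoeff_zero (q : ℂ) (n : ℤ) : tripleCoeff q 0 n = if n = 0 then 1 else 0 := by
  unfold tripleCoeff invPochhammer
  rcases lt_trichotomy n 0 with h | rfl | h
  · simp [h, h.ne]
  · simp [triPow, qPochhammer]
  · simp [h, h.ne']

lemma hasSum_tripleCoeff {q z : ℂ} (h0 : q ≠ 0) (hq : ‖q‖ < 1) (hz : z ≠ 0) (N : ℕ) :
    HasSum (fun n : ℤ => tripleCoeff q N n * z ^ n)
      ((∏ i ∈ Finset.range N, (1 - z * q ^ i)) * ∏ i ∈ Finset.range N, (1 - q / z * q ^ i)) := by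
  induction N with
  | zero =>
    simp only [Finset.range_zero, Finset.prod_empty, mul_one, tripleCoeff_zero]
    convert hasSum_ite_eq (0 : ℤ) (1 : ℂ) using 2 with n
    split_ifs with h <;> simp [h]
  | succ N ih =>
    rw [Finset.prod_range_succ, Finset.prod_range_succ]
    have h1 := hasSum_int_shift ih (-1)
    have h2 := hasSum_int_shift ih 1
    convert! ((ih.mul_left (1 + q ^ (2 * N + 1))).sub (h1.mul_left (q ^ N * z))).sub
      (h2.mul_left (q ^ (N + 1) * z⁻¹)) using 1
    · funext n
      rw [tripleCoeff_succ h0 hq, zpow_add_one₀ hz, ← sub_eq_add_neg, zpow_sub_one₀ hz]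
      field_simp
    · field_simp
      ring

/-- This is `z d/dz` of the finite product at `z = 1`: the product contains `1 - z`, so only the
derivative of that factor survives. -/
lemma hasSum_int_mul_tripleCoeff {q : ℂ} (h0 : q ≠ 0) (hq : ‖q‖ < 1) (N : ℕ) :
    HasSum (fun n : ℤ => (n : ℂ) * tripleCoeff q (N + 1) n)
      (-(qPochhammer q N * qPochhammer q (N + 1))) := by
  -- Shifting the index in the recursion changes the weight by one and so produces an extra
  -- unweighted sum, the finite product at `z = 1`. It is zero once `M ≥ 1`, since it contains `1 -
  -- q^0`; at `M = 0` it supplies the starting value.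
  have key : ∀ M : ℕ, ∀ s : ℂ, HasSum (fun n : ℤ => (n : ℂ) * tripleCoeff q M n) s →
      HasSum (fun n : ℤ => (n : ℂ) * tripleCoeff q (M + 1) n)
        ((1 - q ^ M) * (1 - q ^ (M + 1)) * s + (q ^ (M + 1) - q ^ M) *
          ((∏ i ∈ Finset.range M, (1 - 1 * q ^ i)) * ∏ i ∈ Finset.range M, (1 - q / 1 * q ^ i))) := by
    intro M s h
    have hS := hasSum_tripleCoeff h0 hq one_ne_zero M
    simp only [one_zpow, mul_one] at hS
    have h1 := hasSum_int_shift h (-1)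
    have h2 := hasSum_int_shift h 1
    have h3 := hasSum_int_shift hS (-1)
    have h4 := hasSum_int_shift hS 1
    convert! ((h.mul_left (1 + q ^ (2 * M + 1))).sub ((h1.add h3).mul_left (q ^ M))).sub
      ((h2.sub h4).mul_left (q ^ (M + 1))) using 1
    · funext n
      rw [tripleCoeff_succ h0 hq]
      push_cast
      rw [← sub_eq_add_neg]
      ring_nf
    · ring
  induction N with
  | zero =>
    have := key 0 0 (by
      convert hasSum_zero using 2 with n
      rw [tripleCoeff_zero]; split_ifs with h <;> simp [h])
    simpa [qPochhammer] using this
  | succ N ih =>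
    have := key (N + 1) _ ih
    rw [Finset.prod_range_succ'] at this
    convert this using 1
    rw [qPochhammer_succ q (N + 1), qPochhammer_succ q N]
    simp
    ring

lemma multipliable_qProd (x : ℂ) {q : ℂ} (hq : ‖q‖ < 1) :
    Multipliable fun n : ℕ => 1 - x * q ^ n := by
  simp only [sub_eq_add_neg]
  apply multipliable_one_add_of_summable
  simpa using (summable_geometric_of_lt_one (norm_nonneg q) hq).mul_left ‖x‖

lemma tendsto_qProd (x : ℂ) {q : ℂ} (hq : ‖q‖ < 1) :
    Tendsto (fun N => ∏ i ∈ Finset.range N, (1 - x * q ^ i)) atTop (𝓝 (qProd x q)) :=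
  (multipliable_qProd x hq).hasProd.tendsto_prod_nat

lemma tendsto_qPochhammer {q : ℂ} (hq : ‖q‖ < 1) :
    Tendsto (qPochhammer q) atTop (𝓝 (qProd q q)) := by
  convert tendsto_qProd q hq using 2 with N
  simp only [qPochhammer, pow_succ']

lemma qProd_ne_zero {x q : ℂ} (hq : ‖q‖ < 1) (hx : ∀ n : ℕ, x * q ^ n ≠ 1) : qProd x q ≠ 0 := by
  unfold qProd
  simp only [sub_eq_add_neg]
  apply tprod_one_add_ne_zero_of_summable
  · intro n
    rw [← sub_eq_add_neg, sub_ne_zero]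
    exact (hx n).symm
  · simpa using (summable_geometric_of_lt_one (norm_nonneg q) hq).mul_left ‖x‖

lemma qProd_ne_zero_of_norm_lt {x q : ℂ} (hq : ‖q‖ < 1) (hx : ‖x‖ < 1) : qProd x q ≠ 0 := by
  apply qProd_ne_zero hq
  intro n h
  have h1 : ‖x‖ * ‖q‖ ^ n = 1 := by rw [← norm_pow, ← norm_mul, h, norm_one]
  have h2 : ‖q‖ ^ n ≤ 1 := pow_le_one₀ (norm_nonneg q) hq.le
  nlinarith [norm_nonneg x, norm_nonneg q]

lemma tendsto_invPochhammer_aux {q : ℂ} (hq : ‖q‖ < 1) {f : ℕ → ℤ}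
    (hf : Tendsto f atTop atTop) :
    Tendsto (fun N => invPochhammer q (f N)) atTop (𝓝 (qProd q q)⁻¹) := by
  have h1 : Tendsto (fun N => (f N).toNat) atTop atTop := by
    rw [tendsto_atTop] at hf ⊢
    intro b
    filter_upwards [hf b] with N hN
    omega
  refine (((tendsto_qPochhammer hq).comp h1).inv₀ (qProd_ne_zero_of_norm_lt hq hq)).congr' ?_
  filter_upwards [hf.eventually_ge_atTop 0] with N hN
  simp [invPochhammer, not_lt.mpr hN]

lemma tendsto_tripleCoeff {q : ℂ} (hq : ‖q‖ < 1) (n : ℤ) :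
    Tendsto (fun N => tripleCoeff q N n) atTop
      (𝓝 ((-1) ^ n * triPow q n * (qProd q q)⁻¹)) := by
  have hE := qProd_ne_zero_of_norm_lt hq hq
  have hN : Tendsto (fun N : ℕ => (N : ℤ)) atTop atTop := tendsto_natCast_atTop_atTop
  have h1 : Tendsto (fun N : ℕ => qPochhammer q (2 * N)) atTop (𝓝 (qProd q q)) :=
    (tendsto_qPochhammer hq).comp (tendsto_id.const_mul_atTop' two_pos)
  have h2 := tendsto_invPochhammer_aux hq (tendsto_atTop_add_const_right atTop n hN)
  have h3 := tendsto_invPochhammer_aux hq (tendsto_atTop_add_const_right atTop (-n) hN)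
  have := ((h1.mul h2).mul h3).const_mul ((-1) ^ n * triPow q n)
  rw [mul_inv_cancel₀ hE, one_mul] at this
  simpa only [tripleCoeff, sub_eq_add_neg] using this

/-- Convergent sequences are bounded, so the finite coefficients are dominated uniformly in `N`;
this permits the limit under the sum. -/
lemma exists_bound_tripleCoeff {q : ℂ} (hq : ‖q‖ < 1) :
    ∃ C : ℝ, ∀ N n, ‖tripleCoeff q N n‖ ≤ C * ‖triPow q n‖ := by
  obtain ⟨A, hA⟩ := (tendsto_qPochhammer hq).norm.bddAbove_range
  obtain ⟨B, hB⟩ := ((tendsto_qPochhammer hq).inv₀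
    (qProd_ne_zero_of_norm_lt hq hq)).norm.bddAbove_range
  have hA' : ∀ n, ‖qPochhammer q n‖ ≤ A := fun n => hA ⟨n, rfl⟩
  have hA0 : 0 ≤ A := (norm_nonneg _).trans (hA' 0)
  have hB1 : ∀ n, ‖(qPochhammer q n)⁻¹‖ ≤ B := fun n => hB ⟨n, rfl⟩
  have hB0 : 0 ≤ B := (norm_nonneg _).trans (hB1 0)
  have hB' : ∀ m, ‖invPochhammer q m‖ ≤ B := by
    intro m
    unfold invPochhammer
    split_ifs
    · simpa using hB0
    · exact hB1 _
  refine ⟨A * B * B, fun N n => ?_⟩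
  unfold tripleCoeff
  simp only [norm_mul, norm_zpow, norm_neg, norm_one, one_zpow, one_mul]
  rw [mul_comm]
  gcongr
  exacts [hA' _, hB' _, hB' _]

lemma summable_triPow {q : ℂ} (h0 : q ≠ 0) (hq : ‖q‖ < 1) {z : ℂ} (hz : z ≠ 0) (k : ℕ) :
    Summable fun n : ℤ => (|n| ^ k : ℝ) * (‖triPow q n‖ * ‖z ^ n‖) := by
  have hq0 : 0 < ‖q‖ := norm_pos_iff.mpr h0
  have hz0 : 0 < ‖z‖ := norm_pos_iff.mpr hz
  set L : ℝ := -Real.log ‖q‖ with hL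
  have hL0 : 0 < L := neg_pos.mpr (Real.log_neg hq0 hq)
  have hpi := Real.pi_pos
  refine Summable.of_nonneg_of_le (fun n => by positivity) (fun n => ?_)
    -- The term is `|n|^k exp(-L n²/2 + L n/2 + n log ‖z‖)`. The two constants are chosen so that
    -- the theta bound is this expression with both linear terms replaced by their upper bounds in
    -- `|n|`.
    (summable_pow_mul_jacobiTheta₂_term_bound ((L / 2 + |Real.log ‖z‖|) / (2 * Real.pi))
      (T := L / (2 * Real.pi)) (by positivity) k)
  push_cast
  gcongr
  rw [triPow, norm_zpow, norm_zpow, ← Real.rpow_intCast, ← Real.rpow_intCast,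
    Real.rpow_def_of_pos hq0, Real.rpow_def_of_pos hz0, ← Real.exp_add]
  apply Real.exp_le_exp.mpr
  have he : ((n * (n - 1) / 2 : ℤ) : ℝ) = n * (n - 1) / 2 := by
    rw [Int.cast_div (Int.even_mul_pred_self n).two_dvd (by norm_num)]
    push_cast; ring
  rw [he]
  have h1 : Real.log ‖z‖ * n ≤ |Real.log ‖z‖| * |(n : ℝ)| := by
    rw [← abs_mul]; exact le_abs_self _
  have h2 : L * n ≤ L * |(n : ℝ)| := by gcongr; exact le_abs_self _
  have h3 : -Real.pi * (L / (2 * Real.pi) * (n : ℝ) ^ 2 - 2 * ((L / 2 + |Real.log ‖z‖|) / (2 * Real.pi)) * |(n : ℝ)|)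
      = -L * n ^ 2 / 2 + L / 2 * |(n : ℝ)| + |Real.log ‖z‖| * |(n : ℝ)| := by
    field_simp
    ring
  rw [h3]
  have h4 : Real.log ‖q‖ = -L := by simp [hL]
  rw [h4]
  linarith

/-- The Jacobi triple product identity. -/
theorem hasSum_triple_product {q z : ℂ} (h0 : q ≠ 0) (hq : ‖q‖ < 1) (hz : z ≠ 0) :
    HasSum (fun n : ℤ => (-1) ^ n * triPow q n * z ^ n)
      (qProd q q * qProd z q * qProd (q / z) q) := by
  have hE := qProd_ne_zero_of_norm_lt hq hq
  obtain ⟨C, hC⟩ := exists_bound_tripleCoeff hq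
  have hs := summable_triPow h0 hq hz 0
  simp only [pow_zero, one_mul] at hs
  -- Let `N → ∞` in the finite identity. The limit coefficients carry a factor `(qProd q q)⁻¹`,
  -- which is moved to the product side at the end.
  have hlim := tendsto_tsum_of_dominated_convergence (𝓕 := atTop)
    (f := fun N (n : ℤ) => tripleCoeff q N n * z ^ n)
    (g := fun n => (-1) ^ n * triPow q n * (qProd q q)⁻¹ * z ^ n) (hs.mul_left C)
    (fun n => (tendsto_tripleCoeff hq n).mul_const _)
    (Eventually.of_forall fun N n => by
      rw [norm_mul, ← mul_assoc]; gcongr; exact hC N n)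
  simp only [(hasSum_tripleCoeff h0 hq hz _).tsum_eq] at hlim
  have h1 := tendsto_nhds_unique hlim ((tendsto_qProd z hq).mul (tendsto_qProd (q / z) hq))
  have h2 : Summable fun n : ℤ => (-1) ^ n * triPow q n * z ^ n := by
    refine Summable.of_norm (hs.congr fun n => ?_)
    simp
  convert h2.hasSum using 1
  rw [mul_assoc, ← h1, ← tsum_mul_left]
  refine tsum_congr fun n => ?_
  field_simp

/-- Jacobi's identity for the cube of the Euler product. -/
theorem hasSum_int_mul_triPow {q : ℂ} (h0 : q ≠ 0) (hq : ‖q‖ < 1) :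
    HasSum (fun n : ℤ => (n : ℂ) * ((-1) ^ n * triPow q n)) (-qProd q q ^ 3) := by
  have hE := qProd_ne_zero_of_norm_lt hq hq
  obtain ⟨C, hC⟩ := exists_bound_tripleCoeff hq
  have hs := summable_triPow h0 hq one_ne_zero 1
  simp only [pow_one, one_zpow, norm_one, mul_one] at hs
  have hlim := tendsto_tsum_of_dominated_convergence (𝓕 := atTop)
    (f := fun N (n : ℤ) => (n : ℂ) * tripleCoeff q (N + 1) n)
    (g := fun n => (n : ℂ) * ((-1) ^ n * triPow q n * (qProd q q)⁻¹)) (hs.mul_left C)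
    (fun n => ((tendsto_tripleCoeff hq n).comp (tendsto_add_atTop_nat 1)).const_mul _)
    (Eventually.of_forall fun N n => by
      rw [norm_mul, Complex.norm_intCast]
      calc |(n : ℝ)| * ‖tripleCoeff q (N + 1) n‖ ≤ |(n : ℝ)| * (C * ‖triPow q n‖) := by
            gcongr; exact hC _ _
        _ = C * (((|n| : ℤ) : ℝ) * ‖triPow q n‖) := by push_cast; ring)
  simp only [(hasSum_int_mul_tripleCoeff h0 hq _).tsum_eq] at hlim
  have h1 := tendsto_nhds_unique hlim ((tendsto_qPochhammer hq).mul
    ((tendsto_qPochhammer hq).comp (tendsto_add_atTop_nat 1))).neg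
  have h2 : Summable fun n : ℤ => (n : ℂ) * ((-1) ^ n * triPow q n) := by
    refine Summable.of_norm (hs.congr fun n => ?_)
    simp
  convert h2.hasSum using 1
  have : -qProd q q ^ 3 = qProd q q * -(qProd q q * qProd q q) := by ring
  rw [this, ← h1, ← tsum_mul_left]
  refine tsum_congr fun n => ?_
  field_simp

end EtaShimura

namespace EtaShimura

open Filter Topology

/-! ### Theta series as products -/

/-- Euler's product `∏ (1 - q^n)`. -/
noncomputable def eulerProd (q : ℂ) : ℂ := qProd q q

lemma norm_pow_succ_lt_one {q : ℂ} (hq : ‖q‖ < 1) (n : ℕ) : ‖q ^ (n + 1)‖ < 1 := by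
  rw [norm_pow]; exact pow_lt_one₀ (norm_nonneg q) hq n.succ_ne_zero

lemma eulerProd_ne_zero {q : ℂ} (hq : ‖q‖ < 1) : eulerProd q ≠ 0 :=
  qProd_ne_zero_of_norm_lt hq hq

lemma qProd_eq_one_sub_mul (x : ℂ) {q : ℂ} (hq : ‖q‖ < 1) :
    qProd x q = (1 - x) * qProd (x * q) q := by
  have h := (tendsto_qProd x hq).comp (tendsto_add_atTop_nat 1)
  refine tendsto_nhds_unique h (((tendsto_qProd (x * q) hq).const_mul (1 - x)).congr fun N => ?_)
  simp only [Function.comp, Finset.prod_range_succ']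
  rw [mul_comm]
  simp only [pow_zero, mul_one]
  congr 1
  exact Finset.prod_congr rfl fun i _ => by ring

lemma qProd_two (x : ℂ) {q : ℂ} (hq : ‖q‖ < 1) :
    qProd x q = qProd x (q ^ 2) * qProd (x * q) (q ^ 2) := by
  have hq2 := norm_pow_succ_lt_one hq 1
  have h := (tendsto_qProd x hq).comp (tendsto_id.const_mul_atTop' two_pos)
  refine tendsto_nhds_unique h (((tendsto_qProd x hq2).mul (tendsto_qProd (x * q) hq2)).congr
    fun N => ?_)
  simp only [Function.comp, id]
  induction N with
  | zero => simp
  | succ N ih =>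
    rw [show 2 * (N + 1) = 2 * N + 1 + 1 by ring]
    simp only [Finset.prod_range_succ]
    rw [← ih]
    ring

lemma qProd_three (x : ℂ) {q : ℂ} (hq : ‖q‖ < 1) :
    qProd x q = qProd x (q ^ 3) * qProd (x * q) (q ^ 3) * qProd (x * q ^ 2) (q ^ 3) := by
  have hq3 := norm_pow_succ_lt_one hq 2
  have h := (tendsto_qProd x hq).comp (tendsto_id.const_mul_atTop' three_pos)
  refine tendsto_nhds_unique h ((((tendsto_qProd x hq3).mul (tendsto_qProd (x * q) hq3)).mul
    (tendsto_qProd (x * q ^ 2) hq3)).congr fun N => ?_)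
  simp only [Function.comp, id]
  induction N with
  | zero => simp
  | succ N ih =>
    rw [show 3 * (N + 1) = 3 * N + 1 + 1 + 1 by ring]
    simp only [Finset.prod_range_succ]
    rw [← ih]
    ring

lemma qProd_mul_qProd_neg (x : ℂ) {q : ℂ} (hq : ‖q‖ < 1) :
    qProd x q * qProd (-x) q = qProd (x ^ 2) (q ^ 2) := by
  have hq2 := norm_pow_succ_lt_one hq 1
  refine tendsto_nhds_unique ((tendsto_qProd x hq).mul (tendsto_qProd (-x) hq))
    ((tendsto_qProd (x ^ 2) hq2).congr fun N => ?_)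
  rw [← Finset.prod_mul_distrib]
  exact Finset.prod_congr rfl fun i _ => by ring

lemma qProd_neg_self {q : ℂ} (hq : ‖q‖ < 1) :
    qProd (-q) q = eulerProd (q ^ 2) / eulerProd q := by
  rw [eq_div_iff (eulerProd_ne_zero hq), mul_comm]
  exact qProd_mul_qProd_neg q hq

lemma qProd_self_sq {q : ℂ} (hq : ‖q‖ < 1) :
    qProd q (q ^ 2) = eulerProd q / eulerProd (q ^ 2) := by
  rw [eq_div_iff (eulerProd_ne_zero (norm_pow_succ_lt_one hq 1)), eulerProd, eulerProd,
    qProd_two q hq, ← pow_two]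

/-- Separate odd from even exponents: only the odd factors change under `q ↦ -q`, and `∏ (1 -
q^(2n+1))(1 + q^(2n+1)) = ∏ (1 - q^(4n+2))`. This keeps eta-quotients closed under `q ↦ -q`. -/
lemma eulerProd_neg {q : ℂ} (hq : ‖q‖ < 1) :
    eulerProd (-q) = eulerProd (q ^ 2) ^ 3 / (eulerProd q * eulerProd (q ^ 4)) := by
  have h1 := eulerProd_ne_zero hq
  have h2 := eulerProd_ne_zero (norm_pow_succ_lt_one hq 1)
  have h4 := eulerProd_ne_zero (norm_pow_succ_lt_one hq 3)
  have e1 : eulerProd (-q) = qProd (-q) (q ^ 2) * eulerProd (q ^ 2) := by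
    rw [eulerProd, qProd_two (-q) (by rwa [norm_neg]), eulerProd]
    ring_nf
  have e2 := qProd_mul_qProd_neg q (norm_pow_succ_lt_one hq 1)
  rw [qProd_self_sq hq, qProd_self_sq (norm_pow_succ_lt_one hq 1)] at e2
  norm_num [← pow_mul] at e2
  rw [e1, eq_div_iff (by positivity)]
  field_simp at e2
  linear_combination eulerProd (q ^ 2) * e2

/-- The power `q^(n (3n - 1) / 2)`. -/
noncomputable def pentPow (q : ℂ) (n : ℤ) : ℂ := q ^ (n * (3 * n - 1) / 2)

lemma two_mul_tri (n : ℤ) : 2 * (n * (n - 1) / 2) = n * (n - 1) :=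
  Int.mul_ediv_cancel' (Int.even_mul_pred_self n).two_dvd

lemma two_mul_pent (n : ℤ) : 2 * (n * (3 * n - 1) / 2) = n * (3 * n - 1) := by
  refine Int.mul_ediv_cancel' ?_
  rcases Int.even_or_odd' n with ⟨k, rfl | rfl⟩
  · exact ⟨k * (3 * (2 * k) - 1), by ring⟩
  · exact ⟨(2 * k + 1) * (3 * k + 1), by ring⟩

lemma triPow_cube_mul {q : ℂ} (h0 : q ≠ 0) (n : ℤ) : triPow (q ^ 3) n * q ^ n = pentPow q n := by
  unfold triPow pentPow
  rw [← zpow_natCast, ← zpow_mul, ← zpow_add₀ h0]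
  congr 1
  have h1 := two_mul_tri n
  have h2 := two_mul_pent n
  push_cast
  have : 2 * (3 * (n * (n - 1) / 2) + n) = 2 * (n * (3 * n - 1) / 2) := by
    rw [h2]; linear_combination 3 * h1
  omega

lemma triPow_sq_mul {q : ℂ} (h0 : q ≠ 0) (n : ℤ) : triPow (q ^ 2) n * q ^ n = q ^ (n ^ 2) := by
  unfold triPow
  rw [← zpow_natCast, ← zpow_mul, ← zpow_add₀ h0]
  congr 1
  have h1 := two_mul_tri n
  push_cast
  linear_combination h1

/-- Triple product with base `q³` at `z = q`; the three factors are the residue classes of exponents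
modulo 3. -/
theorem hasSum_pentagonal {q : ℂ} (h0 : q ≠ 0) (hq : ‖q‖ < 1) :
    HasSum (fun n : ℤ => (-1) ^ n * pentPow q n) (eulerProd q) := by
  have := hasSum_triple_product (pow_ne_zero 3 h0) (norm_pow_succ_lt_one hq 2) h0
  convert this using 1
  · funext n
    rw [mul_assoc, triPow_cube_mul h0]
  · rw [eulerProd, qProd_three q hq, show q ^ 3 / q = q * q by field_simp,
      show q * q ^ 2 = q ^ 3 by ring]
    ring

/-- Triple product with base `q³` at `z = -q`, which cancels the signs. The product side is found by
splitting `∏ (1 + q^n)` modulo 3. -/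
theorem hasSum_pentPow {q : ℂ} (h0 : q ≠ 0) (hq : ‖q‖ < 1) :
    HasSum (fun n : ℤ => pentPow q n)
      (eulerProd (q ^ 2) * eulerProd (q ^ 3) ^ 2 / (eulerProd q * eulerProd (q ^ 6))) := by
  have hq3 := norm_pow_succ_lt_one hq 2
  have h1 := eulerProd_ne_zero hq
  have h3 := eulerProd_ne_zero hq3
  have h6 := eulerProd_ne_zero (norm_pow_succ_lt_one hq 5)
  have := hasSum_triple_product (pow_ne_zero 3 h0) hq3 (neg_ne_zero.mpr h0)
  convert this using 1
  · funext n
    rw [show -q = (-1) * q by ring, mul_zpow, ← triPow_cube_mul h0]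
    have : ((-1 : ℂ) ^ n) * (-1) ^ n = 1 := by rw [← mul_zpow]; norm_num
    linear_combination (-triPow (q ^ 3) n * q ^ n) * this
  · have e1 := qProd_three (-q) hq
    rw [qProd_neg_self hq, show -q * q ^ 2 = -(q ^ 3) by ring, qProd_neg_self hq3,
      show -q * q = -(q ^ 2) by ring, ← pow_mul] at e1
    norm_num at e1
    rw [show q ^ 3 / -q = -(q ^ 2) by field_simp]
    change _ = eulerProd (q ^ 3) * _ * _
    field_simp at e1 ⊢
    linear_combination e1

/-- Triple product at `z = -1`; the 2 is its first factor `1 - z`, and reflects that `n` and `1 - n`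
give equal terms. -/
theorem hasSum_triPow {q : ℂ} (h0 : q ≠ 0) (hq : ‖q‖ < 1) :
    HasSum (fun n : ℤ => triPow q n) (2 * (eulerProd (q ^ 2) ^ 2 / eulerProd q)) := by
  have h1 := eulerProd_ne_zero hq
  have := hasSum_triple_product h0 hq (neg_ne_zero.mpr one_ne_zero)
  convert this using 1
  · funext n
    have : ((-1 : ℂ) ^ n) * (-1) ^ n = 1 := by rw [← mul_zpow]; norm_num
    linear_combination (-triPow q n) * this
  · rw [qProd_eq_one_sub_mul (-1) hq, show q / -1 = -q by ring, neg_one_mul, qProd_neg_self hq]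
    change _ = eulerProd q * _ * _
    field_simp
    ring

theorem hasSum_neg_one_zpow_mul_sq {q : ℂ} (h0 : q ≠ 0) (hq : ‖q‖ < 1) :
    HasSum (fun n : ℤ => (-1) ^ n * q ^ (n ^ 2)) (eulerProd q ^ 2 / eulerProd (q ^ 2)) := by
  have hq2 := norm_pow_succ_lt_one hq 1
  have h2 := eulerProd_ne_zero hq2
  have := hasSum_triple_product (pow_ne_zero 2 h0) hq2 h0
  convert this using 1
  · funext n
    rw [mul_assoc, triPow_sq_mul h0]
  · rw [show q ^ 2 / q = q by field_simp, qProd_self_sq hq]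
    change _ = eulerProd (q ^ 2) * _ * _
    field_simp

/-- The unweighted alternating series is the triple product at `z = 1`, hence zero, and may be added
to turn the weight `-2n` into `1 - 2n`. -/
theorem hasSum_odd_mul_triPow {q : ℂ} (h0 : q ≠ 0) (hq : ‖q‖ < 1) :
    HasSum (fun n : ℤ => -(2 * (n : ℂ) - 1) * (-1) ^ n * triPow q n) (2 * eulerProd q ^ 3) := by
  have h1 := hasSum_int_mul_triPow h0 hq
  have h2 := hasSum_triple_product h0 hq one_ne_zero
  rw [qProd_eq_one_sub_mul 1 hq] at h2
  convert! (h1.mul_left (-2)).add h2 using 1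
  · funext n
    rw [one_zpow]
    ring
  · rw [eulerProd]
    ring

end EtaShimura

/-! ### The weighted pentagonal series for `η(z)^5 / η(2z)^2` -/

namespace EtaShimura

open Filter Topology

lemma neg_one_zpow_mul_self (n : ℤ) : (-1 : ℂ) ^ n * (-1) ^ n = 1 := by
  rw [← mul_zpow]; norm_num

/-- Exponent bookkeeping for the substitution `a = c - 2b` that collects the terms `z^a z^(2b)` with
equal exponent `c`. -/
lemma triPow_sub_two_mul {q : ℂ} (h0 : q ≠ 0) (c b : ℤ) :
    triPow q (c - 2 * b) * q ^ (b ^ 2) = triPow q c * q ^ (3 * b ^ 2 - (2 * c - 1) * b) := by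
  unfold triPow
  rw [← zpow_add₀ h0, ← zpow_add₀ h0]
  congr 1
  have h1 := two_mul_tri (c - 2 * b)
  have h2 := two_mul_tri c
  have : 2 * ((c - 2 * b) * (c - 2 * b - 1) / 2 + b ^ 2) =
      2 * (c * (c - 1) / 2 + (3 * b ^ 2 - (2 * c - 1) * b)) := by
    linear_combination h1 - h2
  omega

lemma hasSum_pentagonal_sq {q : ℂ} (h0 : q ≠ 0) (hq : ‖q‖ < 1) :
    HasSum (fun n : ℤ => (-1) ^ n * q ^ (3 * n ^ 2 - n)) (eulerProd (q ^ 2)) := by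
  convert hasSum_pentagonal (pow_ne_zero 2 h0) (norm_pow_succ_lt_one hq 1) using 2 with n
  rw [pentPow, ← zpow_natCast, ← zpow_mul]
  congr 2
  push_cast
  rw [two_mul_pent]
  ring

/-- The coefficient sums that occur when two triple products are multiplied, for an exponent
divisible by three. -/
lemma hasSum_fiber_zero {q : ℂ} (h0 : q ≠ 0) (hq : ‖q‖ < 1) (m : ℤ) :
    HasSum (fun b : ℤ => (-1) ^ (3 * m + b) *
      (triPow q (3 * m) * q ^ (3 * b ^ 2 - (2 * (3 * m) - 1) * b)))
      (pentPow q m * eulerProd (q ^ 2)) := by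
  have h := (Equiv.neg ℤ).hasSum_iff.mpr (hasSum_int_shift (hasSum_pentagonal_sq h0 hq) m)
  convert! h.mul_left (pentPow q m) using 1
  funext b
  simp only [Function.comp, Equiv.neg_apply, triPow, pentPow]
  have e1 : (-1 : ℂ) ^ (3 * m + b) = (-1) ^ (-b + m) := by
    rw [show 3 * m + b = -b + m + 2 * (m + b) by ring, zpow_add₀ (by norm_num), zpow_mul (-1) 2]
    norm_num
  rw [e1, mul_left_comm (q ^ (m * (3 * m - 1) / 2)), ← zpow_add₀ h0, ← zpow_add₀ h0]
  congr 2
  have h1 := two_mul_tri (3 * m)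
  have h2 := two_mul_pent m
  have : 2 * (3 * m * (3 * m - 1) / 2 + (3 * b ^ 2 - (2 * (3 * m) - 1) * b)) =
      2 * (m * (3 * m - 1) / 2 + (3 * (-b + m) ^ 2 - (-b + m))) := by
    linear_combination h1 - h2
  omega

/-- Completing the square by the shift `b ↦ b - m` leaves a pentagonal series in `q²`, times a power
of `q` free of `b`. -/
lemma hasSum_fiber_one {q : ℂ} (h0 : q ≠ 0) (hq : ‖q‖ < 1) (m : ℤ) :
    HasSum (fun b : ℤ => (-1) ^ (3 * m + 1 + b) *
      (triPow q (3 * m + 1) * q ^ (3 * b ^ 2 - (2 * (3 * m + 1) - 1) * b)))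
      (-(pentPow q (-m) * eulerProd (q ^ 2))) := by
  have h := hasSum_int_shift (hasSum_pentagonal_sq h0 hq) (-m)
  convert! h.mul_left (-pentPow q (-m)) using 1
  · funext b
    simp only [triPow, pentPow]
    have e1 : (-1 : ℂ) ^ (3 * m + 1 + b) = -(-1) ^ (b + -m) := by
      rw [show 3 * m + 1 + b = b + -m + 2 * (2 * m) + 1 by ring, zpow_add_one₀ (by norm_num),
        zpow_add₀ (by norm_num), zpow_mul (-1) 2]
      norm_num
    rw [e1, neg_mul, neg_mul, mul_left_comm (q ^ (-m * (3 * -m - 1) / 2)), ← zpow_add₀ h0,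
      ← zpow_add₀ h0]
    congr 3
    have h1 := two_mul_tri (3 * m + 1)
    have h2 := two_mul_pent (-m)
    have : 2 * ((3 * m + 1) * (3 * m + 1 - 1) / 2 + (3 * b ^ 2 - (2 * (3 * m + 1) - 1) * b)) =
        2 * (-m * (3 * -m - 1) / 2 + (3 * (b + -m) ^ 2 - (b + -m))) := by
      linear_combination h1 - h2
    omega
  · ring

/-- The reflection `b ↦ 2m + 1 - b` fixes the exponent and reverses the sign, so the sum equals its
own negative. -/
lemma fiber_two_eq_zero {q : ℂ} (m : ℤ) {s : ℂ}
    (h : HasSum (fun b : ℤ => (-1) ^ (3 * m + 2 + b) *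
      (triPow q (3 * m + 2) * q ^ (3 * b ^ 2 - (2 * (3 * m + 2) - 1) * b))) s) : s = 0 := by
  have h1 := (Equiv.subLeft (2 * m + 1)).hasSum_iff.mpr h
  have h2 : s = -s := by
    refine h1.unique ?_
    convert! h.neg using 1
    funext b
    simp only [Function.comp, Equiv.subLeft_apply]
    have e1 : (-1 : ℂ) ^ (3 * m + 2 + (2 * m + 1 - b)) = -(-1) ^ (3 * m + 2 + b) := by
      rw [show 3 * m + 2 + (2 * m + 1 - b) = 3 * m + 2 + b + 2 * (m - b) + 1 by ring,
        zpow_add_one₀ (by norm_num), zpow_add₀ (by norm_num), zpow_mul (-1) 2]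
      norm_num
    rw [e1, neg_mul]
    congr 4
    ring
  linear_combination h2 / 2

lemma hasSum_extend {f : ℤ → ℂ} {s : ℂ} (h : HasSum f s) {e : ℤ → ℤ}
    (he : Function.Injective e) {F : ℤ → ℂ} (hF : ∀ n, F (e n) = f n)
    (hF0 : ∀ c, c ∉ Set.range e → F c = 0) : HasSum F s := by
  rw [← he.hasSum_iff hF0]
  convert h using 1
  exact funext hF

/-- The product rule at `z = 1` for `(∑ A(n) z^n)(∑ B(n) z^(2n))` when the first factor vanishes
there. With `c = a + 2b`, the part of the weight coming from `2b` is multiplied by `∑ A = 0`. -/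
lemma hasSum_convolution {A B : ℤ → ℂ} {s t : ℂ} (hA : HasSum A 0)
    (hA1 : HasSum (fun n : ℤ => (n : ℂ) * A n) s) (hB : HasSum B t)
    (hB1 : Summable fun n : ℤ => ‖(n : ℂ) * B n‖) :
    HasSum (fun p : ℤ × ℤ => (p.1 : ℂ) * (A (p.1 - 2 * p.2) * B p.2)) (s * t) := by
  have h1 : Summable fun p : ℤ × ℤ => ((p.1 : ℂ) * A p.1) * B p.2 :=
    summable_mul_of_summable_norm (f := fun n : ℤ => (n : ℂ) * A n) hA1.summable.norm
      hB.summable.norm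
  have h2 : Summable fun p : ℤ × ℤ => A p.1 * ((p.2 : ℂ) * B p.2) :=
    summable_mul_of_summable_norm (g := fun n : ℤ => (n : ℂ) * B n) hA.summable.norm hB1
  have h3 := HasSum.mul hA1 hB h1
  have h4 := HasSum.mul hA (Summable.hasSum (Summable.of_norm hB1)) h2
  have hD := h3.add (h4.mul_left 2)
  let e : ℤ × ℤ ≃ ℤ × ℤ :=
    ⟨fun p => (p.1 - 2 * p.2, p.2), fun p => (p.1 + 2 * p.2, p.2), fun p => by simp,
      fun p => by simp⟩
  convert! e.hasSum_iff.mpr hD using 1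
  · funext ⟨c, b⟩
    simp only [Function.comp, e, Equiv.coe_fn_mk]
    push_cast
    ring
  · ring

lemma hasSum_mul_tsum_fiber {T : ℤ → ℤ → ℂ} {s : ℂ}
    (h : HasSum (fun p : ℤ × ℤ => (p.1 : ℂ) * T p.1 p.2) s) :
    HasSum (fun c : ℤ => (c : ℂ) * ∑' b, T c b) s := by
  refine h.prod_fiberwise fun c => ?_
  -- Nothing is known about the summability of the fibre over `0`, but its weight is zero.
  rcases eq_or_ne c 0 with rfl | hc
  · simp
  · have h1 : Summable fun b => (c : ℂ) * T c b := h.summable.prod_factor c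
    have h2 : Summable (T c) := (summable_mul_left_iff (Int.cast_ne_zero.mpr hc)).mp h1
    exact h2.hasSum.mul_left _

/-- The general term of the double series for a product of two triple products. -/
noncomputable def doubleTerm (q : ℂ) (c b : ℤ) : ℂ :=
  (-1) ^ (c + b) * (triPow q c * q ^ (3 * b ^ 2 - (2 * c - 1) * b))

lemma hasSum_doubleTerm {q : ℂ} (h0 : q ≠ 0) (hq : ‖q‖ < 1) :
    HasSum (fun c : ℤ => (c : ℂ) * ∑' b, doubleTerm q c b)
      (-(eulerProd q ^ 5 / eulerProd (q ^ 2))) := by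
  apply hasSum_mul_tsum_fiber
  have hA0 := hasSum_triple_product h0 hq one_ne_zero
  rw [qProd_eq_one_sub_mul 1 hq, sub_self, zero_mul, mul_zero, zero_mul] at hA0
  simp only [one_zpow, mul_one] at hA0
  have hB1 : Summable fun n : ℤ => ‖(n : ℂ) * ((-1) ^ n * q ^ (n ^ 2))‖ := by
    refine (summable_triPow (pow_ne_zero 2 h0) (norm_pow_succ_lt_one hq 1) h0 1).congr fun n => ?_
    rw [← norm_mul, triPow_sq_mul h0]
    simp
  have h := hasSum_convolution hA0 (hasSum_int_mul_triPow h0 hq)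
    (hasSum_neg_one_zpow_mul_sq h0 hq) hB1
  have e : -qProd q q ^ 3 * (eulerProd q ^ 2 / eulerProd (q ^ 2)) =
      -(eulerProd q ^ 5 / eulerProd (q ^ 2)) := by
    change -eulerProd q ^ 3 * _ = _
    ring
  rw [e] at h
  refine h.congr_fun fun p => ?_
  have e1 : (-1 : ℂ) ^ (p.1 - 2 * p.2) * (-1) ^ p.2 = (-1) ^ (p.1 + p.2) := by
    rw [← zpow_add₀ (by norm_num), show p.1 + p.2 = p.1 - 2 * p.2 + p.2 + 2 * p.2 by ring,
      zpow_add₀ (by norm_num) (p.1 - 2 * p.2 + p.2), zpow_mul (-1) 2]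
    norm_num
  rw [doubleTerm, ← triPow_sub_two_mul h0, ← e1]
  ring

lemma tsum_doubleTerm_two (q : ℂ) (m : ℤ) : ∑' b, doubleTerm q (3 * m + 2) b = 0 := by
  by_cases hs : Summable (doubleTerm q (3 * m + 2))
  · exact fiber_two_eq_zero m hs.hasSum
  · exact tsum_eq_zero_of_not_summable hs

/-- In effect the derivative at `z = 1` of the quintuple product identity. The weighted double
series equals `-E(q)^5 / E(q²)`, with `E` the Euler product. Grouping by `c` modulo 3, the classes 0
and 1 contribute `3m` and `3m - 1` times `E(q²)` times the same pentagonal power, and class 2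
contributes nothing. -/
theorem hasSum_odd_mul_pentPow {q : ℂ} (h0 : q ≠ 0) (hq : ‖q‖ < 1) :
    HasSum (fun n : ℤ => (1 - 6 * (n : ℂ)) * pentPow q n)
      (eulerProd q ^ 5 / eulerProd (q ^ 2) ^ 2) := by
  have he2 := eulerProd_ne_zero (norm_pow_succ_lt_one hq 1)
  set K : ℤ → ℂ := fun c => ∑' b, doubleTerm q c b
  have hK : HasSum (fun c : ℤ => (c : ℂ) * K c) (-(eulerProd q ^ 5 / eulerProd (q ^ 2))) :=
    hasSum_doubleTerm h0 hq
  have hK0 : ∀ m, K (3 * m) = pentPow q m * eulerProd (q ^ 2) :=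
    fun m => (hasSum_fiber_zero h0 hq m).tsum_eq
  have hK1 : ∀ m, K (3 * m + 1) = -(pentPow q (-m) * eulerProd (q ^ 2)) :=
    fun m => (hasSum_fiber_one h0 hq m).tsum_eq
  have hK2 : ∀ m, K (3 * m + 2) = 0 := tsum_doubleTerm_two q
  have hP0 := hasSum_pentPow h0 hq
  have hP1 : Summable fun n : ℤ => (n : ℂ) * pentPow q n := by
    refine ((summable_triPow (pow_ne_zero 3 h0) (norm_pow_succ_lt_one hq 2) h0 1).congr
      fun n => ?_).of_norm
    rw [← norm_mul, triPow_cube_mul h0]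
    simp
  obtain ⟨s0, hs0⟩ : ∃ s, HasSum (fun n : ℤ => pentPow q n) s := ⟨_, hP0⟩
  obtain ⟨s1, hs1⟩ := hP1
  have f0 : HasSum (fun c : ℤ => if c % 3 = 0 then (c : ℂ) * K c else 0)
      (3 * eulerProd (q ^ 2) * s1) := by
    refine hasSum_extend (hs1.mul_left (3 * eulerProd (q ^ 2))) (e := fun m => 3 * m)
      (fun a b h => by simpa using h) (fun m => ?_) (fun c hc => ?_)
    · rw [if_pos (by omega), hK0]
      push_cast
      ring
    · refine if_neg fun h => hc ⟨c / 3, ?_⟩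
      simp only
      omega
  -- The class is indexed by `c = 1 - 3m`, so that its terms involve `pentPow q m` like those of
  -- class 0.
  have f1 : HasSum (fun c : ℤ => if c % 3 = 1 then (c : ℂ) * K c else 0)
      (eulerProd (q ^ 2) * (3 * s1 - s0)) := by
    refine hasSum_extend (((hs1.mul_left 3).sub hs0).mul_left (eulerProd (q ^ 2)))
      (e := fun m => 3 * (-m) + 1)
      (fun a b h => by simp only at h; omega) (fun m => ?_) (fun c hc => ?_)
    · rw [if_pos (by omega), hK1, neg_neg]
      push_cast
      ring
    · refine if_neg fun h => hc ⟨-(c / 3), ?_⟩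
      simp only
      omega
  have hu := hK.unique (a₂ := 3 * eulerProd (q ^ 2) * s1 + eulerProd (q ^ 2) * (3 * s1 - s0)) (by
    convert! f0.add f1 using 1
    funext c
    have h3 : c % 3 = 0 ∨ c % 3 = 1 ∨ c % 3 = 2 := by omega
    rcases h3 with h | h | h
    · simp [h]
    · simp [h]
    · obtain ⟨m, rfl⟩ : ∃ m, c = 3 * m + 2 := ⟨c / 3, by omega⟩
      simp [h, hK2])
  convert! hs0.sub (hs1.mul_left 6) using 1
  · funext n
    ring
  · field_simp at hu ⊢
    linear_combination -hu

end EtaShimura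

namespace EtaShimura

open Filter Topology

/-! ### Eta quotients as theta series -/

/-- The quadratic character `(-4 / ·)` on the integers. -/
def chiFour (m : ℤ) : ℤ := if m % 4 = 1 then 1 else if m % 4 = 3 then -1 else 0

/-- The quadratic character `(8 / ·)` on the integers. -/
def chiEight (m : ℤ) : ℤ :=
  if m % 8 = 1 ∨ m % 8 = 7 then 1 else if m % 8 = 3 ∨ m % 8 = 5 then -1 else 0

/-- The quadratic character `(12 / ·)` on the integers. -/
def chiTwelve (m : ℤ) : ℤ :=
  if m % 12 = 1 ∨ m % 12 = 11 then 1 else if m % 12 = 5 ∨ m % 12 = 7 then -1 else 0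

lemma chiFour_neg (m : ℤ) : chiFour (-m) = -chiFour m := by
  unfold chiFour; split_ifs <;> omega

lemma chiEight_neg (m : ℤ) : chiEight (-m) = chiEight m := by
  unfold chiEight; split_ifs <;> omega

lemma chiTwelve_neg (m : ℤ) : chiTwelve (-m) = chiTwelve m := by
  unfold chiTwelve; split_ifs <;> omega

lemma chiFour_eq_zero {m : ℤ} (h : m % 2 = 0) : chiFour m = 0 := by
  unfold chiFour; split_ifs <;> omega

lemma chiEight_eq_zero {m : ℤ} (h : m % 2 = 0) : chiEight m = 0 := by
  unfold chiEight; split_ifs <;> omega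

lemma chiTwelve_eq_zero {m : ℤ} (h1 : m % 6 ≠ 1) (h5 : m % 6 ≠ 5) : chiTwelve m = 0 := by
  unfold chiTwelve; split_ifs <;> omega

lemma neg_one_zpow_eq_ite (n : ℤ) : (-1 : ℂ) ^ n = if n % 2 = 0 then 1 else -1 := by
  rcases Int.even_or_odd n with h | h
  · rw [h.neg_one_zpow, if_pos (Int.even_iff.mp h)]
  · rw [h.neg_one_zpow, if_neg (by rw [Int.odd_iff.mp h]; norm_num)]

lemma chiTwelve_six_mul_sub_one (n : ℤ) : (chiTwelve (6 * n - 1) : ℂ) = (-1) ^ n := by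
  rw [neg_one_zpow_eq_ite, chiTwelve]
  split_ifs <;> first | omega | simp

lemma chiFour_six_mul_sub_one (n : ℤ) : (chiFour (6 * n - 1) : ℂ) = -(-1) ^ n := by
  rw [neg_one_zpow_eq_ite, chiFour]
  split_ifs <;> first | omega | simp

lemma chiFour_two_mul_sub_one (n : ℤ) : (chiFour (2 * n - 1) : ℂ) = -(-1) ^ n := by
  rw [neg_one_zpow_eq_ite, chiFour]
  split_ifs <;> first | omega | simp

/-- The rule `(2/m) = (-1)^((m² - 1)/8)` at `m = 2n - 1`, where `(m² - 1)/8 = n(n - 1)/2`. Both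
sides depend only on `n` modulo 4. -/
lemma triPow_neg (q : ℂ) (n : ℤ) :
    triPow (-q) n = (chiEight (2 * n - 1) : ℂ) * triPow q n := by
  unfold triPow
  rw [← neg_one_mul q, mul_zpow, neg_one_zpow_eq_ite, chiEight]
  congr 1
  obtain ⟨k, r, hr0, hr4, rfl⟩ : ∃ k r : ℤ, 0 ≤ r ∧ r < 4 ∧ n = 4 * k + r :=
    ⟨n / 4, n % 4, by omega, by omega, by omega⟩
  have h := two_mul_tri (4 * k + r)
  have h2 : (4 * k + r) * (4 * k + r - 1) = 4 * (4 * k ^ 2 + 2 * k * r - k) + r * (r - 1) := by ring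
  rw [h2] at h ⊢
  interval_cases r <;> split_ifs <;> first | omega | simp

/-- The same rule at `m = 6n - 1`, where `(m² - 1)/8` is three times the pentagonal exponent and so
has its parity. -/
lemma pentPow_neg (q : ℂ) (n : ℤ) :
    pentPow (-q) n = (chiEight (6 * n - 1) : ℂ) * pentPow q n := by
  unfold pentPow
  rw [← neg_one_mul q, mul_zpow, neg_one_zpow_eq_ite, chiEight]
  congr 1
  obtain ⟨k, r, hr0, hr4, rfl⟩ : ∃ k r : ℤ, 0 ≤ r ∧ r < 4 ∧ n = 4 * k + r :=
    ⟨n / 4, n % 4, by omega, by omega, by omega⟩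
  have h := two_mul_pent (4 * k + r)
  have h2 : (4 * k + r) * (3 * (4 * k + r) - 1) =
      4 * (12 * k ^ 2 + 6 * k * r - k) + r * (3 * r - 1) := by ring
  rw [h2] at h ⊢
  interval_cases r <;> split_ifs <;> first | omega | simp

/-- Since `(6n - 1)² = 24 · n(3n - 1)/2 + 1`, the prefactor `Q` completes the square; `n ↦ |6n - 1|`
is a bijection from the integers to the natural numbers prime to 6. -/
lemma hasSum_nat_of_pentPow {Q : ℂ} (hQ : Q ≠ 0) {w : ℤ → ℂ} {e : ℤ → ℤ} {s : ℂ}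
    (h : HasSum (fun n : ℤ => w n * pentPow (Q ^ 24) n) s) (hneg : ∀ m, e (-m) = e m)
    (hw : ∀ n, (e (6 * n - 1) : ℂ) = w n) (h0 : ∀ m, m % 6 ≠ 1 → m % 6 ≠ 5 → e m = 0) :
    HasSum (fun m : ℕ => (e m : ℂ) * Q ^ (m ^ 2)) (Q * s) := by
  have hinj : Function.Injective fun n : ℤ => (6 * n - 1).natAbs := by
    intro a b hab
    simp only at hab
    omega
  rw [← hinj.hasSum_iff]
  · convert! h.mul_left Q using 1
    funext n
    simp only [Function.comp]
    have h1 : e ((6 * n - 1).natAbs : ℤ) = e (6 * n - 1) := by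
      rcases Int.natAbs_eq (6 * n - 1) with h | h
      · rw [← h]
      · rw [← hneg, ← h]
    rw [h1, hw, mul_left_comm, pentPow]
    congr 1
    rw [← zpow_natCast, ← zpow_natCast, ← zpow_mul]
    nth_rw 2 [← zpow_one Q]
    rw [← zpow_add₀ hQ]
    congr 1
    have := two_mul_pent n
    push_cast
    rw [sq_abs]
    linear_combination -12 * this
  · intro m hm
    have : e m = 0 := by
      refine h0 _ (fun h => hm ⟨-((m : ℤ) / 6), ?_⟩) (fun h => hm ⟨(m : ℤ) / 6 + 1, ?_⟩) <;>
      · simp only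
        omega
    simp [this]

/-- Here `(2n - 1)² = 8 · n(n - 1)/2 + 1`, and `n ↦ |2n - 1|` meets every odd natural number twice;
hence `2 * s` in the hypothesis against `s` in the conclusion. -/
lemma hasSum_nat_of_triPow {Q : ℂ} (hQ : Q ≠ 0) {w : ℤ → ℂ} {e : ℤ → ℤ} {s : ℂ}
    (h : HasSum (fun n : ℤ => w n * triPow (Q ^ 8) n) (2 * s)) (hneg : ∀ m, e (-m) = e m)
    (hw : ∀ n, (e (2 * n - 1) : ℂ) = w n) (h0 : ∀ m, m % 2 = 0 → e m = 0) :
    HasSum (fun m : ℕ => (e m : ℂ) * Q ^ (m ^ 2)) (Q * s) := by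
  have hterm : ∀ n : ℤ, Q * (w n * triPow (Q ^ 8) n) = (e (2 * n - 1) : ℂ) * Q ^ ((2 * n - 1) ^ 2) := by
    intro n
    rw [hw, mul_left_comm, triPow]
    congr 1
    rw [← zpow_natCast, ← zpow_mul]
    nth_rw 1 [← zpow_one Q]
    rw [← zpow_add₀ hQ]
    congr 1
    have := two_mul_tri n
    push_cast
    linear_combination 4 * this
  -- After this reflection, folding the bilateral series pairs `-n` with `n + 1`, the two indices
  -- whose `|2j - 1|` is `2n + 1`.
  have h1 := (Equiv.neg ℤ).hasSum_iff.mpr ((h.mul_left (Q / 2)))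
  have h2 := h1.nat_add_neg_add_one
  have hinj : Function.Injective fun n : ℕ => 2 * n + 1 := by
    intro a b hab
    simp only at hab
    omega
  rw [← hinj.hasSum_iff]
  · convert! h2 using 1
    · funext n
      simp only [Function.comp, Equiv.neg_apply]
      have e1 := hterm (-n)
      have e2 := hterm (n + 1)
      rw [show 2 * -(n : ℤ) - 1 = -(2 * n + 1) by ring, hneg, neg_sq] at e1
      rw [show 2 * ((n : ℤ) + 1) - 1 = 2 * n + 1 by ring] at e2
      rw [neg_neg]
      have e3 : Q ^ ((2 * (n : ℤ) + 1) ^ 2) = Q ^ ((2 * n + 1) ^ 2) := by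
        rw [← zpow_natCast]; push_cast; rfl
      rw [e3] at e1 e2
      push_cast
      linear_combination -e1 / 2 - e2 / 2
    · ring
  · intro m hm
    have : e m = 0 := by
      refine h0 _ (by_contra fun h => hm ⟨m / 2, ?_⟩)
      simp only
      omega
    simp [this]

lemma qParam_nat_mul (h : ℝ) (m : ℕ) (z : ℂ) :
    Function.Periodic.qParam h (m * z) = Function.Periodic.qParam h z ^ m := by
  simp only [Function.Periodic.qParam, ← Complex.exp_nat_mul]
  congr 1
  ring

lemma qParam_eq_pow {h h' : ℝ} (hh : h ≠ 0) {m : ℕ} (hm0 : m ≠ 0) (hm : h' = m * h) (z : ℂ) :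
    Function.Periodic.qParam h z = Function.Periodic.qParam h' z ^ m := by
  simp only [Function.Periodic.qParam, ← Complex.exp_nat_mul]
  have hm' : (m : ℂ) ≠ 0 := Nat.cast_ne_zero.mpr hm0
  have hh' : (h : ℂ) ≠ 0 := Complex.ofReal_ne_zero.mpr hh
  congr 1
  rw [hm]
  push_cast
  field_simp

/-- The series `∑ e(m) q^(m² / D)` over the natural numbers `m` converges to `F`. -/
def IsThetaSeries (D : ℕ) (e : ℤ → ℤ) (F : ℍ → ℂ) : Prop :=
  ∀ z : ℍ, HasSum (fun m : ℕ => (e m : ℂ) * Function.Periodic.qParam D (z : ℂ) ^ (m ^ 2)) (F z)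

/-- With everything written in `Q = q^(1/24)` and Euler products of powers of `Q^24`, identities of
eta-quotients become identities of fractions. -/
lemma etaAt_eq (m : ℕ) (z : ℍ) :
    etaAt m z = Function.Periodic.qParam 24 (z : ℂ) ^ m *
      eulerProd ((Function.Periodic.qParam 24 (z : ℂ) ^ 24) ^ m) := by
  have h1 : Function.Periodic.qParam 1 (z : ℂ) = Function.Periodic.qParam 24 (z : ℂ) ^ 24 :=
    qParam_eq_pow one_ne_zero (by norm_num) (by norm_num) _
  rw [etaAt, ModularForm.eta, qParam_nat_mul, eulerProd, qProd, ← h1]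
  congr 1
  refine tprod_congr fun n => ?_
  rw [ModularForm.eta_q, qParam_nat_mul]
  ring

lemma isThetaSeries_eight {e : ℤ → ℤ} {F : ℍ → ℂ} {w : ℤ → ℂ} {s : ℂ → ℂ}
    (h : ∀ q : ℂ, q ≠ 0 → ‖q‖ < 1 → HasSum (fun n : ℤ => w n * triPow q n) (2 * s q))
    (hneg : ∀ m, e (-m) = e m) (hw : ∀ n, (e (2 * n - 1) : ℂ) = w n)
    (h0 : ∀ m, m % 2 = 0 → e m = 0)
    (hF : ∀ z : ℍ, F z = Function.Periodic.qParam 24 (z : ℂ) ^ 3 *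
      s (Function.Periodic.qParam 24 (z : ℂ) ^ 24)) : IsThetaSeries 8 e F := by
  intro z
  have h3 : Function.Periodic.qParam 8 (z : ℂ) = Function.Periodic.qParam 24 (z : ℂ) ^ 3 :=
    qParam_eq_pow (by norm_num) (by norm_num) (by norm_num) _
  have hQ : Function.Periodic.qParam 8 (z : ℂ) ≠ 0 := Function.Periodic.qParam_ne_zero _
  have hlt : ‖Function.Periodic.qParam 8 (z : ℂ)‖ < 1 := by
    exact_mod_cast norm_qParam_lt_one 8 z
  rw [hF, show Function.Periodic.qParam 24 (z : ℂ) ^ 24 =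
    (Function.Periodic.qParam 24 (z : ℂ) ^ 3) ^ 8 by ring, ← h3]
  exact_mod_cast hasSum_nat_of_triPow hQ (h _ (pow_ne_zero 8 hQ) (norm_pow_succ_lt_one hlt 7))
    hneg hw h0

lemma isThetaSeries_twentyFour {e : ℤ → ℤ} {F : ℍ → ℂ} {w : ℤ → ℂ} {s : ℂ → ℂ}
    (h : ∀ q : ℂ, q ≠ 0 → ‖q‖ < 1 → HasSum (fun n : ℤ => w n * pentPow q n) (s q))
    (hneg : ∀ m, e (-m) = e m) (hw : ∀ n, (e (6 * n - 1) : ℂ) = w n)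
    (h0 : ∀ m, m % 6 ≠ 1 → m % 6 ≠ 5 → e m = 0)
    (hF : ∀ z : ℍ, F z = Function.Periodic.qParam 24 (z : ℂ) *
      s (Function.Periodic.qParam 24 (z : ℂ) ^ 24)) : IsThetaSeries 24 e F := by
  intro z
  have hQ : Function.Periodic.qParam 24 (z : ℂ) ≠ 0 := Function.Periodic.qParam_ne_zero _
  have hlt : ‖Function.Periodic.qParam 24 (z : ℂ)‖ < 1 := by
    exact_mod_cast norm_qParam_lt_one 24 z
  rw [hF]
  exact_mod_cast hasSum_nat_of_pentPow hQ (h _ (pow_ne_zero 24 hQ)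
    (norm_pow_succ_lt_one hlt 23)) hneg hw h0

/-- Replacing `q` by `-q` in the product, but not in the prefactor `q^(1/8)`, twists the theta
coefficients by `(8/·)`. -/
lemma isThetaSeries_eight_neg {e : ℤ → ℤ} {F : ℍ → ℂ} {w : ℤ → ℂ} {s : ℂ → ℂ}
    (h : ∀ q : ℂ, q ≠ 0 → ‖q‖ < 1 → HasSum (fun n : ℤ => w n * triPow q n) (2 * s q))
    (hneg : ∀ m, e (-m) = e m) (hw : ∀ n, (e (2 * n - 1) : ℂ) = w n)
    (h0 : ∀ m, m % 2 = 0 → e m = 0)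
    (hF : ∀ z : ℍ, F z = Function.Periodic.qParam 24 (z : ℂ) ^ 3 *
      s (-Function.Periodic.qParam 24 (z : ℂ) ^ 24)) :
    IsThetaSeries 8 (fun m => e m * chiEight m) F := by
  refine isThetaSeries_eight (w := fun n => w n * chiEight (2 * n - 1)) (s := fun q => s (-q))
    (fun q hq0 hq => ?_) (fun m => by rw [hneg, chiEight_neg]) (fun n => by push_cast; rw [hw])
    (fun m hm => by rw [h0 m hm, zero_mul]) hF
  refine (h (-q) (neg_ne_zero.mpr hq0) (by rwa [norm_neg])).congr_fun fun n => ?_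
  rw [triPow_neg, mul_assoc]

lemma isThetaSeries_twentyFour_neg {e : ℤ → ℤ} {F : ℍ → ℂ} {w : ℤ → ℂ} {s : ℂ → ℂ}
    (h : ∀ q : ℂ, q ≠ 0 → ‖q‖ < 1 → HasSum (fun n : ℤ => w n * pentPow q n) (s q))
    (hneg : ∀ m, e (-m) = e m) (hw : ∀ n, (e (6 * n - 1) : ℂ) = w n)
    (h0 : ∀ m, m % 6 ≠ 1 → m % 6 ≠ 5 → e m = 0)
    (hF : ∀ z : ℍ, F z = Function.Periodic.qParam 24 (z : ℂ) *
      s (-Function.Periodic.qParam 24 (z : ℂ) ^ 24)) :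
    IsThetaSeries 24 (fun m => e m * chiEight m) F := by
  refine isThetaSeries_twentyFour (w := fun n => w n * chiEight (6 * n - 1))
    (s := fun q => s (-q)) (fun q hq0 hq => ?_) (fun m => by rw [hneg, chiEight_neg])
    (fun n => by push_cast; rw [hw]) (fun m h1 h5 => by rw [h0 m h1 h5, zero_mul]) hF
  refine (h (-q) (neg_ne_zero.mpr hq0) (by rwa [norm_neg])).congr_fun fun n => ?_
  rw [pentPow_neg, mul_assoc]

lemma qParam_pow_ne_zero (z : ℍ) (n : ℕ) : Function.Periodic.qParam 24 (z : ℂ) ^ n ≠ 0 :=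
  pow_ne_zero n (Function.Periodic.qParam_ne_zero _)

lemma norm_qParam_pow_lt_one (z : ℍ) :
    ‖Function.Periodic.qParam 24 (z : ℂ) ^ 24‖ < 1 :=
  norm_pow_succ_lt_one (by exact_mod_cast norm_qParam_lt_one 24 z) 23

lemma eulerProd_qParam_ne_zero (z : ℍ) (m : ℕ) (hm : m ≠ 0) :
    eulerProd ((Function.Periodic.qParam 24 (z : ℂ) ^ 24) ^ m) ≠ 0 := by
  obtain ⟨n, rfl⟩ := Nat.exists_eq_succ_of_ne_zero hm
  exact eulerProd_ne_zero (norm_pow_succ_lt_one (norm_qParam_pow_lt_one z) n)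

lemma chiTwelve_sq_six_mul_sub_one (n : ℤ) : ((chiTwelve (6 * n - 1) ^ 2 : ℤ) : ℂ) = 1 := by
  push_cast
  rw [chiTwelve_six_mul_sub_one, sq, neg_one_zpow_mul_self]

lemma chiFour_sq_two_mul_sub_one (n : ℤ) : ((chiFour (2 * n - 1) ^ 2 : ℤ) : ℂ) = 1 := by
  push_cast
  rw [chiFour_two_mul_sub_one, neg_sq, sq, neg_one_zpow_mul_self]

theorem isThetaSeries_eta : IsThetaSeries 24 chiTwelve (etaAt 1) := by
  refine isThetaSeries_twentyFour (fun q h0 hq => hasSum_pentagonal h0 hq) chiTwelve_neg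
    chiTwelve_six_mul_sub_one (fun m => chiTwelve_eq_zero) fun z => ?_
  rw [etaAt_eq, pow_one, pow_one]

theorem isThetaSeries_eta_sq_two :
    IsThetaSeries 8 (fun m => chiFour m ^ 2) (etaAt 2 ^ 2 / etaAt 1) := by
  refine isThetaSeries_eight (w := fun _ => 1) (fun q h0 hq => by
      simpa using hasSum_triPow h0 hq) (fun m => by rw [chiFour_neg, neg_sq])
    chiFour_sq_two_mul_sub_one (fun m hm => by rw [chiFour_eq_zero hm]; rfl) fun z => ?_
  have h := qParam_pow_ne_zero z
  have hE := eulerProd_qParam_ne_zero z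
  have h1 := hE 1 one_ne_zero
  have hQ := h 1
  simp only [Pi.div_apply, Pi.pow_apply, etaAt_eq, pow_one] at *
  field_simp

theorem isThetaSeries_eta_one_four :
    IsThetaSeries 8 (fun m => chiFour m ^ 2 * chiEight m) (etaAt 1 * etaAt 4 / etaAt 2) := by
  refine isThetaSeries_eight_neg (w := fun _ => 1) (fun q h0 hq => by
      simpa using hasSum_triPow h0 hq) (fun m => by rw [chiFour_neg, neg_sq])
    chiFour_sq_two_mul_sub_one (fun m hm => by rw [chiFour_eq_zero hm]; rfl) fun z => ?_
  have h := qParam_pow_ne_zero z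
  have hE := eulerProd_qParam_ne_zero z
  have h1 := hE 1 one_ne_zero
  have h2 := hE 2 two_ne_zero
  have h4 := hE 4 four_ne_zero
  have hQ := h 1
  rw [eulerProd_neg (norm_qParam_pow_lt_one z)]
  simp only [Pi.div_apply, Pi.mul_apply, etaAt_eq, pow_one, neg_sq] at *
  field_simp

theorem isThetaSeries_eta_sq_three :
    IsThetaSeries 24 (fun m => chiTwelve m ^ 2) (etaAt 2 * etaAt 3 ^ 2 / (etaAt 1 * etaAt 6)) := by
  refine isThetaSeries_twentyFour (w := fun _ => 1) (fun q h0 hq => by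
      simpa using hasSum_pentPow h0 hq) (fun m => by rw [chiTwelve_neg])
    chiTwelve_sq_six_mul_sub_one (fun m h1 h5 => by rw [chiTwelve_eq_zero h1 h5]; rfl) fun z => ?_
  have h := qParam_pow_ne_zero z
  have hE := eulerProd_qParam_ne_zero z
  have h1 := hE 1 one_ne_zero
  have h6 := hE 6 (by norm_num)
  have hQ := h 1
  simp only [Pi.div_apply, Pi.mul_apply, Pi.pow_apply, etaAt_eq, pow_one] at *
  field_simp

theorem isThetaSeries_eta_cube_two :
    IsThetaSeries 24 (fun m => chiTwelve m * chiEight m)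
      (etaAt 2 ^ 3 / (etaAt 1 * etaAt 4)) := by
  refine isThetaSeries_twentyFour_neg (fun q h0 hq => hasSum_pentagonal h0 hq) chiTwelve_neg
    chiTwelve_six_mul_sub_one (fun m => chiTwelve_eq_zero) fun z => ?_
  have h := qParam_pow_ne_zero z
  have hE := eulerProd_qParam_ne_zero z
  have h1 := hE 1 one_ne_zero
  have h4 := hE 4 four_ne_zero
  have hQ := h 1
  rw [eulerProd_neg (norm_qParam_pow_lt_one z)]
  simp only [Pi.div_apply, Pi.mul_apply, Pi.pow_apply, etaAt_eq, pow_one] at *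
  field_simp

theorem isThetaSeries_eta_twelve :
    IsThetaSeries 24 (fun m => chiTwelve m ^ 2 * chiEight m)
      (etaAt 1 * etaAt 4 * etaAt 6 ^ 5 / (etaAt 2 ^ 2 * etaAt 3 ^ 2 * etaAt 12 ^ 2)) := by
  refine isThetaSeries_twentyFour_neg (w := fun _ => 1) (fun q h0 hq => by
      simpa using hasSum_pentPow h0 hq) (fun m => by rw [chiTwelve_neg])
    chiTwelve_sq_six_mul_sub_one (fun m h1 h5 => by rw [chiTwelve_eq_zero h1 h5]; rfl) fun z => ?_
  have h := qParam_pow_ne_zero z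
  have hE := eulerProd_qParam_ne_zero z
  have h1 := hE 1 one_ne_zero
  have h2 := hE 2 two_ne_zero
  have h3 := hE 3 three_ne_zero
  have h4 := hE 4 four_ne_zero
  have h6 := hE 6 (by norm_num)
  have h12 := hE 12 (by norm_num)
  have hQ := h 1
  -- Under `q ↦ -q` the product at `q³` changes as well, while those at `q²` and `q⁶` do not; so the
  -- sign rule is needed at both `q` and `q³`.
  have e3 := eulerProd_neg (norm_pow_succ_lt_one (norm_qParam_pow_lt_one z) 2)
  have e2 : ∀ x : ℂ, (-x) ^ 2 = x ^ 2 := neg_sq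
  have e6 : ∀ x : ℂ, (-x) ^ 6 = x ^ 6 := fun x => by ring
  have e3' : ∀ x : ℂ, (-x) ^ 3 = -x ^ 3 := fun x => by ring
  rw [e2, e6, e3']
  rw [eulerProd_neg (norm_qParam_pow_lt_one z)]
  norm_num only at e3
  rw [e3]
  simp only [Pi.div_apply, Pi.mul_apply, Pi.pow_apply, etaAt_eq, pow_one, ← pow_mul] at *
  norm_num only at *
  field_simp

theorem isThetaSeries_eta_cube : IsThetaSeries 8 (fun m => chiFour m * m) (etaAt 1 ^ 3) := by
  refine isThetaSeries_eight (fun q h0 hq => hasSum_odd_mul_triPow h0 hq)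
    (fun m => by rw [chiFour_neg, neg_mul_neg])
    (fun n => by push_cast; rw [chiFour_two_mul_sub_one]; ring)
    (fun m hm => by rw [chiFour_eq_zero hm, zero_mul]) fun z => ?_
  simp only [Pi.pow_apply, etaAt_eq, pow_one]
  ring

theorem isThetaSeries_eta_pow_nine :
    IsThetaSeries 8 (fun m => chiFour m * m * chiEight m)
      (etaAt 2 ^ 9 / (etaAt 1 ^ 3 * etaAt 4 ^ 3)) := by
  refine isThetaSeries_eight_neg (fun q h0 hq => hasSum_odd_mul_triPow h0 hq)
    (fun m => by rw [chiFour_neg, neg_mul_neg])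
    (fun n => by push_cast; rw [chiFour_two_mul_sub_one]; ring)
    (fun m hm => by rw [chiFour_eq_zero hm, zero_mul]) fun z => ?_
  have h := qParam_pow_ne_zero z
  have hE := eulerProd_qParam_ne_zero z
  have h1 := hE 1 one_ne_zero
  have h4 := hE 4 four_ne_zero
  have hQ := h 1
  rw [eulerProd_neg (norm_qParam_pow_lt_one z)]
  simp only [Pi.div_apply, Pi.mul_apply, Pi.pow_apply, etaAt_eq, pow_one] at *
  field_simp

/-- The product of the two characters is `(-3/·)` on integers prime to 6, and equals `-1` at `6n -
1`. -/
lemma chi_six_mul_sub_one (n : ℤ) :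
    ((chiTwelve (6 * n - 1) * chiFour (6 * n - 1) * (6 * n - 1) : ℤ) : ℂ) = 1 - 6 * n := by
  push_cast
  rw [chiTwelve_six_mul_sub_one, chiFour_six_mul_sub_one]
  linear_combination (1 - 6 * (n : ℂ)) * neg_one_zpow_mul_self n

theorem isThetaSeries_eta_pow_five :
    IsThetaSeries 24 (fun m => chiTwelve m * chiFour m * m) (etaAt 1 ^ 5 / etaAt 2 ^ 2) := by
  refine isThetaSeries_twentyFour (fun q h0 hq => hasSum_odd_mul_pentPow h0 hq)
    (fun m => by rw [chiFour_neg, chiTwelve_neg]; ring) chi_six_mul_sub_one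
    (fun m h1 h5 => by rw [chiTwelve_eq_zero h1 h5, zero_mul, zero_mul]) fun z => ?_
  have h := qParam_pow_ne_zero z
  have hE := eulerProd_qParam_ne_zero z
  have h2 := hE 2 two_ne_zero
  have hQ := h 1
  simp only [Pi.div_apply, Pi.pow_apply, etaAt_eq, pow_one] at *
  field_simp

theorem isThetaSeries_eta_pow_thirteen :
    IsThetaSeries 24 (fun m => chiTwelve m * chiFour m * m * chiEight m)
      (etaAt 2 ^ 13 / (etaAt 1 ^ 5 * etaAt 4 ^ 5)) := by
  refine isThetaSeries_twentyFour_neg (fun q h0 hq => hasSum_odd_mul_pentPow h0 hq)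
    (fun m => by rw [chiFour_neg, chiTwelve_neg]; ring) chi_six_mul_sub_one
    (fun m h1 h5 => by rw [chiTwelve_eq_zero h1 h5, zero_mul, zero_mul]) fun z => ?_
  have h := qParam_pow_ne_zero z
  have hE := eulerProd_qParam_ne_zero z
  have h1 := hE 1 one_ne_zero
  have h2 := hE 2 two_ne_zero
  have h4 := hE 4 four_ne_zero
  have hQ := h 1
  rw [eulerProd_neg (norm_qParam_pow_lt_one z), neg_sq]
  simp only [Pi.div_apply, Pi.mul_apply, Pi.pow_apply, etaAt_eq, pow_one] at *
  field_simp

end EtaShimura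

namespace EtaShimura

open Filter Topology

/-! ### Functions given by `q`-series -/

/-- The series `∑ c(n) q^(n / h)` converges to `F` on the upper half-plane. -/
def HasQExp (h : ℝ) (c : ℕ → ℂ) (F : ℍ → ℂ) : Prop :=
  ∀ z : ℍ, HasSum (fun n : ℕ => c n * Function.Periodic.qParam h (z : ℂ) ^ n) (F z)

lemma HasQExp.congr {h : ℝ} {c d : ℕ → ℂ} {F G : ℍ → ℂ} (hc : HasQExp h c F)
    (hcd : ∀ n, d n = c n) (hFG : G = F) : HasQExp h d G := by
  rw [hFG, show d = c from funext hcd]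
  exact hc

lemma HasQExp.add {h : ℝ} {c d : ℕ → ℂ} {F G : ℍ → ℂ} (hF : HasQExp h c F)
    (hG : HasQExp h d G) : HasQExp h (fun n => c n + d n) (F + G) := fun z => by
  simp only [add_mul]
  exact (hF z).add (hG z)

lemma HasQExp.sub {h : ℝ} {c d : ℕ → ℂ} {F G : ℍ → ℂ} (hF : HasQExp h c F)
    (hG : HasQExp h d G) : HasQExp h (fun n => c n - d n) (F - G) := fun z => by
  simp only [sub_mul]
  exact (hF z).sub (hG z)

lemma HasQExp.smul {h : ℝ} {c : ℕ → ℂ} {F : ℍ → ℂ} (hF : HasQExp h c F) (s : ℂ) :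
    HasQExp h (fun n => s * c n) (s • F) := fun z => by
  simpa only [mul_assoc, Pi.smul_apply, smul_eq_mul] using (hF z).mul_left s

lemma HasQExp.mul {h : ℝ} {c d : ℕ → ℂ} {F G : ℍ → ℂ} (hF : HasQExp h c F)
    (hG : HasQExp h d G) :
    HasQExp h (fun n => ∑ p ∈ Finset.HasAntidiagonal.antidiagonal n, c p.1 * d p.2) (F * G) := fun z => by
  have hs := summable_norm_sum_mul_antidiagonal_of_summable_norm (hF z).summable.norm
    (hG z).summable.norm
  have ht := tsum_mul_tsum_eq_tsum_sum_antidiagonal_of_summable_norm (hF z).summable.norm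
    (hG z).summable.norm
  rw [(hF z).tsum_eq, (hG z).tsum_eq] at ht
  have := hs.of_norm.hasSum
  rw [← ht] at this
  refine this.congr_fun fun n => ?_
  rw [Finset.sum_mul]
  refine Finset.sum_congr rfl fun p hp => ?_
  rw [← Finset.HasAntidiagonal.mem_antidiagonal.mp hp, pow_add]
  ring

/-- Every nonzero point of the open disc is the parameter of a point of `ℍ`, so convergence on `ℍ`
is convergence on the whole disc. -/
lemma HasQExp.summable_norm {h : ℝ} (hh : 0 < h) {c : ℕ → ℂ} {F : ℍ → ℂ} (hF : HasQExp h c F)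
    {q : ℂ} (hq : ‖q‖ < 1) : Summable fun n => ‖c n * q ^ n‖ := by
  rcases eq_or_ne q 0 with rfl | h0
  · refine summable_of_ne_finset_zero (s := {0}) fun n hn => ?_
    rw [zero_pow (by simpa using hn), mul_zero, norm_zero]
  · have := (hF ⟨_, Function.Periodic.im_invQParam_pos_of_norm_lt_one hh hq h0⟩).summable.norm
    simpa [Function.Periodic.qParam_right_inv hh.ne' h0] using this

lemma HasQExp.hasFPowerSeriesOnBall {h : ℝ} (hh : 0 < h) {c : ℕ → ℂ} {F : ℍ → ℂ}
    (hF : HasQExp h c F) :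
    HasFPowerSeriesOnBall (fun q => ∑' n, c n * q ^ n) (.ofScalars ℂ c) 0 1 := by
  refine ⟨?_, one_pos, fun {y} hy => ?_⟩
  · refine le_of_forall_lt_imp_le_of_dense fun r hr => ?_
    lift r to NNReal using hr.ne_top
    apply FormalMultilinearSeries.le_radius_of_summable
    simpa using hF.summable_norm hh (q := (r : ℂ)) (by simpa using hr)
  · rw [← ENNReal.coe_one, Metric.eball_coe, NNReal.coe_one, mem_ball_zero_iff] at hy
    simpa [mul_comm] using (hF.summable_norm hh hy).of_norm.hasSum

lemma HasQExp.cuspFunction_eq {h : ℝ} (hh : 0 < h) {c : ℕ → ℂ} {F : ℍ → ℂ}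
    (hF : HasQExp h c F) : ∀ᶠ q in 𝓝 0, cuspFunction h F q = ∑' n, c n * q ^ n := by
  have h1 : ∀ q : ℂ, ‖q‖ < 1 → q ≠ 0 → cuspFunction h F q = ∑' n, c n * q ^ n := by
    intro q hq h0
    have him := Function.Periodic.im_invQParam_pos_of_norm_lt_one hh hq h0
    have h2 := (hF ⟨_, him⟩).tsum_eq
    simp only [Function.Periodic.qParam_right_inv hh.ne' h0] at h2
    rw [h2, cuspFunction, Function.Periodic.cuspFunction_eq_of_nonzero h _ h0, Function.comp,
      ofComplex_apply_of_im_pos him]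
  have hb : ∀ᶠ q : ℂ in 𝓝 0, ‖q‖ < 1 := by
    filter_upwards [Metric.ball_mem_nhds (0 : ℂ) one_pos] with q hq
    simpa using hq
  filter_upwards [hb] with q hq
  rcases eq_or_ne q 0 with rfl | h0
  -- The value of the cusp function at `0` is defined as a punctured limit; the sum of the power
  -- series is continuous there.
  · have hc := (hF.hasFPowerSeriesOnBall hh).hasFPowerSeriesAt.continuousAt.tendsto
    have hc' := hc.mono_left (nhdsWithin_le_nhds (s := {0}ᶜ))
    rw [cuspFunction, Function.Periodic.cuspFunction_zero_eq_limUnder_nhds_ne]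
    refine Tendsto.limUnder_eq (hc'.congr' ?_)
    filter_upwards [self_mem_nhdsWithin, nhdsWithin_le_nhds hb] with q h0 hq
    exact (h1 q hq h0).symm
  · exact h1 q hq h0

/-- Uniqueness of power series. No modularity enters, so this applies to eta-quotients, brackets and
twists alike. -/
lemma HasQExp.qExpansion_coeff {h : ℝ} (hh : 0 < h) {c : ℕ → ℂ} {F : ℍ → ℂ}
    (hF : HasQExp h c F) (n : ℕ) : (qExpansion h F).coeff n = c n := by
  have h1 := (hF.hasFPowerSeriesOnBall hh).hasFPowerSeriesAt.congr
    ((hF.cuspFunction_eq hh).mono fun q hq => hq.symm)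
  have h2 := congr_arg (FormalMultilinearSeries.coeff · n)
    (h1.eq_formalMultilinearSeries h1.analyticAt.hasFPowerSeriesAt)
  simp only [FormalMultilinearSeries.coeff_ofScalars] at h2
  rw [UpperHalfPlane.qExpansion_coeff, h2]
  ring

/-! ### The operators `V`, `U`, twisting and differentiation on `q`-series -/

/-- The sequence `c` placed on the multiples of `m`. -/
def spread (m : ℕ) (c : ℕ → ℂ) (n : ℕ) : ℂ := if m ∣ n then c (n / m) else 0

lemma hasSum_spread {m : ℕ} (hm : m ≠ 0) {c : ℕ → ℂ} {q s : ℂ}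
    (h : HasSum (fun n => c n * (q ^ m) ^ n) s) :
    HasSum (fun n => spread m c n * q ^ n) s := by
  have hinj : Function.Injective fun n : ℕ => m * n := fun a b hab =>
    Nat.eq_of_mul_eq_mul_left (Nat.pos_of_ne_zero hm) hab
  rw [← hinj.hasSum_iff]
  · refine h.congr_fun fun n => ?_
    simp only [Function.comp, spread]
    rw [if_pos (dvd_mul_right m n), Nat.mul_div_cancel_left n (Nat.pos_of_ne_zero hm), pow_mul]
  · intro n hn
    rw [spread, if_neg fun ⟨k, hk⟩ => hn ⟨k, hk.symm⟩, zero_mul]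

lemma im_nat_mul_pos {m : ℕ} (hm : m ≠ 0) (z : ℍ) : 0 < ((m : ℂ) * (z : ℂ)).im := by
  have := z.im_pos
  simp only [Complex.mul_im, Complex.natCast_re, Complex.natCast_im, zero_mul, add_zero]
  exact mul_pos (Nat.cast_pos.mpr (Nat.pos_of_ne_zero hm)) this

lemma HasQExp.opV {h : ℝ} {c : ℕ → ℂ} {F : ℍ → ℂ} (hF : HasQExp h c F) {m : ℕ} (hm : m ≠ 0) :
    HasQExp h (spread m c) (opV m F) := fun z => by
  have h1 := hF ⟨(m : ℂ) * z, im_nat_mul_pos hm z⟩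
  simp only [qParam_nat_mul] at h1
  rw [EtaShimura.opV, ofComplex_apply_of_im_pos (im_nat_mul_pos hm z)]
  exact hasSum_spread hm h1

lemma HasQExp.rescale {c : ℕ → ℂ} {F : ℍ → ℂ} (hF : HasQExp 1 c F) {D : ℕ} (hD : D ≠ 0) :
    HasQExp D (spread D c) F := fun z => by
  refine hasSum_spread hD ?_
  rw [← qParam_eq_pow one_ne_zero hD (mul_one _).symm]
  exact hF z

lemma im_add_div_pos {m : ℕ} (hm : m ≠ 0) (z : ℍ) (j : ℕ) :
    0 < (((z : ℂ) + (j : ℂ)) / (m : ℂ)).im := by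
  have := z.im_pos
  rw [Complex.div_natCast_im]
  simp only [Complex.add_im, Complex.natCast_im, add_zero]
  exact div_pos this (Nat.cast_pos.mpr (Nat.pos_of_ne_zero hm))

/-- Orthogonality of the `m`-th roots of unity: the translates by `j/m` multiply the `n`-th power by
`ζ^(nj)`. -/
lemma sum_qParam_add_div_pow {m : ℕ} (hm : m ≠ 0) (z : ℂ) (n : ℕ) :
    (m : ℂ)⁻¹ * ∑ j ∈ Finset.range m, Function.Periodic.qParam 1 ((z + j) / m) ^ n =
      if m ∣ n then Function.Periodic.qParam 1 z ^ (n / m) else 0 := by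
  have hm' : (m : ℂ) ≠ 0 := Nat.cast_ne_zero.mpr hm
  have hζ := Complex.isPrimitiveRoot_exp m hm
  set ζ := Complex.exp (2 * Real.pi * Complex.I / m)
  have h1 : ∀ j : ℕ, Function.Periodic.qParam 1 ((z + j) / m) ^ n =
      Function.Periodic.qParam 1 (z / m) ^ n * (ζ ^ n) ^ j := by
    intro j
    rw [← pow_mul, mul_comm n j, pow_mul, ← mul_pow]
    congr 1
    simp only [Function.Periodic.qParam, ζ, ← Complex.exp_nat_mul, ← Complex.exp_add]
    congr 1
    push_cast
    ring
  simp only [h1, ← Finset.mul_sum]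
  split_ifs with hd
  · obtain ⟨k, rfl⟩ := hd
    rw [Nat.mul_div_cancel_left k (Nat.pos_of_ne_zero hm), pow_mul ζ, hζ.pow_eq_one, one_pow]
    simp only [one_pow, Finset.sum_const, Finset.card_range, nsmul_eq_mul, mul_one]
    rw [mul_comm _ (m : ℂ), inv_mul_cancel_left₀ hm', pow_mul, ← qParam_nat_mul,
      mul_div_cancel₀ _ hm']
  · have hne : ζ ^ n ≠ 1 := fun h => hd ((hζ.pow_eq_one_iff_dvd n).mp h)
    rw [geom_sum_eq hne, ← pow_mul, mul_comm n m, pow_mul, hζ.pow_eq_one, one_pow, sub_self,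
      zero_div, mul_zero, mul_zero]

lemma HasQExp.opU {c : ℕ → ℂ} {F : ℍ → ℂ} (hF : HasQExp 1 c F) {m : ℕ} (hm : m ≠ 0) :
    HasQExp 1 (fun n => c (m * n)) (opU m F) := fun z => by
  have h1 : HasSum (fun n => (m : ℂ)⁻¹ * ∑ j ∈ Finset.range m,
      c n * Function.Periodic.qParam 1 (((z : ℂ) + j) / m) ^ n) (EtaShimura.opU m F z) := by
    refine HasSum.mul_left _ (hasSum_sum fun j _ => ?_)
    rw [ofComplex_apply_of_im_pos (im_add_div_pos hm z j)]
    exact hF ⟨_, im_add_div_pos hm z j⟩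
  have hinj : Function.Injective fun n : ℕ => m * n := fun a b hab =>
    Nat.eq_of_mul_eq_mul_left (Nat.pos_of_ne_zero hm) hab
  simp only [← Finset.mul_sum, mul_left_comm _ (c _), sum_qParam_add_div_pow hm] at h1
  rw [← hinj.hasSum_iff] at h1
  · refine h1.congr_fun fun n => ?_
    simp only [Function.comp]
    rw [if_pos (dvd_mul_right m n), Nat.mul_div_cancel_left n (Nat.pos_of_ne_zero hm)]
  · intro n hn
    rw [if_neg fun ⟨k, hk⟩ => hn ⟨k, hk.symm⟩, mul_zero]

lemma norm_kronecker_le_one (a : ℤ) (n : ℕ) : ‖(kronecker a n : ℂ)‖ ≤ 1 := by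
  have key : ∀ x : ℤ, x = 0 ∨ x = 1 ∨ x = -1 → |x| ≤ 1 := by
    rintro x (rfl | rfl | rfl) <;> simp
  have h : |kronecker a n| ≤ 1 := by
    unfold kronecker
    split_ifs
    · simp
    · simp
    · rw [abs_mul, abs_pow]
      have h8 : ∀ x : ZMod 8, |ZMod.χ₈ x| ≤ 1 := by decide
      exact mul_le_one₀ (pow_le_one₀ (abs_nonneg _) (h8 _)) (abs_nonneg _)
        (key _ (jacobiSym.trichotomy _ _))
  rw [Complex.norm_intCast]
  exact_mod_cast h

lemma HasQExp.twist {c : ℕ → ℂ} {F : ℍ → ℂ} (hF : HasQExp 1 c F) (a : ℤ) :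
    HasQExp 1 (fun n => kronecker a n * c n) (twist F a) := fun z => by
  simp only [EtaShimura.twist, hF.qExpansion_coeff one_pos]
  refine Summable.hasSum (Summable.of_norm_bounded (hF z).summable.norm fun n => ?_)
  rw [mul_assoc, norm_mul]
  exact mul_le_of_le_one_left (norm_nonneg _) (norm_kronecker_le_one a n)

lemma hasDerivAt_qParam_one (w : ℂ) : HasDerivAt (Function.Periodic.qParam 1)
    (2 * Real.pi * Complex.I * Function.Periodic.qParam 1 w) w := by
  unfold Function.Periodic.qParam
  have h : HasDerivAt (fun w : ℂ => 2 * Real.pi * Complex.I * w / (1 : ℝ))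
      (2 * Real.pi * Complex.I) w := by
    simpa using ((hasDerivAt_id w).const_mul (2 * Real.pi * Complex.I)).div_const ((1 : ℝ) : ℂ)
  simpa only [mul_comm] using h.cexp

lemma HasQExp.normalizedDeriv {c : ℕ → ℂ} {F : ℍ → ℂ} (hF : HasQExp 1 c F) :
    HasQExp 1 (fun n => (n : ℂ) * c n) (Derivative.normalizedDerivOfComplex F) := fun z => by
  have hy := z.im_pos
  -- On this half-plane every term is bounded by its absolute value at a point of height `z.im / 2`,
  -- which justifies termwise differentiation.
  let U : Set ℂ := {w | z.im / 2 < w.im}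
  have hU : IsOpen U := isOpen_lt continuous_const Complex.continuous_im
  let z₀ : ℍ := ⟨Complex.I * (z.im / 2 : ℝ), by simpa using hy⟩
  have hle : ∀ w ∈ U, ‖Function.Periodic.qParam 1 w‖ ≤ ‖Function.Periodic.qParam 1 (z₀ : ℂ)‖ := by
    intro w hw
    rw [Function.Periodic.norm_qParam, Function.Periodic.norm_qParam]
    apply Real.exp_le_exp.mpr
    have h1 : (z₀ : ℂ).im = z.im / 2 := by simp [z₀]
    rw [h1, div_one, div_one]
    have h2 : z.im / 2 < w.im := hw
    nlinarith [Real.pi_pos]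
  have hd : ∀ (n : ℕ) (w : ℂ), HasDerivAt (fun w => c n * Function.Periodic.qParam 1 w ^ n)
      (c n * (n * Function.Periodic.qParam 1 w ^ (n - 1) *
        (2 * Real.pi * Complex.I * Function.Periodic.qParam 1 w))) w :=
    fun n w => ((hasDerivAt_qParam_one w).pow n).const_mul (c n)
  have h1 := Complex.hasSum_deriv_of_summable_norm (U := U)
    (F := fun n w => c n * Function.Periodic.qParam 1 w ^ n) (hF z₀).summable.norm
    (fun n w _ => (hd n w).differentiableAt.differentiableWithinAt) hU
    (fun n w hw => by
      rw [norm_mul, norm_mul, norm_pow, norm_pow]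
      gcongr
      exact hle w hw)
    (z := (z : ℂ)) (by change z.im / 2 < (z : ℂ).im; rw [coe_im]; linarith)
  have h2 : deriv (fun w => ∑' n, c n * Function.Periodic.qParam 1 w ^ n) (z : ℂ) =
      deriv (F ∘ ofComplex) (z : ℂ) := by
    apply EventuallyEq.deriv_eq
    filter_upwards [isOpen_upperHalfPlaneSet.mem_nhds (show (z : ℂ) ∈ _ from z.im_pos)] with w hw
    rw [Function.comp, ofComplex_apply_of_im_pos hw]
    exact (hF ⟨w, hw⟩).tsum_eq
  rw [h2] at h1
  refine (h1.mul_left (2 * Real.pi * Complex.I)⁻¹).congr_fun fun n => ?_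
  rw [(hd n z).deriv]
  have hpi := Complex.two_pi_I_ne_zero
  rcases n with _ | n
  · simp
  · rw [Nat.add_sub_cancel, pow_succ]
    field_simp

end EtaShimura

namespace EtaShimura

/-! ### Representations of an integer by linear forms -/

/-- The pairs `(x, y)` of natural numbers with `α x + β y = n`. -/
def linearReps (α β n : ℕ) : Finset (ℕ × ℕ) :=
  (Finset.range (n + 1) ×ˢ Finset.range (n + 1)).filter fun p => α * p.1 + β * p.2 = n

lemma mem_linearReps {α β : ℕ} (hα : α ≠ 0) (hβ : β ≠ 0) {n : ℕ} {p : ℕ × ℕ} :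
    p ∈ linearReps α β n ↔ α * p.1 + β * p.2 = n := by
  unfold linearReps
  rw [Finset.mem_filter, Finset.mem_product, Finset.mem_range, Finset.mem_range]
  refine ⟨fun h => h.2, fun h => ⟨⟨?_, ?_⟩, h⟩⟩
  · have := Nat.le_mul_of_pos_left p.1 (Nat.pos_of_ne_zero hα)
    omega
  · have := Nat.le_mul_of_pos_left p.2 (Nat.pos_of_ne_zero hβ)
    omega

/-- The coefficient of `q^(n² / D)` in the product of `∑ e(m) q^(m² / D)` and `∑ a(j) q^j`. -/
noncomputable def thetaCoeff (D : ℕ) (e : ℤ → ℤ) (a : ℕ → ℂ) (n : ℕ) : ℂ :=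
  ∑ m ∈ (Finset.range (n + 1)).filter (fun m => D ∣ n ^ 2 - m ^ 2),
    (e m : ℂ) * a ((n ^ 2 - m ^ 2) / D)

lemma sq_sub_natAbs_sq (u v : ℕ) :
    (u + v) ^ 2 - ((u : ℤ) - v).natAbs ^ 2 = 4 * (u * v) := by
  apply Nat.sub_eq_of_eq_add
  zify
  rw [sq_abs]
  ring

lemma even_natAbs {e : ℤ → ℤ} (he : ∀ m, e (-m) = e m) (m : ℤ) : e (m.natAbs : ℤ) = e m := by
  rcases Int.natAbs_eq m with h | h
  · rw [← h]
  · rw [← he, ← h]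

lemma sq_mod_eq_of_dvd_sub {D n m : ℕ} (k : ℕ) (hk : k ∣ D) (hm : m ≤ n) (h : D ∣ n ^ 2 - m ^ 2) :
    (n % k) ^ 2 % k = (m % k) ^ 2 % k := by
  rw [← Nat.pow_mod, ← Nat.pow_mod]
  exact ((Nat.modEq_iff_dvd' (Nat.pow_le_pow_left hm 2)).mpr (hk.trans h)).symm

/-- For `n` and `m` odd exactly one of `n - m`, `n + m` is divisible by 4. That one is `4y` and the
other is `2x`, so `n = x + 2y`, `m = ±(x - 2y)` and `n² - m² = 8xy`. -/
lemma thetaCoeff_eight {e : ℤ → ℤ} (he : ∀ m, e (-m) = e m) (a : ℕ → ℂ) {n : ℕ}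
    (hn : n % 2 = 1) :
    thetaCoeff 8 e a n =
      ∑ p ∈ linearReps 1 2 n, (e ((p.1 : ℤ) - 2 * p.2) : ℂ) * a (p.1 * p.2) := by
  symm
  refine Finset.sum_bij' (fun p _ => ((p.1 : ℤ) - 2 * p.2).natAbs)
    (fun m _ => if 4 ∣ n - m then ((n + m) / 2, (n - m) / 4) else ((n - m) / 2, (n + m) / 4))
    ?_ ?_ ?_ ?_ ?_
  · intro p hp
    rw [mem_linearReps one_ne_zero two_ne_zero] at hp
    rw [Finset.mem_filter, Finset.mem_range]
    have h := sq_sub_natAbs_sq p.1 (2 * p.2)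
    push_cast at h
    refine ⟨by omega, p.1 * p.2, ?_⟩
    rw [← hp, one_mul, h]
    ring
  · intro m hm
    rw [Finset.mem_filter, Finset.mem_range] at hm
    have h1 := sq_mod_eq_of_dvd_sub 2 (by norm_num) (by omega) hm.2
    have h2 : m % 2 = 1 := by
      rw [hn] at h1
      rcases Nat.mod_two_eq_zero_or_one m with h | h
      · rw [h] at h1; norm_num at h1
      · exact h
    rw [mem_linearReps one_ne_zero two_ne_zero]
    split_ifs <;> dsimp only <;> omega
  · rintro ⟨x, y⟩ hp
    rw [mem_linearReps one_ne_zero two_ne_zero] at hp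
    dsimp only at hp ⊢
    split_ifs <;> rw [Prod.mk.injEq] <;> omega
  · intro m hm
    rw [Finset.mem_filter, Finset.mem_range] at hm
    have h1 := sq_mod_eq_of_dvd_sub 2 (by norm_num) (by omega) hm.2
    have h2 : m % 2 = 1 := by
      rw [hn] at h1
      rcases Nat.mod_two_eq_zero_or_one m with h | h
      · rw [h] at h1; norm_num at h1
      · exact h
    split_ifs <;> dsimp only <;> omega
  · intro p hp
    rw [mem_linearReps one_ne_zero two_ne_zero] at hp
    have h := sq_sub_natAbs_sq p.1 (2 * p.2)
    push_cast at h
    rw [even_natAbs he, ← hp, one_mul, h, show 4 * (p.1 * (2 * p.2)) = 8 * (p.1 * p.2) by ring,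
      Nat.mul_div_cancel_left _ (by norm_num)]

lemma mod_six_of_dvd {n m : ℕ} (hn : n % 6 = 1 ∨ n % 6 = 5) (hm : m ≤ n)
    (h : 24 ∣ n ^ 2 - m ^ 2) : m % 6 = 1 ∨ m % 6 = 5 := by
  have h1 := sq_mod_eq_of_dvd_sub 6 (by norm_num) hm h
  have h2 : m % 6 < 6 := Nat.mod_lt _ (by norm_num)
  have h3 : (n % 6) ^ 2 % 6 = 1 := by rcases hn with h | h <;> norm_num [h]
  rw [h3] at h1
  clear h h3 hm hn
  generalize m % 6 = r at h1 h2 ⊢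
  interval_cases r <;> revert h1 <;> decide

lemma thetaCoeff_twentyFour {e : ℤ → ℤ} (he : ∀ m, e (-m) = e m) (a : ℕ → ℂ) {n : ℕ}
    (hn : n % 6 = 1 ∨ n % 6 = 5) :
    thetaCoeff 24 e a n =
      ∑ p ∈ linearReps 1 6 n, (e ((p.1 : ℤ) - 6 * p.2) : ℂ) * a (p.1 * p.2) +
      ∑ p ∈ linearReps 2 3 n, (e (2 * (p.1 : ℤ) - 3 * p.2) : ℂ) * a (p.1 * p.2) := by
  unfold thetaCoeff
  -- Both `n` and `m` are prime to 6, so 4 divides exactly one of `n ± m` and so does 3. If it is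
  -- the same one, it is `12y` and the other `2x`; otherwise they are `4x` and `6y`. These cases
  -- give the forms `x + 6y` and `2x + 3y`.
  rw [← Finset.sum_filter_add_sum_filter_not _ (fun m => 12 ∣ n - m ∨ 12 ∣ n + m)]
  symm
  congr 1
  · refine Finset.sum_bij' (fun p _ => ((p.1 : ℤ) - 6 * p.2).natAbs)
      (fun m _ => if 12 ∣ n - m then ((n + m) / 2, (n - m) / 12) else ((n - m) / 2, (n + m) / 12))
      ?_ ?_ ?_ ?_ ?_
    · intro p hp
      rw [mem_linearReps one_ne_zero (by norm_num)] at hp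
      rw [Finset.mem_filter, Finset.mem_filter, Finset.mem_range]
      have h := sq_sub_natAbs_sq p.1 (6 * p.2)
      push_cast at h
      refine ⟨⟨by omega, p.1 * p.2, ?_⟩, by omega⟩
      rw [← hp, one_mul, h]
      ring
    · intro m hm
      rw [Finset.mem_filter, Finset.mem_filter, Finset.mem_range] at hm
      have h1 := mod_six_of_dvd hn (by omega) hm.1.2
      have h2 := hm.2
      have h3 := hm.1.1
      rw [mem_linearReps one_ne_zero (by norm_num)]
      clear hm
      split_ifs <;> dsimp only <;> omega
    · rintro ⟨x, y⟩ hp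
      rw [mem_linearReps one_ne_zero (by norm_num)] at hp
      dsimp only at hp ⊢
      split_ifs <;> rw [Prod.mk.injEq] <;> omega
    · intro m hm
      rw [Finset.mem_filter, Finset.mem_filter, Finset.mem_range] at hm
      have h1 := mod_six_of_dvd hn (by omega) hm.1.2
      have h2 := hm.2
      have h3 := hm.1.1
      clear hm
      split_ifs <;> dsimp only <;> omega
    · intro p hp
      rw [mem_linearReps one_ne_zero (by norm_num)] at hp
      have h := sq_sub_natAbs_sq p.1 (6 * p.2)
      push_cast at h
      rw [even_natAbs he, ← hp, one_mul, h, show 4 * (p.1 * (6 * p.2)) = 24 * (p.1 * p.2) by ring,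
        Nat.mul_div_cancel_left _ (by norm_num)]
  · refine Finset.sum_bij' (fun p _ => (2 * (p.1 : ℤ) - 3 * p.2).natAbs)
      (fun m _ => if 4 ∣ n + m then ((n + m) / 4, (n - m) / 6) else ((n - m) / 4, (n + m) / 6))
      ?_ ?_ ?_ ?_ ?_
    · intro p hp
      rw [mem_linearReps two_ne_zero (by norm_num)] at hp
      rw [Finset.mem_filter, Finset.mem_filter, Finset.mem_range]
      have h := sq_sub_natAbs_sq (2 * p.1) (3 * p.2)
      push_cast at h
      refine ⟨⟨by omega, p.1 * p.2, ?_⟩, by omega⟩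
      rw [← hp, h]
      ring
    · intro m hm
      rw [Finset.mem_filter, Finset.mem_filter, Finset.mem_range] at hm
      have h1 := mod_six_of_dvd hn (by omega) hm.1.2
      have h2 := hm.2
      have h3 := hm.1.1
      rw [mem_linearReps two_ne_zero (by norm_num)]
      clear hm
      split_ifs <;> dsimp only <;> omega
    · rintro ⟨x, y⟩ hp
      rw [mem_linearReps two_ne_zero (by norm_num)] at hp
      dsimp only at hp ⊢
      split_ifs <;> rw [Prod.mk.injEq] <;> omega
    · intro m hm
      rw [Finset.mem_filter, Finset.mem_filter, Finset.mem_range] at hm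
      have h1 := mod_six_of_dvd hn (by omega) hm.1.2
      have h2 := hm.2
      have h3 := hm.1.1
      clear hm
      split_ifs <;> dsimp only <;> omega
    · intro p hp
      rw [mem_linearReps two_ne_zero (by norm_num)] at hp
      have h := sq_sub_natAbs_sq (2 * p.1) (3 * p.2)
      push_cast at h
      rw [even_natAbs he, ← hp, h, show 4 * (2 * p.1 * (3 * p.2)) = 24 * (p.1 * p.2) by ring,
        Nat.mul_div_cancel_left _ (by norm_num)]

/-- For even `n` the involution `(x, y) ↦ (2y, x/2)` preserves both `x + 2y` and `xy`. -/
lemma sum_linearReps_one_two_of_even {n : ℕ} (hn : n % 2 = 0) (f : ℕ → ℕ → ℂ) :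
    ∑ p ∈ linearReps 1 2 n, f p.1 p.2 = ∑ p ∈ linearReps 1 2 n, f (2 * p.2) (p.1 / 2) := by
  refine Finset.sum_bij' (fun p _ => (2 * p.2, p.1 / 2)) (fun p _ => (2 * p.2, p.1 / 2))
    ?_ ?_ ?_ ?_ ?_
  · rintro ⟨x, y⟩ hp
    rw [mem_linearReps one_ne_zero two_ne_zero] at hp ⊢
    dsimp only at hp ⊢
    omega
  · rintro ⟨x, y⟩ hp
    rw [mem_linearReps one_ne_zero two_ne_zero] at hp ⊢
    dsimp only at hp ⊢
    omega
  · rintro ⟨x, y⟩ hp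
    rw [mem_linearReps one_ne_zero two_ne_zero] at hp
    dsimp only at hp ⊢
    rw [Prod.mk.injEq]
    omega
  · rintro ⟨x, y⟩ hp
    rw [mem_linearReps one_ne_zero two_ne_zero] at hp
    dsimp only at hp ⊢
    rw [Prod.mk.injEq]
    omega
  · rintro ⟨x, y⟩ hp
    rw [mem_linearReps one_ne_zero two_ne_zero] at hp
    dsimp only at hp ⊢
    congr 1 <;> omega

lemma sum_linearReps_of_even {n : ℕ} (hn : n % 2 = 0) (f : ℕ → ℕ → ℂ) :
    ∑ p ∈ linearReps 1 6 n, f p.1 p.2 = ∑ p ∈ linearReps 2 3 n, f (2 * p.1) (p.2 / 2) := by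
  refine Finset.sum_bij' (fun p _ => (p.1 / 2, 2 * p.2)) (fun p _ => (2 * p.1, p.2 / 2))
    ?_ ?_ ?_ ?_ ?_ <;> rintro ⟨x, y⟩ hp <;>
    simp only [mem_linearReps one_ne_zero (show 6 ≠ 0 by norm_num),
      mem_linearReps two_ne_zero three_ne_zero, Prod.mk.injEq] at hp ⊢
  · omega
  · omega
  · omega
  · omega
  · congr 1 <;> omega

lemma sum_linearReps_of_three_dvd {n : ℕ} (hn : n % 3 = 0) (f : ℕ → ℕ → ℂ) :
    ∑ p ∈ linearReps 1 6 n, f p.1 p.2 = ∑ p ∈ linearReps 2 3 n, f (3 * p.2) (p.1 / 3) := by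
  refine Finset.sum_bij' (fun p _ => (3 * p.2, p.1 / 3)) (fun p _ => (3 * p.2, p.1 / 3))
    ?_ ?_ ?_ ?_ ?_ <;> rintro ⟨x, y⟩ hp <;>
    simp only [mem_linearReps one_ne_zero (show 6 ≠ 0 by norm_num),
      mem_linearReps two_ne_zero three_ne_zero, Prod.mk.injEq] at hp ⊢
  · omega
  · omega
  · omega
  · omega
  · congr 1 <;> omega

end EtaShimura

namespace EtaShimura

/-! ### Hecke relations and the lift -/

lemma sum_spread_mul_spread {α β : ℕ} (hα : α ≠ 0) (hβ : β ≠ 0) (c d : ℕ → ℂ) (n : ℕ) :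
    ∑ p ∈ Finset.HasAntidiagonal.antidiagonal n, spread α c p.1 * spread β d p.2 =
      ∑ p ∈ linearReps α β n, c p.1 * d p.2 := by
  symm
  have hα' := Nat.pos_of_ne_zero hα
  have hβ' := Nat.pos_of_ne_zero hβ
  refine Finset.sum_of_injOn (fun p => (α * p.1, β * p.2)) ?_ ?_ ?_ ?_
  · intro p _ p' _ h
    rw [Prod.mk.injEq] at h
    exact Prod.ext (Nat.eq_of_mul_eq_mul_left hα' h.1) (Nat.eq_of_mul_eq_mul_left hβ' h.2)
  · intro p hp
    exact Finset.HasAntidiagonal.mem_antidiagonal.mpr ((mem_linearReps hα hβ).mp hp)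
  · rintro ⟨i, j⟩ hp hne
    rw [Finset.HasAntidiagonal.mem_antidiagonal] at hp
    unfold spread
    split_ifs with h1 h2
    · obtain ⟨x, rfl⟩ := h1
      obtain ⟨y, rfl⟩ := h2
      exact absurd ⟨(x, y), (mem_linearReps hα hβ).mpr hp, rfl⟩ hne
    all_goals simp
  · intro p _
    simp [spread, hα', hβ']

/-- The sequence `e` placed on the squares. -/
def squareSpread (e : ℤ → ℤ) (j : ℕ) : ℂ := if j.sqrt ^ 2 = j then (e j.sqrt : ℂ) else 0

lemma sqrt_sq (m : ℕ) : (m ^ 2).sqrt = m := by rw [pow_two, Nat.sqrt_eq]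

lemma IsThetaSeries.hasQExp {D : ℕ} {e : ℤ → ℤ} {F : ℍ → ℂ} (h : IsThetaSeries D e F) :
    HasQExp D (squareSpread e) F := fun z => by
  have hinj : Function.Injective fun m : ℕ => m ^ 2 := Nat.pow_left_injective two_ne_zero
  rw [← hinj.hasSum_iff]
  · refine (h z).congr_fun fun m => ?_
    simp only [Function.comp, squareSpread, sqrt_sq, if_true]
  · intro j hj
    rw [squareSpread, if_neg fun h => hj ⟨_, h⟩, zero_mul]

lemma sum_squareSpread_mul_spread (D : ℕ) (e : ℤ → ℤ) (a : ℕ → ℂ) (n : ℕ) :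
    ∑ p ∈ Finset.HasAntidiagonal.antidiagonal (n ^ 2), squareSpread e p.1 * spread D a p.2 =
      thetaCoeff D e a n := by
  symm
  refine Finset.sum_of_injOn (fun m => (m ^ 2, n ^ 2 - m ^ 2)) ?_ ?_ ?_ ?_
  · intro m _ m' _ h
    rw [Prod.mk.injEq] at h
    exact Nat.pow_left_injective two_ne_zero h.1
  · intro m hm
    rw [Finset.mem_coe, Finset.mem_filter, Finset.mem_range] at hm
    have := Nat.pow_le_pow_left (Nat.lt_succ_iff.mp hm.1) 2
    exact Finset.HasAntidiagonal.mem_antidiagonal.mpr (by dsimp only; omega)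
  · rintro ⟨i, j⟩ hp hne
    rw [Finset.HasAntidiagonal.mem_antidiagonal] at hp
    unfold squareSpread spread
    split_ifs with h1 h2
    · refine absurd ⟨i.sqrt, ?_, ?_⟩ hne
      · dsimp only at h1 h2 hp
        rw [Finset.mem_coe, Finset.mem_filter, Finset.mem_range, h1, ← hp, Nat.add_sub_cancel_left]
        exact ⟨Nat.lt_succ_of_le ((Nat.pow_le_pow_iff_left two_ne_zero).mp (by omega)), h2⟩
      · dsimp only at h1 h2 hp ⊢
        rw [h1, ← hp, Nat.add_sub_cancel_left]
    all_goals simp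
  · intro m hm
    rw [Finset.mem_filter] at hm
    simp only [squareSpread, sqrt_sq, if_true, spread, hm.2]

lemma coeff_theta_mul {D : ℕ} (hD : D ≠ 0) {e : ℤ → ℤ} {a : ℕ → ℂ} {F g : ℍ → ℂ}
    (hF : IsThetaSeries D e F) (hg : HasQExp 1 a g) (n : ℕ) :
    (qExpansion D (F * g)).coeff (n ^ 2) = thetaCoeff D e a n := by
  rw [(hF.hasQExp.mul (hg.rescale hD)).qExpansion_coeff
    (Nat.cast_pos.mpr (Nat.pos_of_ne_zero hD)), sum_squareSpread_mul_spread]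

/-- The Hecke relations `a(x) a(y) = ∑ h(d) a(xy / d²)`, over the common divisors `d`. -/
def HeckeRelation (h a : ℕ → ℂ) : Prop :=
  ∀ x y : ℕ, Nat.gcd x y ≠ 0 →
    a x * a y = ∑ d ∈ (Nat.gcd x y).divisors, h d * a (x * y / d ^ 2)

/-- Both sides of the Hecke relation, as functions of `x`, obey the recursion given by
multiplication by `a(p)`; this is the recursion for the divisor sum. -/
lemma sum_divisors_mul_prime {p x y : ℕ} (hp : p.Prime) (hx : x ≠ 0) {h a : ℕ → ℂ}
    (hmul : ∀ m n, h (m * n) = h m * h n)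
    (hprime : ∀ n, a p * a n = a (p * n) + if p ∣ n then h p * a (n / p) else 0) :
    a p * ∑ d ∈ (Nat.gcd x y).divisors, h d * a (x * y / d ^ 2) =
      ∑ d ∈ (Nat.gcd (p * x) y).divisors, h d * a (p * x * y / d ^ 2) +
      if p ∣ x then h p * ∑ d ∈ (Nat.gcd (x / p) y).divisors, h d * a (x / p * y / d ^ 2) else 0 := by
  have hp0 := hp.pos
  have hg : ∀ z, z ≠ 0 → Nat.gcd z y ≠ 0 := fun z hz => Nat.gcd_ne_zero_left hz
  have hmem : ∀ z, z ≠ 0 → ∀ d, d ∈ (Nat.gcd z y).divisors ↔ d ∣ z ∧ d ∣ y := by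
    intro z hz d
    rw [Nat.mem_divisors, Nat.dvd_gcd_iff]
    exact ⟨fun h => h.1, fun h => ⟨h, hg z hz⟩⟩
  have hpx : p * x ≠ 0 := mul_ne_zero hp.ne_zero hx
  -- expand the product with `a p`
  have e1 : a p * ∑ d ∈ (Nat.gcd x y).divisors, h d * a (x * y / d ^ 2) =
      ∑ d ∈ (Nat.gcd x y).divisors, h d * a (p * x * y / d ^ 2) +
      ∑ d ∈ (Nat.gcd x y).divisors,
        if p ∣ x * y / d ^ 2 then h (p * d) * a (x * y / d ^ 2 / p) else 0 := by
    rw [Finset.mul_sum, ← Finset.sum_add_distrib]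
    refine Finset.sum_congr rfl fun d hd => ?_
    obtain ⟨⟨u, rfl⟩, ⟨v, rfl⟩⟩ := (hmem x hx d).mp hd
    have hd0 : 0 < d ^ 2 := pow_pos (Nat.pos_of_ne_zero (left_ne_zero_of_mul hx)) 2
    rw [mul_left_comm, hprime, show p * (d * u) * (d * v) = d ^ 2 * (p * (u * v)) by ring,
      show d * u * (d * v) = d ^ 2 * (u * v) by ring, Nat.mul_div_cancel_left _ hd0,
      Nat.mul_div_cancel_left _ hd0, mul_add]
    split_ifs
    · rw [hmul]; ring
    · ring
  -- the divisors of `p * x` that do not divide `x`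
  have e2 : ∑ d ∈ (Nat.gcd (p * x) y).divisors, h d * a (p * x * y / d ^ 2) =
      ∑ d ∈ (Nat.gcd x y).divisors, h d * a (p * x * y / d ^ 2) +
      ∑ d ∈ (Nat.gcd (p * x) y).divisors.filter (fun d => ¬ d ∣ x),
        h d * a (p * x * y / d ^ 2) := by
    rw [← Finset.sum_filter_add_sum_filter_not _ (fun d => d ∣ x)]
    congr 1
    refine Finset.sum_congr ?_ fun _ _ => rfl
    ext d
    rw [Finset.mem_filter, hmem _ hpx, hmem _ hx]
    exact ⟨fun h => ⟨h.2, h.1.2⟩, fun h => ⟨⟨h.1.mul_left p, h.2⟩, h.1⟩⟩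
  -- Matched by `d ↦ pd`. If `pd ∤ x` and `p ∣ xy/d²`, then `p` divides `y/d`; conversely a divisor
  -- of `px` not dividing `x` is a multiple of `p`.
  have e3 : ∑ d ∈ (Nat.gcd x y).divisors.filter (fun d => ¬ p * d ∣ x),
        (if p ∣ x * y / d ^ 2 then h (p * d) * a (x * y / d ^ 2 / p) else 0) =
      ∑ d ∈ (Nat.gcd (p * x) y).divisors.filter (fun d => ¬ d ∣ x),
        h d * a (p * x * y / d ^ 2) := by
    rw [← Finset.sum_filter]
    refine Finset.sum_bij' (fun d _ => p * d) (fun d _ => d / p) ?_ ?_ ?_ ?_ ?_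
    · intro d hd
      rw [Finset.mem_filter, Finset.mem_filter, hmem _ hx] at hd
      obtain ⟨⟨⟨⟨u, rfl⟩, ⟨v, rfl⟩⟩, hd2⟩, hd3⟩ := hd
      have hd0 : 0 < d ^ 2 := pow_pos (Nat.pos_of_ne_zero (left_ne_zero_of_mul hx)) 2
      rw [show d * u * (d * v) = d ^ 2 * (u * v) by ring, Nat.mul_div_cancel_left _ hd0] at hd3
      rw [Finset.mem_filter, hmem _ hpx]
      refine ⟨⟨mul_dvd_mul_left p (dvd_mul_right d u), ?_⟩, hd2⟩
      rcases hp.dvd_mul.mp hd3 with h | h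
      · exact absurd (by rw [mul_comm p d]; exact mul_dvd_mul_left d h) hd2
      · rw [mul_comm p d]; exact mul_dvd_mul_left d h
    · intro d hd
      rw [Finset.mem_filter, hmem _ hpx] at hd
      have hpd : p ∣ d := by
        by_contra hc
        exact hd.2 (((hp.coprime_iff_not_dvd.mpr hc).symm).dvd_of_dvd_mul_left hd.1.1)
      obtain ⟨c, rfl⟩ := hpd
      have hc : c ∣ x := Nat.dvd_of_mul_dvd_mul_left hp0 hd.1.1
      rw [Finset.mem_filter, Finset.mem_filter, hmem _ hx, Nat.mul_div_cancel_left _ hp0]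
      refine ⟨⟨⟨hc, (dvd_mul_left c p).trans hd.1.2⟩, hd.2⟩, ?_⟩
      obtain ⟨u, rfl⟩ := hc
      obtain ⟨v, rfl⟩ := hd.1.2
      have hc0 : 0 < c ^ 2 := pow_pos (Nat.pos_of_ne_zero (left_ne_zero_of_mul hx)) 2
      rw [show c * u * (p * c * v) = c ^ 2 * (p * (u * v)) by ring, Nat.mul_div_cancel_left _ hc0]
      exact dvd_mul_right _ _
    · intro d _
      exact Nat.mul_div_cancel_left _ hp0
    · intro d hd
      rw [Finset.mem_filter, hmem _ hpx] at hd
      refine Nat.mul_div_cancel' ?_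
      by_contra hc
      exact hd.2 (((hp.coprime_iff_not_dvd.mpr hc).symm).dvd_of_dvd_mul_left hd.1.1)
    · intro d hd
      rw [Finset.mem_filter, Finset.mem_filter, hmem _ hx] at hd
      obtain ⟨⟨⟨⟨u, rfl⟩, ⟨v, rfl⟩⟩, hd2⟩, hd3⟩ := hd
      have hd0 : 0 < d ^ 2 := pow_pos (Nat.pos_of_ne_zero (left_ne_zero_of_mul hx)) 2
      rw [show d * u * (d * v) = d ^ 2 * (u * v) by ring, Nat.mul_div_cancel_left _ hd0,
        show p * (d * u) * (d * v) = p * (d ^ 2 * (u * v)) by ring,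
        show (p * d) ^ 2 = p * (d ^ 2 * p) by ring, Nat.mul_div_mul_left _ _ hp0,
        Nat.mul_div_mul_left _ _ hd0]
  -- The remaining `d`, those with `pd ∣ x`, are the common divisors of `x/p` and `y`.
  have e4 : ∑ d ∈ (Nat.gcd x y).divisors.filter (fun d => p * d ∣ x),
        (if p ∣ x * y / d ^ 2 then h (p * d) * a (x * y / d ^ 2 / p) else 0) =
      if p ∣ x then h p * ∑ d ∈ (Nat.gcd (x / p) y).divisors, h d * a (x / p * y / d ^ 2) else 0 := by
    split_ifs with hpx'
    · obtain ⟨w, rfl⟩ := hpx'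
      have hw : w ≠ 0 := right_ne_zero_of_mul hx
      rw [Nat.mul_div_cancel_left _ hp0, Finset.mul_sum]
      refine Finset.sum_congr ?_ fun d hd => ?_
      · ext d
        rw [Finset.mem_filter, hmem _ hx, hmem _ hw, Nat.mul_dvd_mul_iff_left hp0]
        exact ⟨fun h => ⟨h.2, h.1.2⟩, fun h => ⟨⟨h.1.mul_left p, h.2⟩, h.1⟩⟩
      · obtain ⟨⟨u, rfl⟩, ⟨v, rfl⟩⟩ := (hmem w hw d).mp hd
        have hd0 : 0 < d ^ 2 := pow_pos (Nat.pos_of_ne_zero (left_ne_zero_of_mul hw)) 2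
        rw [show p * (d * u) * (d * v) = d ^ 2 * (p * (u * v)) by ring,
          show d * u * (d * v) = d ^ 2 * (u * v) by ring, Nat.mul_div_cancel_left _ hd0,
          Nat.mul_div_cancel_left _ hd0, if_pos (dvd_mul_right _ _), Nat.mul_div_cancel_left _ hp0,
          hmul, mul_assoc]
    · refine Finset.sum_eq_zero fun d hd => ?_
      rw [Finset.mem_filter] at hd
      exact absurd ((dvd_mul_right p d).trans hd.2) hpx'
  rw [e1, e2, ← e3, ← e4, ← Finset.sum_filter_add_sum_filter_not (Nat.gcd x y).divisors
    (fun d => p * d ∣ x) (fun d => if p ∣ x * y / d ^ 2 then h (p * d) * a (x * y / d ^ 2 / p)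
      else 0)]
  ring

/-- Strong induction on `x = pw`, using `a(pw) = a(p) a(w) - h(p) a(w/p)`, the last term present
only if `p ∣ w`. -/
lemma heckeRelation_of_prime {h a : ℕ → ℂ} (h1 : h 1 = 1) (hmul : ∀ m n, h (m * n) = h m * h n)
    (a1 : a 1 = 1) (hprime : ∀ p : ℕ, p.Prime → ∀ n,
      a p * a n = a (p * n) + if p ∣ n then h p * a (n / p) else 0) : HeckeRelation h a := by
  have key : ∀ x : ℕ, x ≠ 0 → ∀ y,
      a x * a y = ∑ d ∈ (Nat.gcd x y).divisors, h d * a (x * y / d ^ 2) := by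
    intro x
    induction x using Nat.strong_induction_on with
    | _ x ih =>
      intro hx y
      rcases eq_or_ne x 1 with rfl | hx1
      · simp [a1, h1]
      obtain ⟨p, hp, w, rfl⟩ := Nat.exists_prime_and_dvd hx1
      have hw : w ≠ 0 := right_ne_zero_of_mul hx
      have hlt : w < p * w := (Nat.lt_mul_iff_one_lt_left (Nat.pos_of_ne_zero hw)).mpr hp.one_lt
      have e := sum_divisors_mul_prime (y := y) hp hw hmul (hprime p hp)
      rw [← ih w hlt hw y] at e
      have e2 := hprime p hp w
      split_ifs at e e2 with hd
      · obtain ⟨v, rfl⟩ := hd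
        have hv : v ≠ 0 := right_ne_zero_of_mul hw
        rw [Nat.mul_div_cancel_left _ hp.pos] at e e2
        have hlt2 : v < p * v := (Nat.lt_mul_iff_one_lt_left (Nat.pos_of_ne_zero hv)).mpr hp.one_lt
        rw [← ih v (hlt2.trans hlt) hv y] at e
        linear_combination e - a y * e2
      · linear_combination e - a y * e2
  intro x y hxy
  -- Constant terms are covered as well: `x = 0` with `y ≠ 0` follows by symmetry, and only `x = y =
  -- 0` is excluded.
  rcases eq_or_ne x 0 with rfl | hx
  · rcases eq_or_ne y 0 with rfl | hy
    · simp at hxy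
    · rw [mul_comm (a 0), key y hy 0, Nat.gcd_comm, mul_comm y 0]
  · exact key x hx y

/-- Expand `a(x) a(y)` and exchange sums: a representation of `n` with a common divisor `d` is the
same as `d ∣ n` with a representation of `n/d`, and homogeneity extracts `φ(d)`. -/
lemma sum_linearReps_hecke {h a : ℕ → ℂ} (H : HeckeRelation h a) {α β : ℕ} (hα : α ≠ 0)
    (hβ : β ≠ 0) {W : ℕ → ℕ → ℤ} {φ : ℕ → ℤ}
    (hW : ∀ d x y, d ≠ 0 → W (d * x) (d * y) = φ d * W x y) {n : ℕ} (hn : n ≠ 0) :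
    ∑ p ∈ linearReps α β n, (W p.1 p.2 : ℂ) * (a p.1 * a p.2) =
      ∑ d ∈ n.divisors, h d * φ d *
        ∑ p ∈ linearReps α β (n / d), (W p.1 p.2 : ℂ) * a (p.1 * p.2) := by
  have hgcd : ∀ p ∈ linearReps α β n, Nat.gcd p.1 p.2 ≠ 0 := by
    intro p hp h0
    rw [mem_linearReps hα hβ] at hp
    rw [Nat.gcd_eq_zero_iff] at h0
    rw [h0.1, h0.2] at hp
    exact hn (by simpa using hp.symm)
  have e1 : ∑ p ∈ linearReps α β n, (W p.1 p.2 : ℂ) * (a p.1 * a p.2) =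
      ∑ p ∈ linearReps α β n, ∑ d ∈ (Nat.gcd p.1 p.2).divisors,
        (W p.1 p.2 : ℂ) * (h d * a (p.1 * p.2 / d ^ 2)) := by
    refine Finset.sum_congr rfl fun p hp => ?_
    rw [H p.1 p.2 (hgcd p hp), Finset.mul_sum]
  simp only [e1, Finset.mul_sum]
  rw [Finset.sum_sigma', Finset.sum_sigma']
  refine Finset.sum_bij' (fun s _ => ⟨s.2, (s.1.1 / s.2, s.1.2 / s.2)⟩)
    (fun s _ => ⟨(s.1 * s.2.1, s.1 * s.2.2), s.1⟩) ?_ ?_ ?_ ?_ ?_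
  · rintro ⟨⟨x, y⟩, d⟩ hs
    rw [Finset.mem_sigma] at hs
    obtain ⟨hp, hd⟩ := hs
    have hd0 := Nat.pos_of_mem_divisors hd
    have hd' := Nat.dvd_of_mem_divisors hd
    dsimp only at hp hd hd' ⊢
    rw [Nat.dvd_gcd_iff] at hd'
    obtain ⟨⟨u, rfl⟩, ⟨v, rfl⟩⟩ := hd'
    rw [mem_linearReps hα hβ] at hp
    have hn' : n = d * (α * u + β * v) := by rw [← hp]; ring
    rw [Finset.mem_sigma, Nat.mem_divisors, mem_linearReps hα hβ]
    dsimp only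
    rw [Nat.mul_div_cancel_left _ hd0, Nat.mul_div_cancel_left _ hd0]
    refine ⟨⟨⟨_, hn'⟩, hn⟩, ?_⟩
    rw [hn', Nat.mul_div_cancel_left _ hd0]
  · rintro ⟨d, ⟨u, v⟩⟩ hs
    rw [Finset.mem_sigma] at hs
    obtain ⟨hd, hp⟩ := hs
    dsimp only at hp hd ⊢
    rw [mem_linearReps hα hβ] at hp
    have hd0 := Nat.pos_of_mem_divisors hd
    have hmem : (d * u, d * v) ∈ linearReps α β n := by
      rw [mem_linearReps hα hβ]
      dsimp only at hp ⊢
      rw [← Nat.mul_div_cancel' (Nat.dvd_of_mem_divisors hd), ← hp]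
      ring
    rw [Finset.mem_sigma, Nat.mem_divisors]
    exact ⟨hmem, Nat.dvd_gcd (dvd_mul_right _ _) (dvd_mul_right _ _), hgcd _ hmem⟩
  · rintro ⟨⟨x, y⟩, d⟩ hs
    rw [Finset.mem_sigma] at hs
    have hd' := Nat.dvd_of_mem_divisors hs.2
    rw [Nat.dvd_gcd_iff] at hd'
    dsimp only at hd' ⊢
    rw [Nat.mul_div_cancel' hd'.1, Nat.mul_div_cancel' hd'.2]
  · rintro ⟨d, ⟨u, v⟩⟩ hs
    rw [Finset.mem_sigma] at hs
    have hd0 := Nat.pos_of_mem_divisors hs.1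
    dsimp only at hd0 ⊢
    rw [Nat.mul_div_cancel_left _ hd0, Nat.mul_div_cancel_left _ hd0]
  · rintro ⟨⟨x, y⟩, d⟩ hs
    rw [Finset.mem_sigma] at hs
    have hd0 := Nat.pos_of_mem_divisors hs.2
    have hd' := Nat.dvd_of_mem_divisors hs.2
    rw [Nat.dvd_gcd_iff] at hd'
    dsimp only at hd0 hd' ⊢
    obtain ⟨⟨u, rfl⟩, ⟨v, rfl⟩⟩ := hd'
    rw [Nat.mul_div_cancel_left _ hd0, Nat.mul_div_cancel_left _ hd0, hW d u v hd0.ne',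
      show d * u * (d * v) = d ^ 2 * (u * v) by ring, Nat.mul_div_cancel_left _ (pow_pos hd0 2)]
    push_cast
    ring

end EtaShimura

namespace EtaShimura

/-! ### Kronecker symbols -/

lemma chiFour_mod (m : ℤ) : chiFour m = chiFour (m % 4) := by
  unfold chiFour; rw [Int.emod_emod]

lemma chiEight_mod (m : ℤ) : chiEight m = chiEight (m % 8) := by
  unfold chiEight; rw [Int.emod_emod]

lemma chiTwelve_mod (m : ℤ) : chiTwelve m = chiTwelve (m % 12) := by
  unfold chiTwelve; rw [Int.emod_emod]

lemma chiFour_mul (m n : ℤ) : chiFour (m * n) = chiFour m * chiFour n := by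
  rw [chiFour_mod, Int.mul_emod, ← chiFour_mod, chiFour_mod m, chiFour_mod n]
  have h1 := Int.emod_nonneg m (show (4 : ℤ) ≠ 0 by norm_num)
  have h2 := Int.emod_lt_of_pos m (show (0 : ℤ) < 4 by norm_num)
  have h3 := Int.emod_nonneg n (show (4 : ℤ) ≠ 0 by norm_num)
  have h4 := Int.emod_lt_of_pos n (show (0 : ℤ) < 4 by norm_num)
  generalize m % 4 = i at *
  generalize n % 4 = j at *
  interval_cases i <;> interval_cases j <;> rfl

lemma chiEight_mul (m n : ℤ) : chiEight (m * n) = chiEight m * chiEight n := by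
  rw [chiEight_mod, Int.mul_emod, ← chiEight_mod, chiEight_mod m, chiEight_mod n]
  have h1 := Int.emod_nonneg m (show (8 : ℤ) ≠ 0 by norm_num)
  have h2 := Int.emod_lt_of_pos m (show (0 : ℤ) < 8 by norm_num)
  have h3 := Int.emod_nonneg n (show (8 : ℤ) ≠ 0 by norm_num)
  have h4 := Int.emod_lt_of_pos n (show (0 : ℤ) < 8 by norm_num)
  generalize m % 8 = i at *
  generalize n % 8 = j at *
  interval_cases i <;> interval_cases j <;> rfl

lemma chiTwelve_mul (m n : ℤ) : chiTwelve (m * n) = chiTwelve m * chiTwelve n := by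
  rw [chiTwelve_mod, Int.mul_emod, ← chiTwelve_mod, chiTwelve_mod m, chiTwelve_mod n]
  have h1 := Int.emod_nonneg m (show (12 : ℤ) ≠ 0 by norm_num)
  have h2 := Int.emod_lt_of_pos m (show (0 : ℤ) < 12 by norm_num)
  have h3 := Int.emod_nonneg n (show (12 : ℤ) ≠ 0 by norm_num)
  have h4 := Int.emod_lt_of_pos n (show (0 : ℤ) < 12 by norm_num)
  generalize m % 12 = i at *
  generalize n % 12 = j at *
  interval_cases i <;> interval_cases j <;> rfl

lemma chiFour_sq {m : ℤ} (h : m % 2 = 1) : chiFour m ^ 2 = 1 := by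
  unfold chiFour; split_ifs <;> omega

lemma chiTwelve_sq {m : ℤ} (h : m % 6 = 1 ∨ m % 6 = 5) : chiTwelve m ^ 2 = 1 := by
  unfold chiTwelve; split_ifs <;> omega

lemma kronecker_of_even {a : ℤ} (ha : a % 2 = 0) {n : ℕ} (hn : n % 2 = 0) : kronecker a n = 0 := by
  unfold kronecker
  split_ifs with h0 h1
  · omega
  · rfl
  · have h2 : ZMod.χ₈ (a : ZMod 8) = 0 := by
      rw [ZMod.χ₈_int_eq_if_mod_eight, if_pos ha]
    have h3 : n.factorization 2 ≠ 0 :=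
      (Nat.Prime.factorization_pos_of_dvd Nat.prime_two h0 (Nat.dvd_of_mod_eq_zero hn)).ne'
    rw [h2, zero_pow h3, zero_mul]

lemma kronecker_of_odd (a : ℤ) {n : ℕ} (hn : n % 2 = 1) : kronecker a n = jacobiSym a n := by
  have h0 : n ≠ 0 := by omega
  have h3 : n.factorization 2 = 0 := Nat.factorization_eq_zero_of_not_dvd (by omega)
  rw [kronecker, if_neg h0, h3, pow_zero, pow_zero, one_mul, Nat.div_one]

lemma jacobiSym_three {n : ℕ} (hn : n % 2 = 1) : jacobiSym 3 n = chiTwelve n := by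
  rw [jacobiSym.mod_right 3 (Nat.odd_iff.mpr hn), chiTwelve_mod]
  norm_num
  have h1 : n % 12 < 12 := Nat.mod_lt _ (by norm_num)
  have h2 : n % 12 % 2 = 1 := by omega
  have h3 : (n : ℤ) % 12 = ((n % 12 : ℕ) : ℤ) := by push_cast; rfl
  rw [h3]
  generalize n % 12 = r at *
  interval_cases r <;> first | omega | norm_num [chiTwelve]

lemma jacobiSym_two {n : ℕ} (hn : n % 2 = 1) : jacobiSym 2 n = chiEight n := by
  rw [jacobiSym.at_two (Nat.odd_iff.mpr hn), ZMod.χ₈_nat_eq_if_mod_eight, chiEight]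
  split_ifs <;> omega

lemma jacobiSym_neg_one {n : ℕ} (hn : n % 2 = 1) : jacobiSym (-1) n = chiFour n := by
  rw [jacobiSym.at_neg_one (Nat.odd_iff.mpr hn), ZMod.χ₄_nat_eq_if_mod_four, chiFour]
  split_ifs <;> omega

lemma kronecker_one (n : ℕ) : kronecker 1 n = 1 := by
  unfold kronecker
  split_ifs with h0 h1
  · rfl
  · exact absurd rfl h1
  · simp

lemma kronecker_neg_four (n : ℕ) : kronecker (-4) n = chiFour n := by
  rcases Nat.mod_two_eq_zero_or_one n with h | h
  · rw [kronecker_of_even (by norm_num) h, chiFour_eq_zero (by omega)]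
  · rw [kronecker_of_odd _ h, show (-4 : ℤ) = -1 * 4 by norm_num, jacobiSym.mul_left,
      jacobiSym.at_four (Nat.odd_iff.mpr h), jacobiSym_neg_one h, mul_one]

lemma kronecker_eight (n : ℕ) : kronecker 8 n = chiEight n := by
  rcases Nat.mod_two_eq_zero_or_one n with h | h
  · rw [kronecker_of_even (by norm_num) h, chiEight_eq_zero (by omega)]
  · rw [kronecker_of_odd _ h, show (8 : ℤ) = 2 * 4 by norm_num, jacobiSym.mul_left,
      jacobiSym.at_four (Nat.odd_iff.mpr h), jacobiSym_two h, mul_one]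

lemma kronecker_neg_eight (n : ℕ) : kronecker (-8) n = chiFour n * chiEight n := by
  rcases Nat.mod_two_eq_zero_or_one n with h | h
  · rw [kronecker_of_even (by norm_num) h, chiEight_eq_zero (by omega), mul_zero]
  · rw [kronecker_of_odd _ h, show (-8 : ℤ) = -1 * 8 by norm_num, jacobiSym.mul_left,
      ← kronecker_of_odd 8 h, kronecker_eight, jacobiSym_neg_one h]

lemma kronecker_twelve (n : ℕ) : kronecker 12 n = chiTwelve n := by
  rcases Nat.mod_two_eq_zero_or_one n with h | h
  · rw [kronecker_of_even (by norm_num) h, chiTwelve_eq_zero (by omega) (by omega)]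
  · rw [kronecker_of_odd _ h, show (12 : ℤ) = 3 * 4 by norm_num, jacobiSym.mul_left,
      jacobiSym.at_four (Nat.odd_iff.mpr h), jacobiSym_three h, mul_one]

lemma kronecker_twentyFour (n : ℕ) : kronecker 24 n = chiTwelve n * chiEight n := by
  rcases Nat.mod_two_eq_zero_or_one n with h | h
  · rw [kronecker_of_even (by norm_num) h, chiEight_eq_zero (by omega), mul_zero]
  · rw [kronecker_of_odd _ h, show (24 : ℤ) = 12 * 2 by norm_num, jacobiSym.mul_left,
      ← kronecker_of_odd 12 h, kronecker_twelve, jacobiSym_two h]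

lemma kronecker_neg_twentyFour (n : ℕ) :
    kronecker (-24) n = chiFour n * (chiTwelve n * chiEight n) := by
  rcases Nat.mod_two_eq_zero_or_one n with h | h
  · rw [kronecker_of_even (by norm_num) h, chiEight_eq_zero (by omega), mul_zero, mul_zero]
  · rw [kronecker_of_odd _ h, show (-24 : ℤ) = -1 * 24 by norm_num, jacobiSym.mul_left,
      ← kronecker_of_odd 24 h, kronecker_twentyFour, jacobiSym_neg_one h]

/-! ### The lift of a theta series times an eigenform -/

/-- Only coefficients need comparing, since convergence is inherited from `G`. The factor `d^(k-1)`
of the Hecke relation and `d^ν` of the weight combine to `d^(l-1)`. -/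
theorem isFirstEtaLift_of_weights {N : ℕ} {χ : DirichletCharacter ℂ N} {k : ℤ} {a : ℕ → ℂ}
    (H : HeckeRelation (fun d => χ (d : ZMod N) * (d : ℂ) ^ (k - 1)) a) {g : ℍ → ℂ}
    (hg : HasQExp 1 a g) {r ν : ℕ} {δ : ℤ} {e : ℤ → ℤ} {F : ℍ → ℂ}
    (hF : IsThetaSeries (etaDenominator r) e F) {α β α' β' : ℕ} (hα : α ≠ 0) (hβ : β ≠ 0)
    (hα' : α' ≠ 0) (hβ' : β' ≠ 0) {W W' : ℕ → ℕ → ℤ}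
    (hW : ∀ d x y : ℕ, d ≠ 0 → W (d * x) (d * y) = (kronecker δ d * (d : ℤ) ^ ν) * W x y)
    (hW' : ∀ d x y : ℕ, d ≠ 0 → W' (d * x) (d * y) = (kronecker δ d * (d : ℤ) ^ ν) * W' x y)
    (h0 : W 0 0 + W' 0 0 = 0)
    (hK : ∀ n, n ≠ 0 → (kronecker (etaDiscriminant r) n : ℂ) *
      thetaCoeff (etaDenominator r) e a n =
      ∑ p ∈ linearReps α β n, (W p.1 p.2 : ℂ) * a (p.1 * p.2) +
      ∑ p ∈ linearReps α' β' n, (W' p.1 p.2 : ℂ) * a (p.1 * p.2))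
    {G : ℍ → ℂ} (hG : HasQExp 1 (fun n =>
      ∑ p ∈ linearReps α β n, (W p.1 p.2 : ℂ) * (a p.1 * a p.2) +
      ∑ p ∈ linearReps α' β' n, (W' p.1 p.2 : ℂ) * (a p.1 * a p.2)) G) {l : ℤ}
    (hl : l = k + ν) : IsFirstEtaLift r l (charMul χ δ) (F * g) G := by
  have hD : etaDenominator r ≠ 0 := by unfold etaDenominator; split_ifs <;> norm_num
  refine HasQExp.congr hG (fun n => ?_) rfl
  unfold etaLiftCoeff
  simp only [coeff_theta_mul hD hF hg]
  -- The lift has no constant term, since `0` has an empty divisor set; that of `G` is `a(0)²` times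
  -- the sum of the weights at the origin.
  rcases eq_or_ne n 0 with rfl | hn
  · have hS : ∀ {α β : ℕ}, linearReps α β 0 = {(0, 0)} := by
      intro α β
      ext p
      simp only [linearReps, zero_add, Finset.range_one, Finset.mem_filter, Finset.mem_product,
        Finset.mem_singleton, Prod.ext_iff]
      exact ⟨fun h => h.1, fun h => ⟨h, by simp [h.1, h.2]⟩⟩
    simp only [Nat.divisors_zero, Finset.sum_empty, hS, Finset.sum_singleton]
    rw [← add_mul, ← Int.cast_add, h0, Int.cast_zero, zero_mul]
  · rw [sum_linearReps_hecke H hα hβ hW hn, sum_linearReps_hecke H hα' hβ' hW' hn,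
      ← Finset.sum_add_distrib]
    refine Finset.sum_congr rfl fun d hd => ?_
    have hd0 := Nat.pos_of_mem_divisors hd
    have hd' := Nat.dvd_of_mem_divisors hd
    have hnd : n / d ≠ 0 := (Nat.div_pos (Nat.le_of_dvd (Nat.pos_of_ne_zero hn) hd') hd0).ne'
    have hdC : (d : ℂ) ≠ 0 := Nat.cast_ne_zero.mpr hd0.ne'
    rw [← mul_add, ← hK _ hnd, charMul, hl, show k + (ν : ℤ) - 1 = k - 1 + ν by ring,
      zpow_add₀ hdC, zpow_natCast]
    push_cast
    ring

theorem isFirstEtaLift_of_weight {N : ℕ} {χ : DirichletCharacter ℂ N} {k : ℤ} {a : ℕ → ℂ}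
    (H : HeckeRelation (fun d => χ (d : ZMod N) * (d : ℂ) ^ (k - 1)) a) {g : ℍ → ℂ}
    (hg : HasQExp 1 a g) {r ν : ℕ} {δ : ℤ} {e : ℤ → ℤ} {F : ℍ → ℂ}
    (hF : IsThetaSeries (etaDenominator r) e F) {α β : ℕ} (hα : α ≠ 0) (hβ : β ≠ 0)
    {W : ℕ → ℕ → ℤ}
    (hW : ∀ d x y : ℕ, d ≠ 0 → W (d * x) (d * y) = (kronecker δ d * (d : ℤ) ^ ν) * W x y)
    (h0 : W 0 0 = 0)
    (hK : ∀ n, n ≠ 0 → (kronecker (etaDiscriminant r) n : ℂ) *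
      thetaCoeff (etaDenominator r) e a n =
      ∑ p ∈ linearReps α β n, (W p.1 p.2 : ℂ) * a (p.1 * p.2))
    {G : ℍ → ℂ} (hG : HasQExp 1 (fun n =>
      ∑ p ∈ linearReps α β n, (W p.1 p.2 : ℂ) * (a p.1 * a p.2)) G) {l : ℤ}
    (hl : l = k + ν) : IsFirstEtaLift r l (charMul χ δ) (F * g) G := by
  refine isFirstEtaLift_of_weights H hg hF hα hβ one_ne_zero one_ne_zero (W' := fun _ _ => 0)
    hW (fun _ _ _ _ => (mul_zero _).symm) (by rw [h0]; rfl) (fun n hn => ?_) ?_ hl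
  · simpa using hK n hn
  · simpa using hG

lemma hasQExp_linearReps {α β : ℕ} (hα : α ≠ 0) (hβ : β ≠ 0) {c d : ℕ → ℂ} {F G : ℍ → ℂ}
    (hF : HasQExp 1 (spread α c) F) (hG : HasQExp 1 (spread β d) G) :
    HasQExp 1 (fun n => ∑ p ∈ linearReps α β n, c p.1 * d p.2) (F * G) :=
  (hF.mul hG).congr (fun n => (sum_spread_mul_spread hα hβ c d n).symm) rfl

lemma spread_one (c : ℕ → ℂ) : spread 1 c = c := by
  funext n
  simp [spread]

lemma nat_mul_spread (α : ℕ) (c : ℕ → ℂ) :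
    (fun n : ℕ => (n : ℂ) * spread α c n) = spread α fun x => (α : ℂ) * x * c x := by
  funext n
  unfold spread
  split_ifs with h
  · obtain ⟨x, rfl⟩ := h
    rcases Nat.eq_zero_or_pos α with rfl | hα
    · simp
    · rw [Nat.mul_div_cancel_left _ hα]
      push_cast
      rfl
  · rw [mul_zero]

lemma HasQExp.normalizedDeriv_spread {α : ℕ} {c : ℕ → ℂ} {F : ℍ → ℂ}
    (hF : HasQExp 1 (spread α c) F) : HasQExp 1 (spread α fun x => (α : ℂ) * x * c x)
      (Derivative.normalizedDerivOfComplex F) := by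
  rw [← nat_mul_spread]
  exact hF.normalizedDeriv

lemma rankinCohen_one (k : ℤ) (f g : ℍ → ℂ) :
    rankinCohen k k 1 f g = (k : ℂ) • (Derivative.normalizedDerivOfComplex g * f -
      g * Derivative.normalizedDerivOfComplex f) := by
  funext z
  simp [rankinCohen, Finset.sum_range_succ]
  ring

/-- Differentiation produces the factor `αx - βy`, which up to sign is the theta variable `m`; this
is why weight 3/2 theta series lead to brackets. -/
lemma hasQExp_rankinCohen (k : ℤ) {α β : ℕ} (hα : α ≠ 0) (hβ : β ≠ 0) {c d : ℕ → ℂ}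
    {F G : ℍ → ℂ} (hF : HasQExp 1 (spread β c) F) (hG : HasQExp 1 (spread α d) G) :
    HasQExp 1 (fun n => ∑ p ∈ linearReps α β n,
      ((k : ℂ) * ((α : ℂ) * p.1 - β * p.2)) * (d p.1 * c p.2)) (rankinCohen k k 1 F G) := by
  refine HasQExp.congr (((hasQExp_linearReps hα hβ hG.normalizedDeriv_spread hF).sub
    (hasQExp_linearReps hα hβ hG hF.normalizedDeriv_spread)).smul (k : ℂ))
    (fun n => ?_) (rankinCohen_one k F G)
  rw [← Finset.sum_sub_distrib, Finset.mul_sum]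
  refine Finset.sum_congr rfl fun p _ => ?_
  ring

end EtaShimura

namespace EtaShimura

/-! ### Normalized eigenforms -/

section Eigenform

variable {N : ℕ} [NeZero N] {k : ℤ} {χ : DirichletCharacter ℂ N}
  {f : ModularForm ((Gamma1 N).map (Matrix.SpecialLinearGroup.mapGL ℝ)) k}

lemma hasQExp_modularForm (f : ModularForm ((Gamma1 N).map (Matrix.SpecialLinearGroup.mapGL ℝ)) k) :
    HasQExp 1 (fun n => (qExpansion 1 (f : ℍ → ℂ)).coeff n) f :=
  fun z => ModularForm.hasSum_qExpansion f one_pos (by simp) z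

lemma IsNormalizedEigenform.heckeRelation (hf : IsNormalizedEigenform χ f) :
    HeckeRelation (fun d => χ (d : ZMod N) * (d : ℂ) ^ (k - 1))
      (fun n => (qExpansion 1 (f : ℍ → ℂ)).coeff n) := by
  have hq := hasQExp_modularForm f
  set a : ℕ → ℂ := fun n => (qExpansion 1 (f : ℍ → ℂ)).coeff n
  have a1 : a 1 = 1 := hf.normalized
  refine heckeRelation_of_prime (by simp) (fun m n => ?_) a1 fun p hp n => ?_
  · push_cast
    rw [map_mul, mul_zpow]
    ring
  · obtain ⟨c, hc⟩ := hf.eigen p hp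
    have h1 := (hq.opU hp.ne_zero).add
      ((hq.opV hp.ne_zero).smul (χ (p : ZMod N) * (p : ℂ) ^ (k - 1)))
    have h2 := hq.smul c
    rw [← hc] at h2
    have h3 : ∀ n, c * a n = a (p * n) + χ (p : ZMod N) * (p : ℂ) ^ (k - 1) * spread p a n :=
      fun n => by rw [← h2.qExpansion_coeff one_pos n, ← h1.qExpansion_coeff one_pos n]; rfl
    -- The coefficient at 1 identifies the eigenvalue as `a(p)`: as `p ∤ 1`, the `V_p` term does not
    -- contribute.
    have hp1 := h3 1
    rw [a1, mul_one, mul_one, spread, if_neg (fun h => hp.one_lt.ne' (Nat.dvd_one.mp h)), mul_zero,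
      add_zero] at hp1
    rw [← hp1, h3 n, spread, mul_ite, mul_zero]

/-- A form of weight 0 is constant, which contradicts `a(1) = 1`. It is needed to cancel the factor
`k` of the brackets. -/
lemma IsNormalizedEigenform.weight_ne_zero (hf : IsNormalizedEigenform χ f) : k ≠ 0 := by
  rintro rfl
  obtain ⟨c, hc⟩ := f.eq_const_of_weight_zero
  have h : HasQExp 1 (fun n => if n = 0 then c else 0) f := fun z => by
    rw [hc]
    rw [Function.const_apply]
    convert hasSum_ite_eq (0 : ℕ) c using 2 with n
    split_ifs with h <;> simp [h]
  have h1 := hf.normalized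
  rw [h.qExpansion_coeff one_pos] at h1
  simp at h1

end Eigenform

/-! ### Combinatorial identities for the coefficients of the theta series -/

lemma thetaCoeff_eight_identity {e : ℤ → ℤ} (he : ∀ m, e (-m) = e m) (a : ℕ → ℂ)
    {W : ℕ → ℕ → ℤ}
    (hodd : ∀ x y : ℕ, x % 2 = 1 → chiFour ((x : ℤ) + 2 * y) * e ((x : ℤ) - 2 * y) = W x y)
    (heven : ∀ n, n % 2 = 0 → ∑ p ∈ linearReps 1 2 n, (W p.1 p.2 : ℂ) * a (p.1 * p.2) = 0)
    (n : ℕ) :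
    (kronecker (-4) n : ℂ) * thetaCoeff 8 e a n =
      ∑ p ∈ linearReps 1 2 n, (W p.1 p.2 : ℂ) * a (p.1 * p.2) := by
  rw [kronecker_neg_four]
  rcases Nat.mod_two_eq_zero_or_one n with h | h
  · rw [heven n h, chiFour_eq_zero (by omega), Int.cast_zero, zero_mul]
  · rw [thetaCoeff_eight he a h, Finset.mul_sum]
    refine Finset.sum_congr rfl fun p hp => ?_
    rw [mem_linearReps one_ne_zero two_ne_zero] at hp
    have hn : (n : ℤ) = (p.1 : ℤ) + 2 * p.2 := by omega
    rw [← hodd p.1 p.2 (by omega), hn]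
    push_cast
    ring

lemma thetaCoeff_twentyFour_identity {e : ℤ → ℤ} (he : ∀ m, e (-m) = e m) (a : ℕ → ℂ)
    {W W' : ℕ → ℕ → ℤ}
    (hW : ∀ x y : ℕ, (x + 6 * y) % 6 = 1 ∨ (x + 6 * y) % 6 = 5 →
      chiTwelve ((x : ℤ) + 6 * y) * e ((x : ℤ) - 6 * y) = W x y)
    (hW' : ∀ x y : ℕ, (2 * x + 3 * y) % 6 = 1 ∨ (2 * x + 3 * y) % 6 = 5 →
      chiTwelve (2 * (x : ℤ) + 3 * y) * e (2 * (x : ℤ) - 3 * y) = W' x y)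
    (hbad : ∀ n, n % 2 = 0 ∨ n % 3 = 0 →
      ∑ p ∈ linearReps 1 6 n, (W p.1 p.2 : ℂ) * a (p.1 * p.2) +
      ∑ p ∈ linearReps 2 3 n, (W' p.1 p.2 : ℂ) * a (p.1 * p.2) = 0) (n : ℕ) :
    (kronecker 12 n : ℂ) * thetaCoeff 24 e a n =
      ∑ p ∈ linearReps 1 6 n, (W p.1 p.2 : ℂ) * a (p.1 * p.2) +
      ∑ p ∈ linearReps 2 3 n, (W' p.1 p.2 : ℂ) * a (p.1 * p.2) := by
  rw [kronecker_twelve]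
  by_cases h : n % 6 = 1 ∨ n % 6 = 5
  · rw [thetaCoeff_twentyFour he a h, mul_add, Finset.mul_sum, Finset.mul_sum]
    congr 1
    · refine Finset.sum_congr rfl fun p hp => ?_
      rw [mem_linearReps one_ne_zero (by norm_num)] at hp
      have hn : (n : ℤ) = (p.1 : ℤ) + 6 * p.2 := by omega
      rw [← hW p.1 p.2 (by omega), hn]
      push_cast
      ring
    · refine Finset.sum_congr rfl fun p hp => ?_
      rw [mem_linearReps two_ne_zero (by norm_num)] at hp
      have hn : (n : ℤ) = 2 * (p.1 : ℤ) + 3 * p.2 := by omega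
      rw [← hW' p.1 p.2 (by omega), hn]
      push_cast
      ring
  · rw [hbad n (by omega), chiTwelve_eq_zero (by omega) (by omega), Int.cast_zero, zero_mul]

lemma sum_linearReps_cancel_of_even {n : ℕ} (hn : n % 2 = 0) {W W' : ℕ → ℕ → ℤ} (a : ℕ → ℂ)
    (h : ∀ x y : ℕ, 2 * x + 3 * (2 * y) = n → W (2 * x) y = -W' x (2 * y)) :
    ∑ p ∈ linearReps 1 6 n, (W p.1 p.2 : ℂ) * a (p.1 * p.2) +
      ∑ p ∈ linearReps 2 3 n, (W' p.1 p.2 : ℂ) * a (p.1 * p.2) = 0 := by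
  rw [sum_linearReps_of_even hn (fun x y => (W x y : ℂ) * a (x * y)), ← Finset.sum_add_distrib]
  refine Finset.sum_eq_zero fun p hp => ?_
  obtain ⟨x, y⟩ := p
  rw [mem_linearReps two_ne_zero three_ne_zero] at hp
  dsimp only at hp ⊢
  obtain ⟨v, rfl⟩ : ∃ v, y = 2 * v := ⟨y / 2, by omega⟩
  rw [Nat.mul_div_cancel_left _ two_pos, h x v hp, show 2 * x * v = x * (2 * v) by ring]
  push_cast
  ring

lemma sum_linearReps_cancel_of_three_dvd {n : ℕ} (hn : n % 3 = 0) {W W' : ℕ → ℕ → ℤ}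
    (a : ℕ → ℂ) (h : ∀ x y : ℕ, 2 * (3 * x) + 3 * y = n → W (3 * y) x = -W' (3 * x) y) :
    ∑ p ∈ linearReps 1 6 n, (W p.1 p.2 : ℂ) * a (p.1 * p.2) +
      ∑ p ∈ linearReps 2 3 n, (W' p.1 p.2 : ℂ) * a (p.1 * p.2) = 0 := by
  rw [sum_linearReps_of_three_dvd hn (fun x y => (W x y : ℂ) * a (x * y)),
    ← Finset.sum_add_distrib]
  refine Finset.sum_eq_zero fun p hp => ?_
  obtain ⟨x, y⟩ := p
  rw [mem_linearReps two_ne_zero three_ne_zero] at hp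
  dsimp only at hp ⊢
  obtain ⟨u, rfl⟩ : ∃ u, x = 3 * u := ⟨x / 3, by omega⟩
  rw [Nat.mul_div_cancel_left _ three_pos, h u y hp, show 3 * y * u = 3 * u * y by ring]
  push_cast
  ring

lemma chiFour_sub_two_mul (x y : ℤ) : chiFour (x - 2 * y) = chiFour (x + 2 * y) := by
  rw [chiFour_mod, chiFour_mod (x + 2 * y)]
  congr 1
  omega

lemma chiFour_sub_six_mul (x y : ℤ) : chiFour (x - 6 * y) = chiFour (x + 6 * y) := by
  rw [chiFour_mod, chiFour_mod (x + 6 * y)]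
  congr 1
  omega

lemma chiTwelve_sub_six_mul (x y : ℤ) : chiTwelve (x - 6 * y) = chiTwelve (x + 6 * y) := by
  rw [chiTwelve_mod, chiTwelve_mod (x + 6 * y)]
  congr 1
  omega

lemma neg_one_pow_eq_ite (y : ℕ) : (-1 : ℤ) ^ y = if y % 2 = 0 then 1 else -1 := by
  rcases Nat.even_or_odd y with h | h
  · rw [h.neg_one_pow, if_pos (Nat.even_iff.mp h)]
  · rw [h.neg_one_pow, if_neg (by rw [Nat.odd_iff.mp h]; norm_num)]

/-- The arguments differ by `4y`, and adding 4 to an odd number changes the sign of `(8/·)`. This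
sign is the source of the terms with `g ∣ U_2 ∣ V_2`. -/
lemma chiEight_sub_two_mul {x : ℤ} (hx : x % 2 = 1) (y : ℕ) :
    chiEight (x - 2 * y) = chiEight (x + 2 * y) * (-1) ^ y := by
  rw [neg_one_pow_eq_ite]
  unfold chiEight
  split_ifs <;> omega

lemma chiEight_sub_six_mul {x : ℤ} (hx : x % 2 = 1) (y : ℕ) :
    chiEight (x - 6 * y) = chiEight (x + 6 * y) * (-1) ^ y := by
  rw [neg_one_pow_eq_ite]
  unfold chiEight
  split_ifs <;> omega

lemma chiTwelve_sub_three_mul {x y : ℤ} (hy : y % 2 = 1) :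
    chiTwelve (2 * x - 3 * y) = -chiTwelve (2 * x + 3 * y) := by
  unfold chiTwelve
  split_ifs <;> omega

lemma chiFour_sub_three_mul {x y : ℤ} (hy : y % 2 = 1) :
    chiFour (2 * x - 3 * y) = -chiFour (2 * x + 3 * y) := by
  unfold chiFour
  split_ifs <;> omega

/-- Moving from `2x - 3y` to `2x + 3y` changes `(8/·)` by `(-1)^x`, and this sign is `(-4/(2x + 3y))
(-4/3y)`. Hence the inner twist of `g(3z)` by `(-4/·)`. -/
lemma chiEight_sub_three_mul {x y : ℤ} (hy : y % 2 = 1) :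
    chiEight (2 * x - 3 * y) =
      chiFour (2 * x + 3 * y) * chiEight (2 * x + 3 * y) * chiFour (3 * y) := by
  have h : chiFour (2 * x + 3 * y) * chiFour (3 * y) = if x % 2 = 0 then 1 else -1 := by
    unfold chiFour
    split_ifs <;> omega
  rw [mul_right_comm, h]
  unfold chiEight
  split_ifs <;> omega

lemma chiFour_mul_chiFour_three_mul (x : ℕ) {y : ℤ} (hy : y % 2 = 1) :
    chiFour (2 * (3 * x) + 3 * y) * chiFour (3 * y) = (-1) ^ x := by
  rw [neg_one_pow_eq_ite]
  unfold chiFour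
  split_ifs <;> omega

/-- The sign `(-1)^y` is invariant under scaling by odd `d`, and `(8/d)` vanishes for even `d`. -/
lemma chiEight_mul_neg_one_pow (d y : ℕ) : chiEight d * (-1) ^ (d * y) = chiEight d * (-1) ^ y := by
  rcases Nat.even_or_odd d with h | h
  · rw [chiEight_eq_zero (by have := Nat.even_iff.mp h; omega), zero_mul, zero_mul]
  · rw [pow_mul, h.neg_one_pow]

lemma chiFour_sq_mul_chiEight (d : ℤ) : chiFour d ^ 2 * chiEight d = chiEight d := by
  rcases Int.emod_two_eq_zero_or_one d with h | h
  · rw [chiEight_eq_zero h, mul_zero]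
  · rw [chiFour_sq h, one_mul]

end EtaShimura

namespace EtaShimura

/-! ### The individual lifts -/

lemma kronecker_neg_four_mul (m n : ℕ) :
    kronecker (-4) (m * n) = kronecker (-4) m * kronecker (-4) n := by
  simp only [kronecker_neg_four, Nat.cast_mul, chiFour_mul]

lemma kronecker_eight_mul (m n : ℕ) : kronecker 8 (m * n) = kronecker 8 m * kronecker 8 n := by
  simp only [kronecker_eight, Nat.cast_mul, chiEight_mul]

lemma kronecker_neg_eight_mul (m n : ℕ) :
    kronecker (-8) (m * n) = kronecker (-8) m * kronecker (-8) n := by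
  simp only [kronecker_neg_eight, Nat.cast_mul, chiEight_mul, chiFour_mul]
  ring

lemma kronecker_twelve_mul (m n : ℕ) : kronecker 12 (m * n) = kronecker 12 m * kronecker 12 n := by
  simp only [kronecker_twelve, Nat.cast_mul, chiTwelve_mul]

lemma kronecker_twentyFour_mul (m n : ℕ) :
    kronecker 24 (m * n) = kronecker 24 m * kronecker 24 n := by
  simp only [kronecker_twentyFour, Nat.cast_mul, chiTwelve_mul, chiEight_mul]
  ring

lemma kronecker_neg_twentyFour_mul (m n : ℕ) :
    kronecker (-24) (m * n) = kronecker (-24) m * kronecker (-24) n := by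
  simp only [kronecker_neg_twentyFour, Nat.cast_mul, chiTwelve_mul, chiEight_mul, chiFour_mul]
  ring

/-- Homogeneity of `w` is required only after multiplication by `(δ/d)`, so nothing is asked where
that symbol is zero. -/
lemma weight_homogeneous {δ : ℤ} (hδ : ∀ m n, kronecker δ (m * n) = kronecker δ m * kronecker δ n)
    {w : ℕ → ℕ → ℤ} {ν : ℕ}
    (hw : ∀ d x y : ℕ, kronecker δ d * w (d * x) (d * y) = kronecker δ d * (d : ℤ) ^ ν * w x y)
    (α β d x y : ℕ) :
    kronecker δ (α * (d * x) + β * (d * y)) * w (d * x) (d * y) =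
      kronecker δ d * (d : ℤ) ^ ν * (kronecker δ (α * x + β * y) * w x y) := by
  rw [show α * (d * x) + β * (d * y) = d * (α * x + β * y) by ring, hδ, mul_right_comm, hw]
  ring

/-! ### Coefficient sums of products, brackets and twists -/

/-- The sums `∑_{α x + β y = n} w x y`. -/
def repSum (α β : ℕ) (w : ℕ → ℕ → ℂ) (n : ℕ) : ℂ := ∑ p ∈ linearReps α β n, w p.1 p.2

lemma repSum_congr (α β : ℕ) {w v : ℕ → ℕ → ℂ} (h : ∀ x y, w x y = v x y) (n : ℕ) :
    repSum α β w n = repSum α β v n := Finset.sum_congr rfl fun p _ => h p.1 p.2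

lemma repSum_sub (α β : ℕ) (w v : ℕ → ℕ → ℂ) (n : ℕ) :
    repSum α β w n - repSum α β v n = repSum α β (fun x y => w x y - v x y) n :=
  (Finset.sum_sub_distrib _ _).symm

lemma mul_repSum (α β : ℕ) (c : ℂ) (w : ℕ → ℕ → ℂ) (n : ℕ) :
    c * repSum α β w n = repSum α β (fun x y => c * w x y) n := Finset.mul_sum _ _ _

lemma kronecker_mul_repSum {α β : ℕ} (hα : α ≠ 0) (hβ : β ≠ 0) (δ : ℤ) (w : ℕ → ℕ → ℂ) (n : ℕ) :
    kronecker δ n * repSum α β w n =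
      repSum α β (fun x y => kronecker δ (α * x + β * y) * w x y) n := by
  rw [mul_repSum]
  refine Finset.sum_congr rfl fun p hp => ?_
  dsimp only
  rw [(mem_linearReps hα hβ).mp hp]

lemma HasQExp.twist_repSum {α β : ℕ} (hα : α ≠ 0) (hβ : β ≠ 0) {w : ℕ → ℕ → ℂ} {G : ℍ → ℂ}
    (hG : HasQExp 1 (repSum α β w) G) (δ : ℤ) :
    HasQExp 1 (repSum α β fun x y => kronecker δ (α * x + β * y) * w x y)
      (EtaShimura.twist G δ) :=
  (hG.twist δ).congr (fun n => (kronecker_mul_repSum hα hβ δ w n).symm) rfl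

lemma HasQExp.twist_repSum_add {α β α' β' : ℕ} (hα : α ≠ 0) (hβ : β ≠ 0) (hα' : α' ≠ 0)
    (hβ' : β' ≠ 0) {w w' : ℕ → ℕ → ℂ} {G : ℍ → ℂ}
    (hG : HasQExp 1 (fun n => repSum α β w n + repSum α' β' w' n) G) (δ : ℤ) :
    HasQExp 1 (fun n => repSum α β (fun x y => kronecker δ (α * x + β * y) * w x y) n +
      repSum α' β' (fun x y => kronecker δ (α' * x + β' * y) * w' x y) n)
      (EtaShimura.twist G δ) :=
  (hG.twist δ).congr (fun n => by
    rw [← kronecker_mul_repSum hα hβ, ← kronecker_mul_repSum hα' hβ', mul_add]) rfl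

lemma HasQExp.smul_repSum {α β : ℕ} {w : ℕ → ℕ → ℂ} {G : ℍ → ℂ}
    (hG : HasQExp 1 (repSum α β w) G) (c : ℂ) :
    HasQExp 1 (repSum α β fun x y => c * w x y) (c • G) :=
  (hG.smul c).congr (fun n => (mul_repSum α β c w n).symm) rfl

lemma HasQExp.smul_repSum_add {α β α' β' : ℕ} {w w' : ℕ → ℕ → ℂ} {G : ℍ → ℂ}
    (hG : HasQExp 1 (fun n => repSum α β w n + repSum α' β' w' n) G) (c : ℂ) :
    HasQExp 1 (fun n => repSum α β (fun x y => c * w x y) n +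
      repSum α' β' (fun x y => c * w' x y) n) (c • G) :=
  (hG.smul c).congr (fun n => by rw [← mul_repSum, ← mul_repSum, mul_add]) rfl

lemma HasQExp.sub_repSum {α β α' β' : ℕ} {w w' : ℕ → ℕ → ℂ} {F G : ℍ → ℂ}
    (hF : HasQExp 1 (repSum α β w) F) (hG : HasQExp 1 (repSum α' β' w') G) :
    HasQExp 1 (fun n => repSum α β w n + repSum α' β' (fun x y => -1 * w' x y) n) (F - G) :=
  (hF.sub hG).congr (fun n => by rw [← mul_repSum]; ring) rfl

lemma hasQExp_mul_repSum {α β : ℕ} (hα : α ≠ 0) (hβ : β ≠ 0) {c d : ℕ → ℂ} {F G : ℍ → ℂ}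
    (hF : HasQExp 1 (spread α c) F) (hG : HasQExp 1 (spread β d) G) :
    HasQExp 1 (repSum α β fun x y => c x * d y) (F * G) := hasQExp_linearReps hα hβ hF hG

lemma hasQExp_rankinCohen_repSum (k : ℤ) {α β : ℕ} (hα : α ≠ 0) (hβ : β ≠ 0) {c d : ℕ → ℂ}
    {F G : ℍ → ℂ} (hF : HasQExp 1 (spread β c) F) (hG : HasQExp 1 (spread α d) G) :
    HasQExp 1 (repSum α β fun x y => k * (α * x - β * y) * (d x * c y)) (rankinCohen k k 1 F G) :=
  hasQExp_rankinCohen k hα hβ hF hG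

lemma hasQExp_opV_opU_two {a : ℕ → ℂ} {g : ℍ → ℂ} (hg : HasQExp 1 a g) :
    HasQExp 1 (fun n => if 2 ∣ n then a n else 0) (opV 2 (opU 2 g)) := by
  refine ((hg.opU two_ne_zero).opV two_ne_zero).congr (fun n => ?_) rfl
  unfold spread
  dsimp only
  split_ifs with h
  · rw [Nat.mul_div_cancel' h]
  · rfl

/-- The sign `(-1)^y` is twice the indicator of even `y`, minus one. -/
lemma HasQExp.two_mul_sub {α β : ℕ} {w : ℕ → ℕ → ℂ} {a : ℕ → ℂ} {F G : ℍ → ℂ}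
    (hF : HasQExp 1 (repSum α β fun x y => w x y * (a x * if 2 ∣ y then a y else 0)) F)
    (hG : HasQExp 1 (repSum α β fun x y => w x y * (a x * a y)) G) :
    HasQExp 1 (repSum α β fun x y => w x y * (-1) ^ y * (a x * a y)) (2 * F - G) := by
  refine ((hF.smul_repSum 2).sub hG).congr (fun n => ?_) ?_
  · rw [repSum_sub]
    refine repSum_congr α β (fun x y => ?_) n
    split_ifs with h
    · rw [(even_iff_two_dvd.mpr h).neg_one_pow]
      ring
    · rw [(Nat.not_even_iff_odd.mp fun h' => h (even_iff_two_dvd.mp h')).neg_one_pow]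
      ring
  · funext z
    simp

lemma hasQExp_twist_opV_three {a : ℕ → ℂ} {g : ℍ → ℂ} (hg : HasQExp 1 a g) (δ : ℤ) :
    HasQExp 1 (spread 3 fun y => (kronecker δ (3 * y) : ℂ) * a y) (twist (opV 3 g) δ) := by
  refine ((hg.opV three_ne_zero).twist δ).congr (fun n => ?_) rfl
  unfold spread
  dsimp only
  split_ifs with h
  · rw [Nat.mul_div_cancel' h]
  · rw [mul_zero]

lemma HasQExp.spread_one {a : ℕ → ℂ} {g : ℍ → ℂ} (hg : HasQExp 1 a g) :
    HasQExp 1 (spread 1 a) g := by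
  rwa [EtaShimura.spread_one]

/-! ### Reduction of a lift to congruence identities for its weights -/

section Lifts

variable {N : ℕ} {χ : DirichletCharacter ℂ N} {k : ℤ} {a : ℕ → ℂ} {g : ℍ → ℂ}

lemma hasQExp_mul_opV (hg : HasQExp 1 a g) {β : ℕ} (hβ : β ≠ 0) :
    HasQExp 1 (repSum 1 β fun x y => a x * a y) (g * opV β g) :=
  hasQExp_mul_repSum one_ne_zero hβ hg.spread_one (hg.opV hβ)

lemma hasQExp_opV_mul_opV (hg : HasQExp 1 a g) :
    HasQExp 1 (repSum 2 3 fun x y => a x * a y) (opV 2 g * opV 3 g) :=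
  hasQExp_mul_repSum two_ne_zero three_ne_zero (hg.opV two_ne_zero) (hg.opV three_ne_zero)

lemma hasQExp_alternating (hg : HasQExp 1 a g) {β : ℕ} (hβ : β ≠ 0) :
    HasQExp 1 (repSum 1 β fun x y => 1 * (-1) ^ y * (a x * a y))
      (2 * (g * opV β (opV 2 (opU 2 g))) - g * opV β g) := by
  have h := hasQExp_mul_repSum (d := fun n => if 2 ∣ n then a n else 0) one_ne_zero hβ
    hg.spread_one ((hasQExp_opV_opU_two hg).opV hβ)
  exact HasQExp.two_mul_sub (w := fun _ _ => 1)
    (h.congr (repSum_congr _ _ fun x y => one_mul _) rfl)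
    ((hasQExp_mul_opV hg hβ).congr (repSum_congr _ _ fun x y => one_mul _) rfl)

lemma hasQExp_alternating_rankinCohen (hg : HasQExp 1 a g) {β : ℕ} (hβ : β ≠ 0) (k : ℤ) :
    HasQExp 1 (repSum 1 β fun x y => k * (((1 : ℕ) : ℂ) * x - β * y) * (-1) ^ y * (a x * a y))
      (2 * rankinCohen k k 1 (opV β (opV 2 (opU 2 g))) g - rankinCohen k k 1 (opV β g) g) := by
  have h1 := hasQExp_rankinCohen_repSum k (c := fun n => if 2 ∣ n then a n else 0) one_ne_zero hβ
    ((hasQExp_opV_opU_two hg).opV hβ) hg.spread_one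
  have h2 := hasQExp_rankinCohen_repSum k one_ne_zero hβ (hg.opV hβ) hg.spread_one
  exact HasQExp.two_mul_sub (w := fun x y => k * (((1 : ℕ) : ℂ) * x - β * y)) h1 h2

/-- The involution `(x, y) ↦ (2y, x/2)` preserves `xy` and negates `W`, so the sum is its own
negative. -/
lemma sum_linearReps_antisymm {n : ℕ} (hn : n % 2 = 0) {W : ℕ → ℕ → ℤ} (a : ℕ → ℂ)
    (hW : ∀ x y : ℕ, W (2 * x) y = -W (2 * y) x) :
    ∑ p ∈ linearReps 1 2 n, (W p.1 p.2 : ℂ) * a (p.1 * p.2) = 0 := by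
  have e := sum_linearReps_one_two_of_even hn (fun x y => (W x y : ℂ) * a (x * y))
  have e2 : ∑ p ∈ linearReps 1 2 n, (W (2 * p.2) (p.1 / 2) : ℂ) * a (2 * p.2 * (p.1 / 2)) =
      -∑ p ∈ linearReps 1 2 n, (W p.1 p.2 : ℂ) * a (p.1 * p.2) := by
    rw [← Finset.sum_neg_distrib]
    refine Finset.sum_congr rfl fun p hp => ?_
    obtain ⟨x, y⟩ := p
    rw [mem_linearReps one_ne_zero two_ne_zero] at hp
    dsimp only at hp ⊢
    obtain ⟨u, rfl⟩ : ∃ u, x = 2 * u := ⟨x / 2, by omega⟩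
    rw [Nat.mul_div_cancel_left _ two_pos, show 2 * y * u = 2 * u * y by ring, hW y u]
    push_cast
    ring
  rw [e2] at e
  linear_combination e / 2

theorem isFirstEtaLift_eight (H : HeckeRelation (fun d => χ (d : ZMod N) * (d : ℂ) ^ (k - 1)) a)
    (hg : HasQExp 1 a g) {ν : ℕ} {δ : ℤ} {e : ℤ → ℤ} {F : ℍ → ℂ} (hF : IsThetaSeries 8 e F)
    (W : ℕ → ℕ → ℤ) {G : ℍ → ℂ} {w : ℕ → ℕ → ℂ} (hG : HasQExp 1 (repSum 1 2 w) G) {l : ℤ}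
    (hl : l = k + ν)
    (hw : ∀ x y, W x y * (a x * a y) = w x y)
    (hW : ∀ d x y : ℕ, W (d * x) (d * y) = (kronecker δ d * (d : ℤ) ^ ν) * W x y)
    (h0 : W 0 0 = 0) (he : ∀ m, e (-m) = e m)
    (hodd : ∀ x y : ℕ, x % 2 = 1 → chiFour ((x : ℤ) + 2 * y) * e ((x : ℤ) - 2 * y) = W x y)
    (hev : ∀ x y : ℕ, W (2 * x) y = -W (2 * y) x) :
    IsFirstEtaLift 3 l (charMul χ δ) (F * g) G := by
  have hD : etaDenominator 3 = 8 := if_pos dvd_rfl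
  have hd : etaDiscriminant 3 = -4 := if_pos dvd_rfl
  refine isFirstEtaLift_of_weight H hg (r := 3) (e := e) (by rwa [hD]) one_ne_zero two_ne_zero
    (W := W) (fun d x y _ => hW d x y) h0 (fun n _ => ?_)
    (hG.congr (repSum_congr 1 2 hw) rfl) hl
  rw [hD, hd]
  exact thetaCoeff_eight_identity he a hodd (fun n hn => sum_linearReps_antisymm hn a hev) n

theorem isFirstEtaLift_twentyFour
    (H : HeckeRelation (fun d => χ (d : ZMod N) * (d : ℂ) ^ (k - 1)) a)
    (hg : HasQExp 1 a g) {ν : ℕ} {δ : ℤ} {e : ℤ → ℤ} {F : ℍ → ℂ} (hF : IsThetaSeries 24 e F)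
    (W W' : ℕ → ℕ → ℤ) {G : ℍ → ℂ} {w w' : ℕ → ℕ → ℂ}
    (hG : HasQExp 1 (fun n => repSum 1 6 w n + repSum 2 3 w' n) G) {l : ℤ} (hl : l = k + ν)
    (hw : ∀ x y, W x y * (a x * a y) = w x y) (hw' : ∀ x y, W' x y * (a x * a y) = w' x y)
    (hW : ∀ d x y : ℕ, W (d * x) (d * y) = (kronecker δ d * (d : ℤ) ^ ν) * W x y)
    (hW' : ∀ d x y : ℕ, W' (d * x) (d * y) = (kronecker δ d * (d : ℤ) ^ ν) * W' x y)
    (h0 : W 0 0 + W' 0 0 = 0) (he : ∀ m, e (-m) = e m)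
    (hsix : ∀ x y : ℕ, (x + 6 * y) % 6 = 1 ∨ (x + 6 * y) % 6 = 5 →
      chiTwelve ((x : ℤ) + 6 * y) * e ((x : ℤ) - 6 * y) = W x y)
    (hthree : ∀ x y : ℕ, (2 * x + 3 * y) % 6 = 1 ∨ (2 * x + 3 * y) % 6 = 5 →
      chiTwelve (2 * (x : ℤ) + 3 * y) * e (2 * (x : ℤ) - 3 * y) = W' x y)
    (hev : ∀ x y : ℕ, W (2 * x) y = -W' x (2 * y))
    (hdvd : ∀ x y : ℕ, y % 2 = 1 → W (3 * y) x = -W' (3 * x) y) :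
    IsFirstEtaLift 1 l (charMul χ δ) (F * g) G := by
  have hD : etaDenominator 1 = 24 := if_neg (by norm_num)
  have hd : etaDiscriminant 1 = 12 := if_neg (by norm_num)
  refine isFirstEtaLift_of_weights H hg (r := 1) (e := e) (by rwa [hD]) one_ne_zero (by norm_num)
    two_ne_zero three_ne_zero (W := W) (W' := W') (fun d x y _ => hW d x y)
    (fun d x y _ => hW' d x y) h0 (fun n _ => ?_)
    (hG.congr (fun n => congrArg₂ (· + ·) (repSum_congr 1 6 hw n) (repSum_congr 2 3 hw' n)) rfl) hl
  rw [hD, hd]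
  refine thetaCoeff_twentyFour_identity he a hsix hthree (fun n hn => ?_) n
  rcases Nat.mod_two_eq_zero_or_one n with h2 | h2
  · exact sum_linearReps_cancel_of_even h2 a fun x y _ => hev x y
  -- Even `n` being settled, `n = 6x + 3y` is odd here, which forces `y` to be odd.
  · exact sum_linearReps_cancel_of_three_dvd (by omega) a fun x y h => hdvd x y (by omega)

end Lifts

end EtaShimura

/-! ### The ten eta-quotients -/

namespace EtaShimura

section Lifts

variable {N : ℕ} {χ : DirichletCharacter ℂ N} {k : ℤ} {a : ℕ → ℂ} {g : ℍ → ℂ}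

/-- For even `n` both weights contain a Kronecker symbol of even discriminant and vanish, so
cancellation is trivial. -/
lemma kronecker_mul_eq_neg {δ ε : ℤ} (hδ : δ % 2 = 0) (hε : ε % 2 = 0) {m n : ℕ}
    (hm : m % 2 = 0) (hn : n % 2 = 0) (u v : ℤ) : kronecker δ m * u = -(kronecker ε n * v) := by
  rw [kronecker_of_even hδ hm, kronecker_of_even hε hn, zero_mul, zero_mul, neg_zero]

theorem lift_eta
    (H : HeckeRelation (fun d => χ (d : ZMod N) * (d : ℂ) ^ (k - 1)) a) (hg : HasQExp 1 a g) :
    IsFirstEtaLift 1 k (charMul χ 1) (etaAt 1 * g) (g * opV 6 g - opV 2 g * opV 3 g) := by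
  have h6 : (6 : ℕ) ≠ 0 := by norm_num
  refine isFirstEtaLift_twentyFour H hg (ν := 0) isThetaSeries_eta (fun _ _ => 1) (fun _ _ => -1)
    ((hasQExp_mul_opV hg h6).sub_repSum (hasQExp_opV_mul_opV hg)) (by simp) (fun x y => by simp)
    (fun x y => by simp) (fun d x y => by simp [kronecker_one])
    (fun d x y => by simp [kronecker_one]) (by norm_num) chiTwelve_neg (fun x y h => ?_)
    (fun x y h => ?_) (fun _ _ => (neg_neg 1).symm) (fun _ _ _ => (neg_neg 1).symm)
  · rw [chiTwelve_sub_six_mul, ← pow_two, chiTwelve_sq (by omega)]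
  · rw [chiTwelve_sub_three_mul (by omega), mul_neg, ← pow_two, chiTwelve_sq (by omega)]

theorem lift_eta_one_four
    (H : HeckeRelation (fun d => χ (d : ZMod N) * (d : ℂ) ^ (k - 1)) a) (hg : HasQExp 1 a g) :
    IsFirstEtaLift 3 k (charMul χ (-8)) (etaAt 1 * etaAt 4 / etaAt 2 * g)
      (twist (2 * (g * opV 2 (opV 2 (opU 2 g))) - g * opV 2 g) (-8)) := by
  refine isFirstEtaLift_eight H hg (ν := 0) isThetaSeries_eta_one_four
    (fun x y => kronecker (-8) (1 * x + 2 * y) * (-1) ^ y)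
    ((hasQExp_alternating hg two_ne_zero).twist_repSum one_ne_zero two_ne_zero (-8)) (by simp)
    (fun x y => ?_) (weight_homogeneous kronecker_neg_eight_mul (w := fun _ y => (-1) ^ y)
      (fun d x y => ?_) 1 2)
    (by simp [kronecker]) (fun m => by rw [chiFour_neg, chiEight_neg, neg_sq]) (fun x y h => ?_)
    (fun x y => kronecker_mul_eq_neg rfl rfl (by omega) (by omega) _ _)
  · push_cast
    ring
  · rw [kronecker_neg_eight, mul_assoc, chiEight_mul_neg_one_pow]
    ring
  · rw [chiFour_sq (by omega), chiEight_sub_two_mul (by omega), kronecker_neg_eight]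
    push_cast
    ring_nf

theorem lift_eta_sq_two
    (H : HeckeRelation (fun d => χ (d : ZMod N) * (d : ℂ) ^ (k - 1)) a) (hg : HasQExp 1 a g) : IsFirstEtaLift 3 k (charMul χ (-4)) (etaAt 2 ^ 2 / etaAt 1 * g)
    (twist (g * opV 2 g) (-4)) := by
  refine isFirstEtaLift_eight H hg (ν := 0) isThetaSeries_eta_sq_two
    (fun x y => kronecker (-4) (1 * x + 2 * y) * 1)
    ((hasQExp_mul_opV hg two_ne_zero).twist_repSum one_ne_zero two_ne_zero (-4)) (by simp)
    (fun x y => ?_) (weight_homogeneous kronecker_neg_four_mul (w := fun _ _ => 1)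
      (fun d x y => by simp) 1 2)
    (by simp [kronecker]) (fun m => by rw [chiFour_neg, neg_sq]) (fun x y h => ?_)
    (fun x y => kronecker_mul_eq_neg rfl rfl (by omega) (by omega) _ _)
  · push_cast
    ring
  · rw [chiFour_sq (by omega), kronecker_neg_four]
    push_cast
    ring_nf

theorem lift_eta_sq_three
    (H : HeckeRelation (fun d => χ (d : ZMod N) * (d : ℂ) ^ (k - 1)) a) (hg : HasQExp 1 a g) :
    IsFirstEtaLift 1 k (charMul χ 12) (etaAt 2 * etaAt 3 ^ 2 / (etaAt 1 * etaAt 6) * g)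
      (twist (g * opV 6 g + opV 2 g * opV 3 g) 12) := by
  have h6 : (6 : ℕ) ≠ 0 := by norm_num
  refine isFirstEtaLift_twentyFour H hg (ν := 0) isThetaSeries_eta_sq_three
    (fun x y => kronecker 12 (1 * x + 6 * y) * 1) (fun x y => kronecker 12 (2 * x + 3 * y) * 1)
    (((hasQExp_mul_opV hg h6).add (hasQExp_opV_mul_opV hg)).twist_repSum_add one_ne_zero h6
      two_ne_zero three_ne_zero 12) (by simp) (fun x y => ?_) (fun x y => ?_)
    (weight_homogeneous kronecker_twelve_mul (w := fun _ _ => 1) (fun d x y => by simp) 1 6)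
    (weight_homogeneous kronecker_twelve_mul (w := fun _ _ => 1) (fun d x y => by simp) 2 3)
    (by simp [kronecker]) (fun m => by rw [chiTwelve_neg]) (fun x y h => ?_) (fun x y h => ?_)
    (fun x y => kronecker_mul_eq_neg rfl rfl (by omega) (by omega) _ _) (fun x y _ => ?_)
  · push_cast
    ring
  · push_cast
    ring
  · rw [chiTwelve_sub_six_mul, chiTwelve_sq (by omega), kronecker_twelve]
    push_cast
    ring_nf
  · rw [chiTwelve_sub_three_mul (by omega), neg_sq, chiTwelve_sq (by omega), kronecker_twelve]
    push_cast
    ring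
  · rw [kronecker_twelve, kronecker_twelve, chiTwelve_eq_zero (by omega) (by omega),
      chiTwelve_eq_zero (by omega) (by omega), zero_mul, neg_zero]

theorem lift_eta_cube_two
    (H : HeckeRelation (fun d => χ (d : ZMod N) * (d : ℂ) ^ (k - 1)) a) (hg : HasQExp 1 a g) :
    IsFirstEtaLift 1 k (charMul χ 8) (etaAt 2 ^ 3 / (etaAt 1 * etaAt 4) * g)
      (twist (2 * (g * opV 6 (opV 2 (opU 2 g))) - g * opV 6 g) 8
        - twist (opV 2 g * twist (opV 3 g) (-4)) (-8)) := by
  have h6 : (6 : ℕ) ≠ 0 := by norm_num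
  refine isFirstEtaLift_twentyFour H hg (ν := 0) isThetaSeries_eta_cube_two
    (fun x y => kronecker 8 (1 * x + 6 * y) * (-1) ^ y)
    (fun x y => kronecker (-8) (2 * x + 3 * y) * -kronecker (-4) (3 * y))
    (((hasQExp_alternating hg h6).twist_repSum one_ne_zero h6 8).sub_repSum
      ((hasQExp_mul_repSum two_ne_zero three_ne_zero (hg.opV two_ne_zero)
        (hasQExp_twist_opV_three hg (-4))).twist_repSum two_ne_zero three_ne_zero (-8))) (by simp)
    (fun x y => ?_) (fun x y => ?_) (weight_homogeneous kronecker_eight_mul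
      (w := fun _ y => (-1) ^ y) (fun d x y => ?_) 1 6) (fun d x y => ?_) (by simp [kronecker])
    (fun m => by rw [chiTwelve_neg, chiEight_neg]) (fun x y h => ?_) (fun x y h => ?_)
    (fun x y => kronecker_mul_eq_neg rfl rfl (by omega) (by omega) _ _) (fun x y h => ?_)
  · push_cast
    ring
  · push_cast
    ring
  · rw [kronecker_eight, chiEight_mul_neg_one_pow]
    ring
  · rw [show 2 * (d * x) + 3 * (d * y) = d * (2 * x + 3 * y) by ring, kronecker_neg_eight_mul,
      show 3 * (d * y) = d * (3 * y) by ring, kronecker_neg_four_mul, kronecker_neg_eight d,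
      kronecker_neg_four d, kronecker_eight d]
    linear_combination (-kronecker (-8) (2 * x + 3 * y) * kronecker (-4) (3 * y)) *
      chiFour_sq_mul_chiEight d
  · rw [chiTwelve_sub_six_mul, ← mul_assoc, ← pow_two, chiTwelve_sq (by omega),
      chiEight_sub_six_mul (by omega), kronecker_eight]
    push_cast
    ring_nf
  · rw [chiTwelve_sub_three_mul (by omega), ← mul_assoc, mul_neg, ← pow_two,
      chiTwelve_sq (by omega), chiEight_sub_three_mul (by omega), kronecker_neg_eight,
      kronecker_neg_four]
    push_cast
    ring
  -- Neither weight need vanish when `3 ∣ n`. They cancel because the alternating sign `(-1)^x` of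
  -- one is the product of the two `(-4/·)` values in the other.
  · have e := chiFour_mul_chiFour_three_mul x (y := (y : ℤ)) (by omega)
    rw [show 1 * (3 * y) + 6 * x = 2 * (3 * x) + 3 * y by ring, kronecker_eight,
      kronecker_neg_eight, kronecker_neg_four]
    push_cast
    rw [← e]
    ring

theorem lift_eta_twelve
    (H : HeckeRelation (fun d => χ (d : ZMod N) * (d : ℂ) ^ (k - 1)) a) (hg : HasQExp 1 a g) :
    IsFirstEtaLift 1 k (charMul χ 24)
      (etaAt 1 * etaAt 4 * etaAt 6 ^ 5 / (etaAt 2 ^ 2 * etaAt 3 ^ 2 * etaAt 12 ^ 2) * g)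
      (twist (2 * (g * opV 6 (opV 2 (opU 2 g))) - g * opV 6 g) 24
        + twist (opV 2 g * twist (opV 3 g) (-4)) (-24)) := by
  have h6 : (6 : ℕ) ≠ 0 := by norm_num
  refine isFirstEtaLift_twentyFour H hg (ν := 0) isThetaSeries_eta_twelve
    (fun x y => kronecker 24 (1 * x + 6 * y) * (-1) ^ y)
    (fun x y => kronecker (-24) (2 * x + 3 * y) * kronecker (-4) (3 * y))
    (((hasQExp_alternating hg h6).twist_repSum one_ne_zero h6 24).add
      ((hasQExp_mul_repSum two_ne_zero three_ne_zero (hg.opV two_ne_zero)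
        (hasQExp_twist_opV_three hg (-4))).twist_repSum two_ne_zero three_ne_zero (-24))) (by simp)
    (fun x y => ?_) (fun x y => ?_) (weight_homogeneous kronecker_twentyFour_mul
      (w := fun _ y => (-1) ^ y) (fun d x y => ?_) 1 6) (fun d x y => ?_) (by simp [kronecker])
    (fun m => by rw [chiTwelve_neg, chiEight_neg]) (fun x y h => ?_) (fun x y h => ?_)
    (fun x y => kronecker_mul_eq_neg rfl rfl (by omega) (by omega) _ _) (fun x y h => ?_)
  · push_cast
    ring
  · push_cast
    ring
  · rw [kronecker_twentyFour, mul_assoc, chiEight_mul_neg_one_pow]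
    ring
  · rw [show 2 * (d * x) + 3 * (d * y) = d * (2 * x + 3 * y) by ring, kronecker_neg_twentyFour_mul,
      show 3 * (d * y) = d * (3 * y) by ring, kronecker_neg_four_mul, kronecker_neg_twentyFour d,
      kronecker_neg_four d, kronecker_twentyFour d]
    linear_combination (chiTwelve d * kronecker (-24) (2 * x + 3 * y) * kronecker (-4) (3 * y)) *
      chiFour_sq_mul_chiEight d
  · rw [chiTwelve_sub_six_mul, chiTwelve_sq (by omega), chiEight_sub_six_mul (by omega),
      kronecker_twentyFour]
    push_cast
    ring_nf
  · rw [chiTwelve_sub_three_mul (by omega), neg_sq, chiTwelve_sq (by omega),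
      chiEight_sub_three_mul (by omega), kronecker_neg_twentyFour, kronecker_neg_four]
    push_cast
    ring
  -- Here `3 ∣ n`, so the factor `(12/·)` makes both weights zero.
  · rw [kronecker_twentyFour, kronecker_neg_twentyFour, chiTwelve_eq_zero (by omega) (by omega),
      chiTwelve_eq_zero (by omega) (by omega)]
    ring

theorem lift_eta_cube
    (H : HeckeRelation (fun d => χ (d : ZMod N) * (d : ℂ) ^ (k - 1)) a) (hg : HasQExp 1 a g)
    (hk : k ≠ 0) :
    IsFirstEtaLift 3 (k + 1) (charMul χ 1) (etaAt 1 ^ 3 * g)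
      ((k : ℂ)⁻¹ • rankinCohen k k 1 (opV 2 g) g) := by
  have hkC : (k : ℂ) ≠ 0 := Int.cast_ne_zero.mpr hk
  refine isFirstEtaLift_eight H hg (ν := 1) isThetaSeries_eta_cube (fun x y => (x : ℤ) - 2 * y)
    ((hasQExp_rankinCohen_repSum k one_ne_zero two_ne_zero (hg.opV two_ne_zero)
      hg.spread_one).smul_repSum (k : ℂ)⁻¹) (by simp) (fun x y => ?_)
    (fun d x y => ?_) (by simp) (fun m => by rw [chiFour_neg, neg_mul_neg]) (fun x y h => ?_)
    (fun x y => ?_)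
  · push_cast
    field_simp
  · rw [kronecker_one]
    push_cast
    ring
  · rw [chiFour_sub_two_mul, ← mul_assoc, ← pow_two, chiFour_sq (by omega), one_mul]
  · push_cast
    ring

theorem lift_eta_pow_nine
    (H : HeckeRelation (fun d => χ (d : ZMod N) * (d : ℂ) ^ (k - 1)) a) (hg : HasQExp 1 a g)
    (hk : k ≠ 0) :
    IsFirstEtaLift 3 (k + 1) (charMul χ 8) (etaAt 2 ^ 9 / (etaAt 1 ^ 3 * etaAt 4 ^ 3) * g)
      ((k : ℂ)⁻¹ • twist (2 * rankinCohen k k 1 (opV 2 (opV 2 (opU 2 g))) g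
        - rankinCohen k k 1 (opV 2 g) g) 8) := by
  have hkC : (k : ℂ) ≠ 0 := Int.cast_ne_zero.mpr hk
  refine isFirstEtaLift_eight H hg (ν := 1) isThetaSeries_eta_pow_nine
    (fun x y => kronecker 8 (1 * x + 2 * y) * ((-1) ^ y * ((x : ℤ) - 2 * y)))
    (((hasQExp_alternating_rankinCohen hg two_ne_zero k).twist_repSum one_ne_zero two_ne_zero
      8).smul_repSum (k : ℂ)⁻¹) (by simp) (fun x y => ?_)
    (weight_homogeneous kronecker_eight_mul (w := fun x y => (-1) ^ y * ((x : ℤ) - 2 * y))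
      (fun d x y => ?_) 1 2)
    (by simp) (fun m => by rw [chiFour_neg, chiEight_neg, neg_mul_neg]) (fun x y h => ?_)
    (fun x y => kronecker_mul_eq_neg rfl rfl (by omega) (by omega) _ _)
  · push_cast
    field_simp
  · rw [kronecker_eight, ← mul_assoc, chiEight_mul_neg_one_pow]
    push_cast
    ring
  · have e := chiFour_sq (m := (x : ℤ) + 2 * y) (by omega)
    rw [chiFour_sub_two_mul, chiEight_sub_two_mul (by omega), kronecker_eight]
    push_cast
    rw [one_mul]
    linear_combination (((x : ℤ) - 2 * y) * chiEight ((x : ℤ) + 2 * y) * (-1) ^ y) * e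

theorem lift_eta_pow_five
    (H : HeckeRelation (fun d => χ (d : ZMod N) * (d : ℂ) ^ (k - 1)) a) (hg : HasQExp 1 a g)
    (hk : k ≠ 0) :
    IsFirstEtaLift 1 (k + 1) (charMul χ (-4)) (etaAt 1 ^ 5 / etaAt 2 ^ 2 * g)
      ((k : ℂ)⁻¹ • twist (rankinCohen k k 1 (opV 6 g) g
        + rankinCohen k k 1 (opV 3 g) (opV 2 g)) (-4)) := by
  have h6 : (6 : ℕ) ≠ 0 := by norm_num
  have hkC : (k : ℂ) ≠ 0 := Int.cast_ne_zero.mpr hk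
  refine isFirstEtaLift_twentyFour H hg (ν := 1) isThetaSeries_eta_pow_five
    (fun x y => kronecker (-4) (1 * x + 6 * y) * ((x : ℤ) - 6 * y))
    (fun x y => kronecker (-4) (2 * x + 3 * y) * (2 * (x : ℤ) - 3 * y))
    ((((hasQExp_rankinCohen_repSum k one_ne_zero h6 (hg.opV h6) hg.spread_one).add
      (hasQExp_rankinCohen_repSum k two_ne_zero three_ne_zero (hg.opV three_ne_zero)
        (hg.opV two_ne_zero))).twist_repSum_add one_ne_zero h6 two_ne_zero three_ne_zero
          (-4)).smul_repSum_add (k : ℂ)⁻¹) (by simp) (fun x y => ?_) (fun x y => ?_)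
    (weight_homogeneous kronecker_neg_four_mul (w := fun x y => (x : ℤ) - 6 * y)
      (fun d x y => by push_cast; ring) 1 6)
    (weight_homogeneous kronecker_neg_four_mul (w := fun x y => 2 * (x : ℤ) - 3 * y)
      (fun d x y => by push_cast; ring) 2 3) (by simp)
    (fun m => by rw [chiTwelve_neg, chiFour_neg]; ring) (fun x y h => ?_) (fun x y h => ?_)
    (fun x y => kronecker_mul_eq_neg rfl rfl (by omega) (by omega) _ _) (fun x y h => ?_)
  · push_cast
    field_simp
  · push_cast
    field_simp
  · have e := chiTwelve_sq (m := (x : ℤ) + 6 * y) (by omega)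
    rw [chiTwelve_sub_six_mul, chiFour_sub_six_mul, kronecker_neg_four]
    push_cast
    rw [one_mul]
    linear_combination (chiFour ((x : ℤ) + 6 * y) * ((x : ℤ) - 6 * y)) * e
  · have e := chiTwelve_sq (m := 2 * (x : ℤ) + 3 * y) (by omega)
    rw [chiTwelve_sub_three_mul (by omega), chiFour_sub_three_mul (by omega), kronecker_neg_four]
    push_cast
    linear_combination (chiFour (2 * (x : ℤ) + 3 * y) * (2 * (x : ℤ) - 3 * y)) * e
  · rw [show 1 * (3 * y) + 6 * x = 2 * (3 * x) + 3 * y by ring]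
    push_cast
    ring

theorem lift_eta_pow_thirteen
    (H : HeckeRelation (fun d => χ (d : ZMod N) * (d : ℂ) ^ (k - 1)) a) (hg : HasQExp 1 a g)
    (hk : k ≠ 0) :
    IsFirstEtaLift 1 (k + 1) (charMul χ (-8)) (etaAt 2 ^ 13 / (etaAt 1 ^ 5 * etaAt 4 ^ 5) * g)
      ((k : ℂ)⁻¹ • twist (2 * rankinCohen k k 1 (opV 6 (opV 2 (opU 2 g))) g
          - rankinCohen k k 1 (opV 6 g) g) (-8)
        + (k : ℂ)⁻¹ • twist (rankinCohen k k 1 (twist (opV 3 g) (-4)) (opV 2 g)) 8) := by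
  have h6 : (6 : ℕ) ≠ 0 := by norm_num
  have hkC : (k : ℂ) ≠ 0 := Int.cast_ne_zero.mpr hk
  refine isFirstEtaLift_twentyFour H hg (ν := 1) isThetaSeries_eta_pow_thirteen
    (fun x y => kronecker (-8) (1 * x + 6 * y) * ((-1) ^ y * ((x : ℤ) - 6 * y)))
    (fun x y => kronecker 8 (2 * x + 3 * y) * (kronecker (-4) (3 * y) * (2 * (x : ℤ) - 3 * y)))
    ((((hasQExp_alternating_rankinCohen hg h6 k).twist_repSum one_ne_zero h6 (-8)).smul_repSum
      (k : ℂ)⁻¹).add (((hasQExp_rankinCohen_repSum k two_ne_zero three_ne_zero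
        (hasQExp_twist_opV_three hg (-4)) (hg.opV two_ne_zero)).twist_repSum two_ne_zero
          three_ne_zero 8).smul_repSum (k : ℂ)⁻¹)) (by simp) (fun x y => ?_) (fun x y => ?_)
    (weight_homogeneous kronecker_neg_eight_mul (w := fun x y => (-1) ^ y * ((x : ℤ) - 6 * y))
      (fun d x y => ?_) 1 6) (fun d x y => ?_) (by simp)
    (fun m => by rw [chiTwelve_neg, chiFour_neg, chiEight_neg]; ring) (fun x y h => ?_)
    (fun x y h => ?_) (fun x y => kronecker_mul_eq_neg rfl rfl (by omega) (by omega) _ _)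
    (fun x y h => ?_)
  · push_cast
    field_simp
  · push_cast
    field_simp
  · rw [kronecker_neg_eight, ← mul_assoc, mul_assoc (chiFour d), chiEight_mul_neg_one_pow]
    push_cast
    ring
  · rw [show 2 * (d * x) + 3 * (d * y) = d * (2 * x + 3 * y) by ring, kronecker_eight_mul,
      show 3 * (d * y) = d * (3 * y) by ring, kronecker_neg_four_mul, kronecker_neg_eight d,
      kronecker_neg_four d, kronecker_eight d]
    push_cast
    ring
  · have e := chiTwelve_sq (m := (x : ℤ) + 6 * y) (by omega)
    rw [chiTwelve_sub_six_mul, chiFour_sub_six_mul, chiEight_sub_six_mul (by omega),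
      kronecker_neg_eight]
    push_cast
    rw [one_mul]
    linear_combination (chiFour ((x : ℤ) + 6 * y) * chiEight ((x : ℤ) + 6 * y) * (-1) ^ y *
      ((x : ℤ) - 6 * y)) * e
  · have e := chiTwelve_sq (m := 2 * (x : ℤ) + 3 * y) (by omega)
    have e4 := chiFour_sq (m := 2 * (x : ℤ) + 3 * y) (by omega)
    rw [chiTwelve_sub_three_mul (by omega), chiFour_sub_three_mul (by omega),
      chiEight_sub_three_mul (by omega), kronecker_neg_four, kronecker_eight]
    push_cast
    linear_combination (chiFour (2 * (x : ℤ) + 3 * y) ^ 2 * chiEight (2 * (x : ℤ) + 3 * y) *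
      chiFour (3 * (y : ℤ)) * (2 * (x : ℤ) - 3 * y)) * e + (chiEight (2 * (x : ℤ) + 3 * y) *
      chiFour (3 * (y : ℤ)) * (2 * (x : ℤ) - 3 * y)) * e4
  · have e := chiFour_mul_chiFour_three_mul x (y := (y : ℤ)) (by omega)
    have e4 := chiFour_sq (m := 2 * (3 * (x : ℤ)) + 3 * y) (by omega)
    rw [show 1 * (3 * y) + 6 * x = 2 * (3 * x) + 3 * y by ring, kronecker_eight,
      kronecker_neg_eight, kronecker_neg_four]
    push_cast
    rw [← e]
    linear_combination (chiEight (2 * (3 * (x : ℤ)) + 3 * y) * chiFour (3 * (y : ℤ)) *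
      (3 * (y : ℤ) - 6 * x)) * e4

end Lifts

end EtaShimura

/-! ### The theorem for a normalized eigenform -/

open EtaShimura in
theorem mainTheorem4 (N : ℕ) [NeZero N] (k : ℤ) (χ : DirichletCharacter ℂ N)
    (f : ModularForm ((CongruenceSubgroup.Gamma1 N).map (Matrix.SpecialLinearGroup.mapGL ℝ)) k)
    (hf : IsNormalizedEigenform χ f)
    (g gt : UpperHalfPlane → ℂ) (hg : g = ⇑f) (hgt : gt = opV 2 (opU 2 g)) :
    -- weight 1/2 eta-quotients
    IsFirstEtaLift 1 k (charMul χ 1) (etaAt 1 * g)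
      (g * opV 6 g - opV 2 g * opV 3 g) ∧
    IsFirstEtaLift 3 k (charMul χ (-8)) (etaAt 1 * etaAt 4 / etaAt 2 * g)
      (twist (2 * (g * opV 2 gt) - g * opV 2 g) (-8)) ∧
    IsFirstEtaLift 3 k (charMul χ (-4)) (etaAt 2 ^ 2 / etaAt 1 * g)
      (twist (g * opV 2 g) (-4)) ∧
    IsFirstEtaLift 1 k (charMul χ 12) (etaAt 2 * etaAt 3 ^ 2 / (etaAt 1 * etaAt 6) * g)
      (twist (g * opV 6 g + opV 2 g * opV 3 g) 12) ∧
    IsFirstEtaLift 1 k (charMul χ 8) (etaAt 2 ^ 3 / (etaAt 1 * etaAt 4) * g)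
      (twist (2 * (g * opV 6 gt) - g * opV 6 g) 8
        - twist (opV 2 g * twist (opV 3 g) (-4)) (-8)) ∧
    IsFirstEtaLift 1 k (charMul χ 24)
      (etaAt 1 * etaAt 4 * etaAt 6 ^ 5 / (etaAt 2 ^ 2 * etaAt 3 ^ 2 * etaAt 12 ^ 2) * g)
      (twist (2 * (g * opV 6 gt) - g * opV 6 g) 24
        + twist (opV 2 g * twist (opV 3 g) (-4)) (-24)) ∧
    -- weight 3/2 eta-quotients
    IsFirstEtaLift 3 (k + 1) (charMul χ 1) (etaAt 1 ^ 3 * g)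
      ((k : ℂ)⁻¹ • rankinCohen k k 1 (opV 2 g) g) ∧
    IsFirstEtaLift 3 (k + 1) (charMul χ 8) (etaAt 2 ^ 9 / (etaAt 1 ^ 3 * etaAt 4 ^ 3) * g)
      ((k : ℂ)⁻¹ •
        twist (2 * rankinCohen k k 1 (opV 2 gt) g - rankinCohen k k 1 (opV 2 g) g) 8) ∧
    IsFirstEtaLift 1 (k + 1) (charMul χ (-4)) (etaAt 1 ^ 5 / etaAt 2 ^ 2 * g)
      ((k : ℂ)⁻¹ •
        twist (rankinCohen k k 1 (opV 6 g) g + rankinCohen k k 1 (opV 3 g) (opV 2 g)) (-4)) ∧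
    IsFirstEtaLift 1 (k + 1) (charMul χ (-8)) (etaAt 2 ^ 13 / (etaAt 1 ^ 5 * etaAt 4 ^ 5) * g)
      ((k : ℂ)⁻¹ •
          twist (2 * rankinCohen k k 1 (opV 6 gt) g - rankinCohen k k 1 (opV 6 g) g) (-8)
        + (k : ℂ)⁻¹ •
          twist (rankinCohen k k 1 (twist (opV 3 g) (-4)) (opV 2 g)) 8) := by
  subst hg hgt
  have H := hf.heckeRelation
  have hq := hasQExp_modularForm f
  have hk := hf.weight_ne_zero
  exact ⟨lift_eta H hq, lift_eta_one_four H hq, lift_eta_sq_two H hq, lift_eta_sq_three H hq,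
    lift_eta_cube_two H hq, lift_eta_twelve H hq, lift_eta_cube H hq hk, lift_eta_pow_nine H hq hk,
    lift_eta_pow_five H hq hk, lift_eta_pow_thirteen H hq hk⟩
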